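/- For $c\in[1,2)$ let $\mathcal F_c$ be the family of all functions $h:[x_0,\infty)\to[1,\infty)$, for some $x_0\ge 1$, such that (i) $h\in C^3([x_0,\infty))$, and $h'(x)>0$, $h''(x)>0$ for all $x\ge x_0$; (ii) there are a real function $\vartheta\in C^2([x_0,\infty))$ and a constant $C_h>0$ with $$h(x)=C_h\,x^c\exp\Big(\int_{x_0}^x\frac{\vartheta(t)}{t}\,dt\Big)\qquad (x\ge x_0),$$ and, if $c>1$, then $\vartheta(x)\to0$, $x\vartheta'(x)\to0$ and $x^2\vartheta''(x)\to0$ as $x\to\infty$; (iii) if $c=1$, then $\vartheta$ is positive and decreasing; for every $\varepsilon>0$ there is a constant $A_\varepsilon$ with $1/\vartheta(x)\le A_\varepsilon x^{\varepsilon}$ for all $x\ge x_0$; and, as $x\to\infty$, $x/h(x)\to0$, $\vartheta(x)\to0$, $x\vartheta'(x)/\vartheta(x)\to0$ and $x^2\vartheta''(x)/\vartheta(x)\to0$. **Theorem.** For $k\in\{1,2,3\}$ let $c_k\in[1,4/3)$ and $\gamma_k:=1/c_k$ be such that $$\begin{aligned} 4(1-\gamma_1)+\tfrac52(1-\gamma_2)+\tfrac52(1-\gamma_3)&<1,\\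 \tfrac52(1-\gamma_1)+4(1-\gamma_2)+\tfrac52(1-\gamma_3)&<1,\\ \tfrac52(1-\gamma_1)+\tfrac52(1-\gamma_2)+4(1-\gamma_3)&<1. \end{aligned}$$ Let $h_k\in\mathcal F_{c_k}$ with domain $[x_{0,k},\infty)$, and let $\varphi_k:[h_k(x_{0,k}),\infty)\to[x_{0,k},\infty)$ be its inverse. Let $N_0$ be a positive integer such that, for each $k$, $N_0\ge x_{0,k}$ and $n\mapsto\lfloor h_k(n)\rfloor$ is injective on the integers $n\ge N_0$. For positive integers $\lambda$ put $$r_{h_1,h_2,h_3}(\lambda):=\#\{(x_1,x_2,x_3)\in\mathbb Z^3:\ x_1,x_2,x_3\ge N_0,\ \lfloor h_1(x_1)\rfloor+\lfloor h_2(x_2)\rfloor+\lfloor h_3(x_3)\rfloor=\lambda\}.$$ Then, as $\lambda\to\infty$, $$r_{h_1,h_2,h_3}(\lambda)=\frac{\Gamma(\gamma_1)\Gamma(\gamma_2)\Gamma(\gamma_3)}{\Gamma(\gamma_1+\gamma_2+\gamma_3)}\,\lambda^2\varphi_1'(\lambda)\varphi_2'(\lambda)\varphi_3'(\lambda)+o\big(\lambda^2\varphi_1'(\lambda)\varphi_2'(\lambda)\varphi_3'(\lambda)\big).$$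 -/

import Mathlib

open Set Filter Topology Asymptotics

/-- `IsRegularlyVarying c x₀ h`: the restriction of `h` to `[x₀, ∞)` is a function
`[x₀, ∞) → [1, ∞)` that belongs to the class `𝓕_c` of `c`-regularly varying functions.
All derivatives are derivatives on `[x₀, ∞)` (one-sided at `x₀`); the values of `h` to the left
of `x₀` play no role. -/
structure IsRegularlyVarying (c x₀ : ℝ) (h : ℝ → ℝ) : Prop where
  one_le_exponent : 1 ≤ c
  exponent_lt_two : c < 2
  one_le_start : 1 ≤ x₀
  one_le : ∀ x ∈ Ici x₀, 1 ≤ h x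
  contDiffOn : ContDiffOn ℝ 3 h (Ici x₀)
  deriv_pos : ∀ x ∈ Ici x₀, 0 < derivWithin h (Ici x₀) x
  deriv_two_pos : ∀ x ∈ Ici x₀, 0 < iteratedDerivWithin 2 h (Ici x₀) x
  representation : ∃ ϑ : ℝ → ℝ,
    ContDiffOn ℝ 2 ϑ (Ici x₀) ∧
    (∃ C : ℝ, 0 < C ∧ ∀ x ∈ Ici x₀,
      h x = C * x ^ c * Real.exp (∫ t in x₀..x, ϑ t / t)) ∧
    (1 < c →
      Tendsto ϑ atTop (𝓝 0) ∧
      Tendsto (fun x => x * derivWithin ϑ (Ici x₀) x) atTop (𝓝 0) ∧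
      Tendsto (fun x => x ^ 2 * iteratedDerivWithin 2 ϑ (Ici x₀) x) atTop (𝓝 0)) ∧
    (c = 1 →
      (∀ x ∈ Ici x₀, 0 < ϑ x) ∧
      AntitoneOn ϑ (Ici x₀) ∧
      (∀ ε : ℝ, 0 < ε → ∃ A : ℝ, ∀ x ∈ Ici x₀, 1 / ϑ x ≤ A * x ^ ε) ∧
      Tendsto (fun x => x / h x) atTop (𝓝 0) ∧
      Tendsto ϑ atTop (𝓝 0) ∧
      Tendsto (fun x => x * derivWithin ϑ (Ici x₀) x / ϑ x) atTop (𝓝 0) ∧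
      Tendsto (fun x => x ^ 2 * iteratedDerivWithin 2 ϑ (Ici x₀) x / ϑ x) atTop (𝓝 0))

/-- The generalized arithmetic sphere of radius `l`: all triples of integers `≥ N₀` with
`⌊h₁(x₁)⌋ + ⌊h₂(x₂)⌋ + ⌊h₃(x₃)⌋ = l`. -/
def arithmeticSphere (h : Fin 3 → ℝ → ℝ) (N₀ l : ℕ) : Set (Fin 3 → ℕ) :=
  {x | (∀ k, N₀ ≤ x k) ∧ ∑ k, ⌊h k (x k)⌋ = (l : ℤ)}

/-- The number of points of the generalized arithmetic sphere of radius `l`. -/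
noncomputable def sphereCount (h : Fin 3 → ℝ → ℝ) (N₀ l : ℕ) : ℕ :=
  (arithmeticSphere h N₀ l).ncard

/-! The counting function is a coefficient of a product of three generating functions, one for the
indicator $F_k$ of the values $\lfloor h_k(n)\rfloor$. An integer $m$ is such a value exactly when
$[\varphi_k(m),\varphi_k(m+1))$ contains an integer, so for large $m$ one has
$F_k(m)=\lceil\varphi_k(m+1)\rceil-\lceil\varphi_k(m)\rceil$. With $\psi(x)=\{x\}-1/2$ this equals
$\varphi_k(m+1)-\varphi_k(m)$ plus the increment of $\psi(-\varphi_k)$. Hence $F_k$ should behave on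
average like the smooth sequence $u_k(m)=\varphi_k'(m)$.

The comparison is uniform in frequency: the exponential sums of $D_k=F_k-u_k$ up to $n$ are
$O(n^{3/4})$ (`exists_model`). The source of this is a bound for twisted sums of $\psi(-\varphi_k)$.
The sawtooth is replaced by a difference quotient of its periodic antiderivative, whose Fourier
series converges absolutely (`norm_sum_sawtooth_le`), and each harmonic is estimated by van der
Corput's second derivative test (`norm_sum_unitExp_le_of_second_diff`). The size of $\varphi_k''$
needed there is about $y^{\gamma_k-2}$, up to $y^{\pm\varepsilon}$. When $c_k=1$ the factor
$\vartheta$ tends to zero, and the assumed lower bound on $\vartheta$ keeps the curvature from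
degenerating.

The identity $F_0F_1F_2-u_0u_1u_2=D_0F_1F_2+D_1u_0F_2+D_2u_0u_1$ leaves three error terms. Discrete
orthogonality and Cauchy–Schwarz bound each by the supremum of one exponential sum times the mean
squares of the other two sequences (`abs_coeff_mul_mul_le`). The first error is therefore at most
$n^{3/4+(\gamma_1+\gamma_2)/2+\varepsilon}$, against a main term of order
$n^{\gamma_0+\gamma_1+\gamma_2-1}$ up to $n^{\pm\varepsilon}$. It is negligible once
$4(1-\gamma_0)+2(1-\gamma_1)+2(1-\gamma_2)<1$, which the hypotheses imply; the other two are
symmetric.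

The main term is a triple convolution of regularly varying sequences. After rescaling, each
convolution is an integral that converges by domination to a Beta integral, and two Beta integrals
combine to the stated Gamma quotient (`RegularlyVaryingSeq.tendsto_coeff_triple`). -/

/-! ### Exponential sums: Kusmin–Landau and van der Corput. -/

/-- The additive character `x ↦ exp (2 π i x)` of `ℝ`. -/
noncomputable def unitExp (x : ℝ) : ℂ := Complex.exp (2 * Real.pi * x * Complex.I)

lemma unitExp_eq_exp_ofReal_mul_I (x : ℝ) :
    unitExp x = Complex.exp ((2 * Real.pi * x : ℝ) * Complex.I) := by
  simp [unitExp]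

lemma norm_unitExp (x : ℝ) : ‖unitExp x‖ = 1 := by
  rw [unitExp_eq_exp_ofReal_mul_I, Complex.norm_exp_ofReal_mul_I]

lemma unitExp_add (x y : ℝ) : unitExp (x + y) = unitExp x * unitExp y := by
  simp only [unitExp, ← Complex.exp_add]
  congr 1
  push_cast
  ring

lemma unitExp_intCast (n : ℤ) : unitExp n = 1 := by
  rw [unitExp, Complex.exp_eq_one_iff]
  exact ⟨n, by push_cast; ring⟩

lemma unitExp_zero : unitExp 0 = 1 := by simp [unitExp]

lemma unitExp_neg (x : ℝ) : unitExp (-x) = (starRingEnd ℂ) (unitExp x) := by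
  rw [unitExp, unitExp, ← Complex.exp_conj]
  congr 1
  simp only [map_mul, Complex.conj_I, Complex.conj_ofReal, map_ofNat, Complex.ofReal_neg]
  ring

lemma norm_sum_unitExp_le_card (s : Finset ℕ) (f : ℕ → ℝ) :
    ‖∑ m ∈ s, unitExp (f m)‖ ≤ s.card := by
  refine (norm_sum_le _ _).trans ?_
  simp [norm_unitExp]

/-- A reciprocal of `unitExp x - 1` whose real part is constant. -/
noncomputable def geomFactor (x : ℝ) : ℂ :=
  -(1 / 2 : ℝ) - ((1 / 2 * (Real.cos (Real.pi * x) / Real.sin (Real.pi * x)) : ℝ) : ℂ) * Complex.I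

lemma geomFactor_mul {x : ℝ} (hx : Real.sin (Real.pi * x) ≠ 0) :
    geomFactor x * (unitExp x - 1) = 1 := by
  have h1 : unitExp x = (Real.cos (Real.pi * x) + Real.sin (Real.pi * x) * Complex.I) ^ 2 := by
    rw [unitExp, Complex.ofReal_cos, Complex.ofReal_sin, Complex.cos_add_sin_I, ← Complex.exp_nat_mul]
    congr 1
    push_cast
    ring
  have h2 := Real.sin_sq_add_cos_sq (Real.pi * x)
  rw [h1, geomFactor]
  set s := Real.sin (Real.pi * x)
  set c := Real.cos (Real.pi * x)
  have hs : (s : ℂ) ≠ 0 := by exact_mod_cast hx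
  have h3 : (s : ℂ) ^ 2 + (c : ℂ) ^ 2 = 1 := by exact_mod_cast h2
  push_cast
  have hI : Complex.I ^ 2 = -1 := Complex.I_sq
  field_simp
  linear_combination ((s : ℂ) - c * Complex.I) * h3 + (- 2 * s * c ^ 2 - s ^ 3 - c * s ^ 2 * Complex.I) * hI

lemma norm_geomFactor {x : ℝ} (hx : Real.sin (Real.pi * x) ≠ 0) :
    ‖geomFactor x‖ = 1 / (2 * |Real.sin (Real.pi * x)|) := by
  have h2 := Real.sin_sq_add_cos_sq (Real.pi * x)
  have h : ‖geomFactor x‖ ^ 2 = (1 / (2 * |Real.sin (Real.pi * x)|)) ^ 2 := by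
    rw [← Complex.normSq_eq_norm_sq, Complex.normSq_apply, geomFactor]
    simp only [Complex.sub_re, Complex.neg_re, Complex.ofReal_re, Complex.mul_re, Complex.I_re,
      Complex.ofReal_im, Complex.I_im, Complex.sub_im, Complex.neg_im, Complex.mul_im]
    rw [div_pow, mul_pow, sq_abs]
    field_simp
    linarith
  exact (pow_left_inj₀ (norm_nonneg _) (by positivity) two_ne_zero).1 h

/-- Since the real part is constant, the values lie on a vertical line and their distance is half a
difference of cotangents. Along monotone arguments the total variation then telescopes. -/
lemma norm_geomFactor_sub (x y : ℝ) :
    ‖geomFactor x - geomFactor y‖ = 1 / 2 * |Real.cos (Real.pi * x) / Real.sin (Real.pi * x) -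
      Real.cos (Real.pi * y) / Real.sin (Real.pi * y)| := by
  have : geomFactor x - geomFactor y =
      ((-(1 / 2 * (Real.cos (Real.pi * x) / Real.sin (Real.pi * x) -
      Real.cos (Real.pi * y) / Real.sin (Real.pi * y))) : ℝ) : ℂ) * Complex.I := by
    simp only [geomFactor]
    push_cast
    ring
  rw [this, norm_mul, Complex.norm_I, mul_one, Complex.norm_real, Real.norm_eq_abs, abs_neg, abs_mul]
  norm_num

lemma two_mul_le_sin_pi_mul {x d : ℝ} (hd : 0 ≤ d) (h1 : d ≤ x) (h2 : x ≤ 1 - d) :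
    2 * d ≤ Real.sin (Real.pi * x) := by
  have hpi := Real.pi_pos
  rcases le_total x (1 / 2) with hx | hx
  · have := Real.mul_le_sin (x := Real.pi * x) (by nlinarith) (by nlinarith)
    have e : 2 / Real.pi * (Real.pi * x) = 2 * x := by field_simp
    linarith
  · have := Real.mul_le_sin (x := Real.pi * (1 - x)) (by nlinarith) (by nlinarith)
    have e : 2 / Real.pi * (Real.pi * (1 - x)) = 2 * (1 - x) := by field_simp
    have e2 : Real.sin (Real.pi * (1 - x)) = Real.sin (Real.pi * x) := by
      rw [mul_sub, mul_one, Real.sin_pi_sub]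
    linarith

lemma cos_div_sin_antitone {x y : ℝ} (hx : 0 < x) (hxy : x ≤ y) (hy : y < 1) :
    Real.cos (Real.pi * y) / Real.sin (Real.pi * y) ≤
      Real.cos (Real.pi * x) / Real.sin (Real.pi * x) := by
  have hpi := Real.pi_pos
  have sx : 0 < Real.sin (Real.pi * x) := Real.sin_pos_of_pos_of_lt_pi (by positivity) (by nlinarith)
  have sy : 0 < Real.sin (Real.pi * y) :=
    Real.sin_pos_of_pos_of_lt_pi (by nlinarith) (by nlinarith)
  rw [div_le_div_iff₀ sy sx]
  have : 0 ≤ Real.sin (Real.pi * y - Real.pi * x) :=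
    Real.sin_nonneg_of_nonneg_of_le_pi (by nlinarith) (by nlinarith)
  rw [Real.sin_sub] at this
  nlinarith

/-- Summation by parts based on $e(f(m))=g_m\,(e(f(m+1))-e(f(m)))$ with $g_m=1/(e(f(m+1)-f(m))-1)$.
The last boundary term stays on the left so that the induction closes, and the variation of $g$
collapses to a difference of its two end values. -/
lemma norm_sum_Ico_sub_geomFactor_le (f : ℕ → ℝ) (a n : ℕ) {d : ℝ} (hd : 0 < d)
    (hlo : ∀ m ∈ Finset.Icc a (a + n), d ≤ f (m + 1) - f m)
    (hhi : ∀ m ∈ Finset.Icc a (a + n), f (m + 1) - f m ≤ 1 - d)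
    (hmono : ∀ m ∈ Finset.Ico a (a + n), f (m + 1) - f m ≤ f (m + 2) - f (m + 1)) :
    ‖∑ m ∈ Finset.Ico a (a + n + 1), unitExp (f m) -
        geomFactor (f (a + n + 1) - f (a + n)) * unitExp (f (a + n + 1))‖ ≤
      ‖geomFactor (f (a + 1) - f a)‖ +
        ‖geomFactor (f (a + 1) - f a) - geomFactor (f (a + n + 1) - f (a + n))‖ := by
  have key : ∀ m ∈ Finset.Icc a (a + n), geomFactor (f (m + 1) - f m) * unitExp (f (m + 1)) =
      unitExp (f m) + geomFactor (f (m + 1) - f m) * unitExp (f m) := by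
    intro m hm
    have hs : Real.sin (Real.pi * (f (m + 1) - f m)) ≠ 0 := by
      have := two_mul_le_sin_pi_mul hd.le (hlo m hm) (hhi m hm)
      intro h
      linarith
    have h1 := geomFactor_mul hs
    have h2 : unitExp (f (m + 1)) = unitExp (f (m + 1) - f m) * unitExp (f m) := by
      rw [← unitExp_add]; ring_nf
    rw [h2]
    linear_combination unitExp (f m) * h1
  induction n with
  | zero =>
    have := key a (by simp)
    simp only [add_zero] at this ⊢
    rw [this]
    simp [norm_unitExp]
  | succ n ih =>
    have hsub : Finset.Icc a (a + n) ⊆ Finset.Icc a (a + (n + 1)) :=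
      Finset.Icc_subset_Icc_right (by omega)
    have ih := ih (fun m hm => hlo m (hsub hm)) (fun m hm => hhi m (hsub hm))
      (fun m hm => hmono m (Finset.Ico_subset_Ico_right (by omega) hm))
      (fun m hm => key m (hsub hm))
    have hk := key (a + (n + 1)) (by simp)
    have e1 : a + (n + 1) = a + n + 1 := by ring
    rw [e1] at hk ⊢
    rw [Finset.sum_Ico_succ_top (by omega), hk]
    set w0 := geomFactor (f (a + 1) - f a)
    set w1 := geomFactor (f (a + n + 1) - f (a + n)) with hw1
    set w2 := geomFactor (f (a + n + 1 + 1) - f (a + n + 1)) with hw2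
    set S := ∑ m ∈ Finset.Ico a (a + n + 1), unitExp (f m)
    have e2 : S + unitExp (f (a + n + 1)) - (unitExp (f (a + n + 1)) + w2 * unitExp (f (a + n + 1)))
        = (S - w1 * unitExp (f (a + n + 1))) + (w1 - w2) * unitExp (f (a + n + 1)) := by ring
    rw [e2]
    -- Equality in the triangle inequality: the three cotangents are ordered.
    have e3 : ‖w0 - w2‖ = ‖w0 - w1‖ + ‖w1 - w2‖ := by
      simp only [w0, hw1, hw2, norm_geomFactor_sub]
      have hmono' : ∀ k ≤ n, f (a + 1) - f a ≤ f (a + k + 1) - f (a + k) := by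
        intro k hk
        induction k with
        | zero => simp
        | succ k ih =>
          exact (ih (by omega)).trans (hmono (a + k) (by simp; omega))
      have m0 := hmono' n le_rfl
      have m1 : f (a + n + 1) - f (a + n) ≤ f (a + n + 1 + 1) - f (a + n + 1) :=
        hmono (a + n) (by simp)
      have l0 := hlo a (by simp)
      have u2 := hhi (a + n + 1) (by simp; omega)
      have c1 := cos_div_sin_antitone (by linarith) m0 (by linarith)
      have c2 := cos_div_sin_antitone (by linarith) m1 (by linarith)
      rw [abs_of_nonneg (by linarith), abs_of_nonneg (by linarith), abs_of_nonneg (by linarith)]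
      ring
    rw [e3]
    refine (norm_add_le _ _).trans ?_
    rw [norm_mul, norm_unitExp, mul_one]
    linarith

/-- The Kusmin–Landau inequality for a sequence with monotone differences in `[d, 1 - d]`. -/
lemma norm_sum_unitExp_le_of_diff_mem (f : ℕ → ℝ) (a b : ℕ) {d : ℝ} (hd : 0 < d)
    (hlo : ∀ m ∈ Finset.Ico a b, d ≤ f (m + 1) - f m)
    (hhi : ∀ m ∈ Finset.Ico a b, f (m + 1) - f m ≤ 1 - d)
    (hmono : ∀ m ∈ Finset.Ico a b, f (m + 1) - f m ≤ f (m + 2) - f (m + 1)) :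
    ‖∑ m ∈ Finset.Ico a b, unitExp (f m)‖ ≤ 1 / d := by
  rcases le_or_gt b a with hab | hab
  · rw [Finset.Ico_eq_empty_of_le hab]; simp; positivity
  obtain ⟨n, rfl⟩ : ∃ n, b = a + n + 1 := ⟨b - a - 1, by omega⟩
  have hI : Finset.Icc a (a + n) = Finset.Ico a (a + n + 1) := by ext; simp
  have h := norm_sum_Ico_sub_geomFactor_le f a n hd (by rwa [hI]) (by rwa [hI])
    (fun m hm => hmono m (Finset.Ico_subset_Ico_right (by omega) hm))
  have hw : ∀ m ∈ Finset.Ico a (a + n + 1), ‖geomFactor (f (m + 1) - f m)‖ ≤ 1 / (4 * d) := by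
    intro m hm
    have := two_mul_le_sin_pi_mul hd.le (hlo m hm) (hhi m hm)
    rw [norm_geomFactor (by intro h; linarith), abs_of_nonneg (by linarith)]
    exact one_div_le_one_div_of_le (by positivity) (by linarith)
  -- The bound $|A|+|A-B|+|B|$ costs at most four factors $1/(4d)$.
  have w0 := hw a (by simp)
  have w1 := hw (a + n) (by simp)
  set S := ∑ m ∈ Finset.Ico a (a + n + 1), unitExp (f m)
  set A := geomFactor (f (a + 1) - f a)
  set B := geomFactor (f (a + n + 1) - f (a + n))
  have h3 : ‖B * unitExp (f (a + n + 1))‖ = ‖B‖ := by rw [norm_mul, norm_unitExp, mul_one]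
  have h4 : S = (S - B * unitExp (f (a + n + 1))) + B * unitExp (f (a + n + 1)) := by ring
  have h5 : ‖S‖ ≤ ‖S - B * unitExp (f (a + n + 1))‖ + ‖B * unitExp (f (a + n + 1))‖ := by
    conv_lhs => rw [h4]
    exact norm_add_le _ _
  have h6 := norm_sub_le A B
  have h7 : 1 / d = 4 * (1 / (4 * d)) := by field_simp
  linarith

/-- A monotone sequence on `[a, b)` crosses the level `t` once. -/
lemma exists_threshold (g : ℕ → ℝ) (a b : ℕ) (hab : a ≤ b)
    (hmono : ∀ m ∈ Finset.Ico a b, g m ≤ g (m + 1)) (t : ℝ) :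
    ∃ p, a ≤ p ∧ p ≤ b ∧ (∀ m ∈ Finset.Ico a p, g m < t) ∧ ∀ m ∈ Finset.Ico p b, t ≤ g m := by
  induction b, hab using Nat.le_induction with
  | base => exact ⟨a, le_rfl, le_rfl, by simp, by simp⟩
  | succ b hab ih =>
    obtain ⟨p, hap, hpb, h1, h2⟩ := ih (fun m hm => hmono m (Finset.Ico_subset_Ico_right (by omega) hm))
    rcases lt_or_ge (g b) t with hb | hb
    · refine ⟨b + 1, by omega, le_rfl, fun m hm => ?_, by simp⟩
      simp only [Finset.mem_Ico] at hm
      rcases eq_or_lt_of_le (Nat.lt_succ_iff.1 hm.2) with rfl | hm'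
      · exact hb
      · by_contra hlt
        push Not at hlt
        have : ∀ k, m ≤ k → k ≤ b → t ≤ g k := by
          intro k hk
          induction k, hk using Nat.le_induction with
          | base => intro _; exact hlt
          | succ k hk ih => intro hkb; exact (ih (by omega)).trans (hmono k (by simp; omega))
        linarith [this b hm'.le le_rfl]
    · refine ⟨p, hap, by omega, h1, fun m hm => ?_⟩
      simp only [Finset.mem_Ico] at hm
      rcases eq_or_lt_of_le (Nat.lt_succ_iff.1 hm.2) with rfl | hm'
      · exact hb
      · exact h2 m (by simp; omega)

/-- Values separated by at least `lam` inside a window of length `d` number at most `d / lam + 1`.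
This limits how many terms have a phase increment close to an integer. -/
lemma sub_le_of_step {g : ℕ → ℝ} {a b : ℕ} {lam t d : ℝ} (hl : 0 < lam) (hd : 0 ≤ d)
    (hab : a ≤ b)
    (hstep : ∀ m ∈ Finset.Ico a b, lam ≤ g (m + 1) - g m)
    (hlo : ∀ m ∈ Finset.Ico a b, t ≤ g m) (hhi : ∀ m ∈ Finset.Ico a b, g m ≤ t + d) :
    ((b : ℝ) - a) ≤ d / lam + 1 := by
  rcases eq_or_lt_of_le hab with rfl | hab
  · simp; positivity
  obtain ⟨n, rfl⟩ : ∃ n, b = a + n + 1 := ⟨b - a - 1, by omega⟩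
  have : ∀ k ≤ n, g a + k * lam ≤ g (a + k) := by
    intro k hk
    induction k with
    | zero => simp
    | succ k ih =>
      have := hstep (a + k) (by simp; omega)
      have h2 := ih (by omega)
      push_cast
      rw [← add_assoc]
      linarith
  have h1 := this n le_rfl
  have h2 := hlo a (by simp)
  have h3 := hhi (a + n) (by simp)
  have : (n : ℝ) ≤ d / lam := by rw [le_div_iff₀ hl]; linarith
  push_cast
  linarith

/-- While the increments stay in one unit interval, those within $\sqrt\lambda$ of its ends are few
and are counted trivially; the rest fall under Kusmin–Landau. The distance $\sqrt\lambda$ balances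
the two costs $d/\lambda$ and $1/d$. -/
lemma norm_sum_Ico_le_of_step_of_diff_mem (f : ℕ → ℝ) (a b : ℕ) (hab : a ≤ b) {lam nu : ℝ}
    (hl : 0 < lam) (hl' : lam ≤ 1 / 4)
    (hstep : ∀ m ∈ Finset.Ico a b, lam ≤ (f (m + 2) - f (m + 1)) - (f (m + 1) - f m))
    (n : ℤ) (hn : (n : ℝ) = nu)
    (hlo : ∀ m ∈ Finset.Ico a b, nu ≤ f (m + 1) - f m)
    (hhi : ∀ m ∈ Finset.Ico a b, f (m + 1) - f m < nu + 1) :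
    ‖∑ m ∈ Finset.Ico a b, unitExp (f m)‖ ≤ 4 / Real.sqrt lam := by
  set d := Real.sqrt lam with hd
  have hd0 : 0 < d := Real.sqrt_pos.2 hl
  have hdd : d * d = lam := Real.mul_self_sqrt hl.le
  have hd1 : d ≤ 1 / 2 := by nlinarith
  have hmono : ∀ m ∈ Finset.Ico a b, (fun m => f (m + 1) - f m) m ≤ (fun m => f (m + 1) - f m) (m + 1) := by
    intro m hm
    have := hstep m hm
    show f (m + 1) - f m ≤ f (m + 2) - f (m + 1)
    linarith
  obtain ⟨p, hap, hpb, hp1, hp2⟩ := exists_threshold _ a b hab hmono (nu + d)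
  obtain ⟨q, hpq, hqb, hq1, hq2⟩ := exists_threshold _ p b hpb
    (fun m hm => hmono m (Finset.Ico_subset_Ico_left hap hm)) (nu + 1 - d)
  have sub1 : Finset.Ico a p ⊆ Finset.Ico a b := Finset.Ico_subset_Ico_right hpb
  have sub2 : Finset.Ico p q ⊆ Finset.Ico a b := Finset.Ico_subset_Ico hap hqb
  have sub3 : Finset.Ico q b ⊆ Finset.Ico a b := Finset.Ico_subset_Ico_left (hap.trans hpq)
  have c1 : ‖∑ m ∈ Finset.Ico a p, unitExp (f m)‖ ≤ d / lam + 1 := by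
    refine (norm_sum_unitExp_le_card _ _).trans ?_
    rw [Nat.card_Ico, Nat.cast_sub hap]
    exact sub_le_of_step (g := fun m => f (m + 1) - f m) (t := nu) hl hd0.le hap
      (fun m hm => hstep m (sub1 hm)) (fun m hm => hlo m (sub1 hm)) (fun m hm => (hp1 m hm).le)
  have c3 : ‖∑ m ∈ Finset.Ico q b, unitExp (f m)‖ ≤ d / lam + 1 := by
    refine (norm_sum_unitExp_le_card _ _).trans ?_
    rw [Nat.card_Ico, Nat.cast_sub hqb]
    exact sub_le_of_step (g := fun m => f (m + 1) - f m) (t := nu + 1 - d) hl hd0.le hqb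
      (fun m hm => hstep m (sub3 hm)) (fun m hm => hq2 m hm)
      (fun m hm => by have := hhi m (sub3 hm); show f (m + 1) - f m ≤ _; linarith)
  have c2 : ‖∑ m ∈ Finset.Ico p q, unitExp (f m)‖ ≤ 1 / d := by
    -- Removing an integer slope from the phase leaves the terms unchanged and moves the increments
    -- into $[d,1-d]$.
    have e : ∀ m, unitExp (f m) = unitExp (f m - nu * m) := by
      intro m
      have h1 : f m = (f m - nu * m) + ((n * m : ℤ) : ℝ) := by rw [← hn]; push_cast; ring
      conv_lhs => rw [h1, unitExp_add, unitExp_intCast, mul_one]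
    simp only [e]
    refine norm_sum_unitExp_le_of_diff_mem _ p q hd0 ?_ ?_ ?_
    · intro m hm
      have h := hp2 m (Finset.Ico_subset_Ico_right hqb hm)
      push_cast
      linarith
    · intro m hm
      have h := hq1 m hm
      push_cast
      linarith
    · intro m hm
      have h := hmono m (sub2 hm)
      simp only [add_assoc] at h
      norm_num at h
      push_cast
      linarith
  rw [← Finset.sum_Ico_consecutive _ hap hpb, ← Finset.sum_Ico_consecutive _ hpq hqb]
  have h1 : d / lam = 1 / d := by rw [← hdd]; field_simp
  have h2 : 2 ≤ 1 / d := by rw [le_div_iff₀ hd0]; linarith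
  have h3 : 4 / d = 4 * (1 / d) := by ring
  refine (norm_add_le _ _).trans ((add_le_add le_rfl (norm_add_le _ _)).trans ?_)
  rw [h1] at c1 c3
  linarith

/-- Induction on the number `J` of unit intervals that the increments can meet, peeling off the
lowest one each time. -/
lemma norm_sum_Ico_le_of_step_of_diff_lt (f : ℕ → ℝ) (b : ℕ) {lam : ℝ}
    (hl : 0 < lam) (hl' : lam ≤ 1 / 4) (J : ℕ) : ∀ (a : ℕ) (_ : a ≤ b) (n : ℤ)
    (_ : ∀ m ∈ Finset.Ico a b, lam ≤ (f (m + 2) - f (m + 1)) - (f (m + 1) - f m))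
    (_ : ∀ m ∈ Finset.Ico a b, n ≤ f (m + 1) - f m)
    (_ : ∀ m ∈ Finset.Ico a b, f (m + 1) - f m < n + J),
    ‖∑ m ∈ Finset.Ico a b, unitExp (f m)‖ ≤ J * (4 / Real.sqrt lam) := by
  induction J with
  | zero =>
    intro a hab n hstep hlo hhi
    rcases eq_or_lt_of_le hab with rfl | hab
    · simp
    · have h1 := hlo a (by simp [hab])
      have h2 := hhi a (by simp [hab])
      push_cast at h2
      linarith
  | succ J ih =>
    intro a hab n hstep hlo hhi
    have hmono : ∀ m ∈ Finset.Ico a b,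
        (fun m => f (m + 1) - f m) m ≤ (fun m => f (m + 1) - f m) (m + 1) := by
      intro m hm
      have := hstep m hm
      show f (m + 1) - f m ≤ f (m + 2) - f (m + 1)
      linarith
    obtain ⟨p, hap, hpb, hp1, hp2⟩ := exists_threshold _ a b hab hmono (n + 1)
    have sub1 : Finset.Ico a p ⊆ Finset.Ico a b := Finset.Ico_subset_Ico_right hpb
    have sub2 : Finset.Ico p b ⊆ Finset.Ico a b := Finset.Ico_subset_Ico_left hap
    rw [← Finset.sum_Ico_consecutive _ hap hpb]
    refine (norm_add_le _ _).trans ?_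
    have h1 := norm_sum_Ico_le_of_step_of_diff_mem f a p hap hl hl'
      (fun m hm => hstep m (sub1 hm)) n rfl (fun m hm => hlo m (sub1 hm)) hp1
    have h2 := ih p hpb (n + 1) (fun m hm => hstep m (sub2 hm))
      (fun m hm => by push_cast; exact hp2 m hm)
      (fun m hm => by have := hhi m (sub2 hm); push_cast at this ⊢; linarith)
    push_cast
    linarith

/-- The second derivative test of van der Corput, for second differences. -/
theorem norm_sum_unitExp_le_of_second_diff (f : ℕ → ℝ) (a b : ℕ) (hab : a ≤ b) {lam C : ℝ}
    (hl : 0 < lam) (hC : 1 ≤ C)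
    (hlo : ∀ m ∈ Finset.Ico a b, lam ≤ (f (m + 2) - f (m + 1)) - (f (m + 1) - f m))
    (hhi : ∀ m ∈ Finset.Ico a b, (f (m + 2) - f (m + 1)) - (f (m + 1) - f m) ≤ C * lam) :
    ‖∑ m ∈ Finset.Ico a b, unitExp (f m)‖ ≤ 4 * (C * lam * (b - a) + 3) / Real.sqrt lam := by
  have hs : 0 < Real.sqrt lam := Real.sqrt_pos.2 hl
  have hba : (0 : ℝ) ≤ (b : ℝ) - a := sub_nonneg.2 (by exact_mod_cast hab)
  rcases le_or_gt lam (1 / 4) with hl' | hl'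
  · have hup : ∀ k, a + k ≤ b → f (a + k + 1) - f (a + k) ≤ f (a + 1) - f a + C * lam * k := by
      intro k hk
      induction k with
      | zero => simp
      | succ k ih =>
        have h1 := ih (by omega)
        have h2 := hhi (a + k) (by simp; omega)
        have e : f (a + (k + 1) + 1) - f (a + (k + 1)) = f (a + k + 2) - f (a + k + 1) := by ring_nf
        rw [e]
        push_cast
        linarith
    have hdn : ∀ k, a + k ≤ b → f (a + 1) - f a ≤ f (a + k + 1) - f (a + k) := by
      intro k hk
      induction k with
      | zero => simp
      | succ k ih =>
        have h1 := ih (by omega)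
        have h2 := hlo (a + k) (by simp; omega)
        have e : f (a + (k + 1) + 1) - f (a + (k + 1)) = f (a + k + 2) - f (a + k + 1) := by ring_nf
        rw [e]
        linarith
    set n := ⌊f (a + 1) - f a⌋
    have hn1 : (n : ℝ) ≤ f (a + 1) - f a := Int.floor_le _
    have hn2 : f (a + 1) - f a < n + 1 := Int.lt_floor_add_one _
    have hX : 0 ≤ C * lam * (b - a) := by positivity
    -- The increments grow by at most $C\lambda(b-a)$ in total; the extra 2 absorbs the starting
    -- fractional part and the rounding down.
    set J := ⌊C * lam * (b - a)⌋₊ + 2 with hJ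
    have hJ1 : (J : ℝ) ≤ C * lam * (b - a) + 2 := by
      rw [hJ]; push_cast; linarith [Nat.floor_le hX]
    have hJ2 : C * lam * (b - a) + 1 < J := by
      rw [hJ]; push_cast; linarith [Nat.lt_floor_add_one (C * lam * ((b : ℝ) - a))]
    have := norm_sum_Ico_le_of_step_of_diff_lt f b hl hl' J a hab n hlo
      (fun m hm => by
        simp only [Finset.mem_Ico] at hm
        obtain ⟨k, rfl⟩ := Nat.exists_eq_add_of_le hm.1
        exact hn1.trans (hdn k hm.2.le))
      (fun m hm => by
        simp only [Finset.mem_Ico] at hm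
        obtain ⟨k, rfl⟩ := Nat.exists_eq_add_of_le hm.1
        have h1 := hup k hm.2.le
        have h2 : (k : ℝ) ≤ b - a := by
          have : ((a + k : ℕ) : ℝ) ≤ b := by exact_mod_cast hm.2.le
          push_cast at this
          linarith
        have h3 : C * lam * k ≤ C * lam * (b - a) := by gcongr
        linarith)
    refine this.trans ?_
    rw [mul_div_assoc', mul_comm]
    gcongr
    linarith
  -- For $\lambda>1/4$ the claimed bound exceeds the number of terms.
  · refine (norm_sum_unitExp_le_card _ _).trans ?_
    rw [Nat.card_Ico, Nat.cast_sub hab, le_div_iff₀ hs]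
    have h1 : Real.sqrt lam * Real.sqrt lam = lam := Real.mul_self_sqrt hl.le
    have h2 : Real.sqrt lam ≤ 4 * lam := by nlinarith
    have h3 : Real.sqrt lam ≤ 4 * (C * lam) := by nlinarith
    nlinarith [mul_le_mul_of_nonneg_right h3 hba]

/-! ### Twisted sums of the sawtooth function. -/

/-- The sawtooth function. -/
noncomputable def sawtooth (x : ℝ) : ℝ := Int.fract x - 1 / 2

/-- The periodic antiderivative of the sawtooth function with mean zero. -/
noncomputable def sawtoothPrim (x : ℝ) : ℝ := (Int.fract x ^ 2 - Int.fract x + 1 / 6) / 2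

/-- Subtracting $t^2/2$ from the antiderivative leaves a function of slope $-\lfloor t\rfloor-1/2$,
which is concave. Its supporting line gives a one-sided Taylor bound valid for every sign of `d`,
even across integers. -/
lemma sawtoothPrim_add_sub_le (x d : ℝ) :
    sawtoothPrim (x + d) - sawtoothPrim x ≤ d * sawtooth x + d ^ 2 / 2 := by
  have h0 : 0 ≤ Int.fract (x + d) := Int.fract_nonneg _
  have h1 : Int.fract (x + d) < 1 := Int.fract_lt_one _
  have e1 : Int.fract x + d = Int.fract (x + d) + ((⌊x + d⌋ - ⌊x⌋ : ℤ) : ℝ) := by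
    push_cast
    rw [Int.fract, Int.fract]
    ring
  simp only [sawtoothPrim, sawtooth]
  set u := Int.fract (x + d)
  set n := ⌊x + d⌋ - ⌊x⌋
  have key : u ^ 2 - u ≤ (u + n) ^ 2 - (u + n) := by
    rcases lt_trichotomy n 0 with hn | hn | hn
    · have : (n : ℝ) ≤ -1 := by exact_mod_cast Int.le_sub_one_of_lt hn
      nlinarith
    · rw [hn]; simp
    · have : (1 : ℝ) ≤ n := by exact_mod_cast hn
      nlinarith
  rw [← e1] at key
  nlinarith

/-- This is the Fourier series of the second Bernoulli polynomial; its coefficients decay like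
$k^{-2}$. -/
lemma hasSum_sawtoothPrim (x : ℝ) :
    HasSum (fun k : ℕ => 1 / (2 * Real.pi ^ 2) * (1 / (k : ℝ) ^ 2) * Real.cos (2 * Real.pi * (k * x)))
      (sawtoothPrim x) := by
  have h := hasSum_one_div_nat_pow_mul_cos (k := 1) one_ne_zero
    (x := Int.fract x) ⟨Int.fract_nonneg _, (Int.fract_lt_one _).le⟩
  have h2 := h.mul_left (1 / (2 * Real.pi ^ 2))
  have hpi := Real.pi_pos
  convert! h2 using 1
  · ext k
    have : Real.cos (2 * Real.pi * (k * x)) = Real.cos (2 * Real.pi * k * Int.fract x) := by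
      have : 2 * Real.pi * (k * x) = 2 * Real.pi * k * Int.fract x +
          ((k * ⌊x⌋ : ℤ) : ℝ) * (2 * Real.pi) := by
        have := Int.floor_add_fract x
        conv_lhs => rw [← this]
        push_cast
        ring
      rw [this, Real.cos_add_int_mul_two_pi]
    rw [this]
    ring
  · have := bernoulliFun_two (Int.fract x)
    simp only [bernoulliFun] at this
    rw [this, sawtoothPrim]
    simp [Nat.factorial]
    field_simp

/-- Interpolates between the trivial bound 2 and the Lipschitz bound $2\pi|y|$, so that the saving
for small shifts can be adjusted to the decay needed in `k`. -/
lemma norm_unitExp_sub_one_le (y : ℝ) {θ : ℝ} (h0 : 0 ≤ θ) (h1 : θ ≤ 1) :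
    ‖unitExp y - 1‖ ≤ 2 * (Real.pi * |y|) ^ θ := by
  have hpi := Real.pi_pos
  rcases le_total (Real.pi * |y|) 1 with h | h
  · have e : unitExp y = Complex.exp (Complex.I * (2 * Real.pi * y : ℝ)) := by
      rw [unitExp_eq_exp_ofReal_mul_I, mul_comm]
    have a := Real.norm_exp_I_mul_ofReal_sub_one_le (x := 2 * Real.pi * y)
    rw [← e, Real.norm_eq_abs, abs_mul, abs_of_pos (by positivity : 0 < 2 * Real.pi)] at a
    rcases eq_or_lt_of_le (show 0 ≤ Real.pi * |y| by positivity) with h' | h'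
    · have : 0 ≤ (Real.pi * |y|) ^ θ := by positivity
      nlinarith
    have b := Real.rpow_le_rpow_of_exponent_ge h' h h1
    rw [Real.rpow_one] at b
    linarith
  · have a : ‖unitExp y - 1‖ ≤ 2 := by
      refine (norm_sub_le _ _).trans ?_
      rw [norm_unitExp]; norm_num
    have b := Real.one_le_rpow h h0
    linarith

lemma cos_eq_unitExp (y : ℝ) :
    ((Real.cos (2 * Real.pi * y) : ℝ) : ℂ) = (unitExp y + unitExp (-y)) / 2 := by
  rw [Complex.ofReal_cos, Complex.cos, unitExp, unitExp]
  push_cast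
  ring_nf

lemma norm_sum_cos_sub_le (x : ℕ → ℝ) (s : Finset ℕ) (k d W ξ : ℝ)
    (hW : ∀ ξ, ‖∑ m ∈ s, unitExp (k * x m + m * ξ)‖ ≤ W) {θ : ℝ} (h0 : 0 ≤ θ) (h1 : θ ≤ 1) :
    ‖∑ m ∈ s, ((Real.cos (2 * Real.pi * (k * (x m + d))) - Real.cos (2 * Real.pi * (k * x m)) : ℝ) : ℂ)
      * unitExp (m * ξ)‖ ≤ 2 * (Real.pi * |k * d|) ^ θ * W := by
  have e : ∑ m ∈ s, ((Real.cos (2 * Real.pi * (k * (x m + d))) -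
      Real.cos (2 * Real.pi * (k * x m)) : ℝ) : ℂ) * unitExp (m * ξ) =
      (unitExp (k * d) - 1) / 2 * ∑ m ∈ s, unitExp (k * x m + m * ξ) +
      (unitExp (-(k * d)) - 1) / 2 * (starRingEnd ℂ) (∑ m ∈ s, unitExp (k * x m + m * (-ξ))) := by
    rw [map_sum, Finset.mul_sum, Finset.mul_sum, ← Finset.sum_add_distrib]
    refine Finset.sum_congr rfl fun m _ => ?_
    rw [← unitExp_neg, Complex.ofReal_sub, cos_eq_unitExp, cos_eq_unitExp]
    have a1 : k * (x m + d) = k * d + k * x m := by ring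
    have a2 : -(k * (x m + d)) = -(k * d) + -(k * x m) := by ring
    have a3 : -(k * x m + m * (-ξ)) = -(k * x m) + m * ξ := by ring
    rw [a2, a1, a3]
    simp only [unitExp_add]
    ring
  rw [e]
  have b1 := norm_unitExp_sub_one_le (k * d) h0 h1
  have b2 := norm_unitExp_sub_one_le (-(k * d)) h0 h1
  rw [abs_neg] at b2
  have w1 := hW ξ
  have w2 := hW (-ξ)
  refine (norm_add_le _ _).trans ?_
  rw [norm_mul, norm_mul, norm_div, norm_div, RCLike.norm_conj, Complex.norm_ofNat]
  set P := (Real.pi * |k * d|) ^ θ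
  have hW0 : 0 ≤ W := (norm_nonneg _).trans w1
  have c1 : ‖unitExp (k * d) - 1‖ / 2 * ‖∑ m ∈ s, unitExp (k * x m + m * ξ)‖ ≤ P * W := by
    gcongr; linarith
  have c2 : ‖unitExp (-(k * d)) - 1‖ / 2 * ‖∑ m ∈ s, unitExp (k * x m + m * (-ξ))‖ ≤ P * W := by
    gcongr; linarith
  linarith

/-- The condition `θ + η = 3 / 4` makes the total power of `k` equal to $-2+3/4=-5/4$, which is
summable. -/
lemma inv_two_pi_sq_mul_le {k δ θ η : ℝ} (hk : 1 ≤ k) (hδ : 0 < δ) (h1 : θ ≤ 1)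
    (h : θ + η = 3 / 4) :
    1 / (2 * Real.pi ^ 2) * (1 / k ^ 2) * (2 * (Real.pi * (k * δ)) ^ θ * k ^ η) ≤
      k ^ (-(5 / 4) : ℝ) * δ ^ θ := by
  have hpi : 1 ≤ Real.pi := by linarith [Real.pi_gt_three]
  have hk0 : 0 < k := by linarith
  have e1 : Real.pi ^ θ ≤ Real.pi ^ 2 := by
    rw [← Real.rpow_natCast]
    exact Real.rpow_le_rpow_of_exponent_le hpi (by push_cast; linarith)
  have e2 : k ^ (-(5 / 4) : ℝ) = k ^ θ * k ^ η / k ^ 2 := by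
    rw [← Real.rpow_add hk0, ← Real.rpow_natCast, ← Real.rpow_sub hk0, h]
    norm_num
  rw [e2, Real.mul_rpow (by positivity) (by positivity), Real.mul_rpow (by positivity) (by positivity)]
  have e3 : 1 / (2 * Real.pi ^ 2) * (1 / k ^ 2) * (2 * (Real.pi ^ θ * (k ^ θ * δ ^ θ)) * k ^ η) =
    (Real.pi ^ θ / Real.pi ^ 2) * (k ^ θ * k ^ η / k ^ 2 * δ ^ θ) := by field_simp
  rw [e3]
  have e4 : Real.pi ^ θ / Real.pi ^ 2 ≤ 1 := (div_le_one (by positivity)).2 e1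
  exact mul_le_of_le_one_left (by positivity) e4

/-- Sum of `k ^ (-5/4)`. -/
noncomputable def zetaConst : ℝ := ∑' k : ℕ, (k : ℝ) ^ (-(5 / 4) : ℝ)

lemma zetaConst_nonneg : 0 ≤ zetaConst := tsum_nonneg fun _ => by positivity

lemma norm_sum_sawtoothPrim_sub_le (x : ℕ → ℝ) (s : Finset ℕ) {V₁ V₂ δ : ℝ} (hV₁ : 0 ≤ V₁)
    (hV₂ : 0 ≤ V₂) (hδ : 0 < δ)
    (hW : ∀ k : ℕ, 1 ≤ k → ∀ ξ, ‖∑ m ∈ s, unitExp (k * x m + m * ξ)‖ ≤ (k : ℝ) ^ (1 / 2 : ℝ) * V₁ + V₂)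
    (d : ℝ) (hd : |d| = δ) (ξ : ℝ) :
    ‖∑ m ∈ s, ((sawtoothPrim (x m + d) - sawtoothPrim (x m) : ℝ) : ℂ) * unitExp (m * ξ)‖ ≤
      zetaConst * (δ ^ (1 / 4 : ℝ) * V₁ + δ ^ (3 / 4 : ℝ) * V₂) := by
  set T : ℕ → ℂ := fun k => ((1 / (2 * Real.pi ^ 2) * (1 / (k : ℝ) ^ 2) : ℝ) : ℂ) *
    ∑ m ∈ s, ((Real.cos (2 * Real.pi * (k * (x m + d))) - Real.cos (2 * Real.pi * (k * x m)) : ℝ) : ℂ)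
      * unitExp (m * ξ) with hT
  have hsum : HasSum T
      (∑ m ∈ s, ((sawtoothPrim (x m + d) - sawtoothPrim (x m) : ℝ) : ℂ) * unitExp (m * ξ)) := by
    have : T = fun k : ℕ => ∑ m ∈ s, ((1 / (2 * Real.pi ^ 2) * (1 / (k : ℝ) ^ 2) *
        Real.cos (2 * Real.pi * (k * (x m + d))) - 1 / (2 * Real.pi ^ 2) * (1 / (k : ℝ) ^ 2) *
        Real.cos (2 * Real.pi * (k * x m)) : ℝ) : ℂ) * unitExp (m * ξ) := by
      ext k
      rw [hT]
      simp only
      rw [Finset.mul_sum]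
      refine Finset.sum_congr rfl fun m _ => ?_
      push_cast
      ring
    rw [this]
    refine hasSum_sum fun m _ => ?_
    exact (Complex.hasSum_ofReal.2
      ((hasSum_sawtoothPrim (x m + d)).sub (hasSum_sawtoothPrim (x m)))).mul_right _
  have hz : Summable fun k : ℕ => (k : ℝ) ^ (-(5 / 4) : ℝ) :=
    Real.summable_nat_rpow.2 (by norm_num)
  have hbound : ∀ k : ℕ, ‖T k‖ ≤ (k : ℝ) ^ (-(5 / 4) : ℝ) *
      (δ ^ (1 / 4 : ℝ) * V₁ + δ ^ (3 / 4 : ℝ) * V₂) := by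
    intro k
    rcases Nat.eq_zero_or_pos k with rfl | hk
    · simp [hT]
    have hk1 : (1 : ℝ) ≤ k := by exact_mod_cast hk
    have hkd : |(k : ℝ) * d| = k * δ := by rw [abs_mul, hd, abs_of_nonneg (by linarith)]
    set W := ‖∑ m ∈ s, ((Real.cos (2 * Real.pi * (k * (x m + d))) -
      Real.cos (2 * Real.pi * (k * x m)) : ℝ) : ℂ) * unitExp (m * ξ)‖ with hWdef
    have hTk : ‖T k‖ = 1 / (2 * Real.pi ^ 2) * (1 / (k : ℝ) ^ 2) * W := by
      rw [hT, hWdef]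
      simp only
      rw [norm_mul, Complex.norm_real, Real.norm_eq_abs, abs_of_nonneg (by positivity)]
    -- Both interpolation exponents bound the whole of `W`, hence so does the smaller of the two.
    -- The exponent $1/4$ is then kept for the term growing like $\sqrt k$ and $3/4$ for the
    -- constant one.
    have hWle : W ≤ 2 * (Real.pi * (k * δ)) ^ (1 / 4 : ℝ) * ((k : ℝ) ^ (1 / 2 : ℝ) * V₁) +
        2 * (Real.pi * (k * δ)) ^ (3 / 4 : ℝ) * V₂ := by
      have i1 := norm_sum_cos_sub_le x s k d _ ξ (hW k hk) (θ := 1 / 4) (by norm_num) (by norm_num)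
      have i2 := norm_sum_cos_sub_le x s k d _ ξ (hW k hk) (θ := 3 / 4) (by norm_num) (by norm_num)
      rw [hkd] at i1 i2
      rw [← hWdef] at i1 i2
      have hpos1 : 0 ≤ (k : ℝ) ^ (1 / 2 : ℝ) * V₁ := by positivity
      rcases le_total ((Real.pi * (k * δ)) ^ (1 / 4 : ℝ)) ((Real.pi * (k * δ)) ^ (3 / 4 : ℝ)) with h | h
      · have := mul_le_mul_of_nonneg_right h hV₂
        linarith
      · have := mul_le_mul_of_nonneg_right h hpos1
        linarith
    rw [hTk]
    have j1 := inv_two_pi_sq_mul_le (θ := 1 / 4) (η := 1 / 2) hk1 hδ (by norm_num) (by norm_num)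
    have j2 := inv_two_pi_sq_mul_le (θ := 3 / 4) (η := 0) hk1 hδ (by norm_num) (by norm_num)
    rw [Real.rpow_zero, mul_one] at j2
    have c0 : 0 ≤ 1 / (2 * Real.pi ^ 2) * (1 / (k : ℝ) ^ 2) := by positivity
    have k1 := mul_le_mul_of_nonneg_right j1 hV₁
    have k2 := mul_le_mul_of_nonneg_right j2 hV₂
    refine (mul_le_mul_of_nonneg_left hWle c0).trans ?_
    linarith
  rw [← hsum.tsum_eq]
  refine (tsum_of_norm_bounded (hz.hasSum.mul_right _) hbound).trans ?_
  rw [zetaConst]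

/-- A bound for twisted sums of the sawtooth function in terms of exponential sums. -/
theorem norm_sum_sawtooth_le (x : ℕ → ℝ) (s : Finset ℕ) {V₁ V₂ δ : ℝ} (hV₁ : 0 ≤ V₁)
    (hV₂ : 0 ≤ V₂) (hδ : 0 < δ)
    (hW : ∀ k : ℕ, 1 ≤ k → ∀ ξ, ‖∑ m ∈ s, unitExp (k * x m + m * ξ)‖ ≤ (k : ℝ) ^ (1 / 2 : ℝ) * V₁ + V₂)
    (ξ : ℝ) :
    ‖∑ m ∈ s, (sawtooth (x m) : ℂ) * unitExp (m * ξ)‖ ≤ 2 * δ * s.card +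
      3 * (zetaConst * (δ ^ (1 / 4 : ℝ) * V₁ + δ ^ (3 / 4 : ℝ) * V₂)) / δ := by
  set A := zetaConst * (δ ^ (1 / 4 : ℝ) * V₁ + δ ^ (3 / 4 : ℝ) * V₂) with hA
  have hp := norm_sum_sawtoothPrim_sub_le x s hV₁ hV₂ hδ hW
  have b1 := hp δ (abs_of_pos hδ) ξ
  have b2 := hp δ (abs_of_pos hδ) 0
  have b3 := hp (-δ) (by rw [abs_neg, abs_of_pos hδ]) 0
  simp only [mul_zero, unitExp_zero, mul_one, ← Complex.ofReal_sum, Complex.norm_real,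
    Real.norm_eq_abs] at b2 b3
  rw [← hA] at b1 b2 b3
  set up : ℕ → ℝ := fun m => (sawtoothPrim (x m + δ) - sawtoothPrim (x m)) with hup
  set dn : ℕ → ℝ := fun m => (sawtoothPrim (x m + -δ) - sawtoothPrim (x m)) with hdn
  have e : ∑ m ∈ s, (sawtooth (x m) : ℂ) * unitExp (m * ξ) =
      (1 / δ : ℝ) * (∑ m ∈ s, (up m : ℂ) * unitExp (m * ξ)) +
      ∑ m ∈ s, ((sawtooth (x m) - up m / δ : ℝ) : ℂ) * unitExp (m * ξ) := by
    rw [Finset.mul_sum, ← Finset.sum_add_distrib]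
    refine Finset.sum_congr rfl fun m _ => ?_
    push_cast
    ring
  -- The one-sided bounds at $+\delta$ and $-\delta$ enclose the replacement error in absolute value
  -- by a quantity linear in differences of the antiderivative. Its sum is controlled by the same
  -- estimates at frequency zero.
  have hterm : ∀ m, ‖((sawtooth (x m) - up m / δ : ℝ) : ℂ) * unitExp (m * ξ)‖ ≤
      (2 * δ + (- up m / δ - dn m / δ)) := by
    intro m
    rw [norm_mul, norm_unitExp, mul_one, Complex.norm_real, Real.norm_eq_abs]
    have h1 := sawtoothPrim_add_sub_le (x m) δ
    have h2 := sawtoothPrim_add_sub_le (x m) (-δ)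
    have h1' : up m / δ ≤ sawtooth (x m) + δ / 2 := by
      rw [div_le_iff₀ hδ]; simp only [hup]; linarith
    have h2' : dn m / δ ≤ - sawtooth (x m) + δ / 2 := by
      rw [div_le_iff₀ hδ]; simp only [hdn]; linarith
    have h3 : -up m / δ = -(up m / δ) := by ring
    rw [h3, abs_le]
    constructor <;> linarith
  rw [e]
  refine (norm_add_le _ _).trans ?_
  have c1 : ‖((1 / δ : ℝ) : ℂ) * (∑ m ∈ s, (up m : ℂ) * unitExp (m * ξ))‖ ≤ A / δ := by
    rw [norm_mul, Complex.norm_real, Real.norm_eq_abs, abs_of_pos (by positivity)]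
    have := mul_le_mul_of_nonneg_left b1 (show 0 ≤ 1 / δ by positivity)
    refine this.trans (le_of_eq (by ring))
  have c2 : ‖∑ m ∈ s, ((sawtooth (x m) - up m / δ : ℝ) : ℂ) * unitExp (m * ξ)‖ ≤
      2 * δ * s.card + 2 * A / δ := by
    refine (norm_sum_le_of_le s (fun m _ => hterm m)).trans ?_
    rw [Finset.sum_add_distrib, Finset.sum_const, nsmul_eq_mul, Finset.sum_sub_distrib]
    simp only [← Finset.sum_div, Finset.sum_neg_distrib]
    have u1 := neg_le_of_abs_le b2
    have u2 := neg_le_of_abs_le b3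
    have u3 : -∑ m ∈ s, up m ≤ A := by linarith
    have u4 : -∑ m ∈ s, dn m ≤ A := by linarith
    have v1 := div_le_div_of_nonneg_right u3 hδ.le
    have v2 := div_le_div_of_nonneg_right u4 hδ.le
    have v3 : -(∑ m ∈ s, dn m) / δ = -((∑ m ∈ s, dn m) / δ) := by ring
    have v4 : 2 * A / δ = A / δ + A / δ := by ring
    rw [v3] at v2
    rw [v4]
    linarith
  have v5 : 3 * A / δ = A / δ + 2 * A / δ := by ring
  linarith

/-! ### Discrete Fourier analysis of triple convolutions. -/

lemma sum_range_unitExp_div (Q : ℕ) (hQ : 0 < Q) (n : ℤ) :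
    ∑ q ∈ Finset.range Q, unitExp (n * (q / Q)) = if (Q : ℤ) ∣ n then (Q : ℂ) else 0 := by
  have hQ' : (Q : ℝ) ≠ 0 := by positivity
  have hpow : ∀ q : ℕ, unitExp (n * (q / Q)) = unitExp (n / Q) ^ q := by
    intro q
    rw [unitExp, unitExp, ← Complex.exp_nat_mul]
    congr 1
    push_cast
    ring
  simp only [hpow]
  split_ifs with h
  · obtain ⟨k, rfl⟩ := h
    have : unitExp (((Q : ℤ) * k : ℤ) / Q) = 1 := by
      rw [← unitExp_intCast k]
      congr 1
      push_cast
      field_simp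
    simp only [this, one_pow, Finset.sum_const, Finset.card_range, nsmul_eq_mul, mul_one]
  · have h1 : unitExp (n / Q) ≠ 1 := by
      intro h2
      rw [unitExp, Complex.exp_eq_one_iff] at h2
      obtain ⟨k, hk⟩ := h2
      apply h
      refine ⟨k, ?_⟩
      have hne : (2 * Real.pi * Complex.I : ℂ) ≠ 0 := Complex.two_pi_I_ne_zero
      have h3 : (((n : ℝ) / Q : ℝ) : ℂ) = k := by
        apply mul_left_cancel₀ hne
        linear_combination hk
      have h4 : (n : ℝ) / Q = k := by exact_mod_cast h3
      rw [div_eq_iff hQ'] at h4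
      have : (n : ℝ) = Q * k := by linarith
      exact_mod_cast this
    have h2 : unitExp (n / Q) ^ Q = 1 := by
      rw [← hpow Q, div_self hQ', mul_one, unitExp_intCast]
    rw [geom_sum_eq h1, h2]
    simp

/-- The exponential sum over `[0, n]` with real coefficients `u`. -/
noncomputable def expSum (u : ℕ → ℝ) (n : ℕ) (ξ : ℝ) : ℂ :=
  ∑ m ∈ Finset.range (n + 1), (u m : ℂ) * unitExp (m * ξ)

/-- Parseval over the `Q`-th roots of unity: indices in $[0,n]$ differ by less than `Q`, so only the
diagonal survives. -/
lemma sum_norm_expSum_sq (u : ℕ → ℝ) (n Q : ℕ) (hQ : n < Q) :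
    ∑ q ∈ Finset.range Q, ‖expSum u n (q / Q)‖ ^ 2 = Q * ∑ m ∈ Finset.range (n + 1), u m ^ 2 := by
  have hC : ((∑ q ∈ Finset.range Q, ‖expSum u n (q / Q)‖ ^ 2 : ℝ) : ℂ) =
      ((Q * ∑ m ∈ Finset.range (n + 1), u m ^ 2 : ℝ) : ℂ) := by
    push_cast
    have h1 : ∀ q : ℕ, (‖expSum u n (q / Q)‖ : ℂ) ^ 2 = ∑ i ∈ Finset.range (n + 1),
        ∑ j ∈ Finset.range (n + 1), (u i : ℂ) * u j * unitExp (((i : ℤ) - j : ℤ) * (q / Q)) := by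
      intro q
      rw [← Complex.mul_conj', expSum, map_sum, Finset.sum_mul_sum]
      refine Finset.sum_congr rfl fun i _ => Finset.sum_congr rfl fun j _ => ?_
      rw [map_mul, Complex.conj_ofReal, ← unitExp_neg]
      have : unitExp (((i : ℤ) - j : ℤ) * (q / Q)) = unitExp (i * (q / Q)) * unitExp (-(j * (q / Q))) := by
        rw [← unitExp_add]
        congr 1
        push_cast
        ring
      rw [this]
      ring
    simp only [h1]
    rw [Finset.sum_comm, Finset.mul_sum]
    refine Finset.sum_congr rfl fun i hi => ?_
    rw [Finset.sum_comm]
    simp only [← Finset.mul_sum, sum_range_unitExp_div Q (by omega)]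
    rw [Finset.sum_eq_single i]
    · simp; ring
    · intro j hj hij
      rw [if_neg, mul_zero]
      intro hd
      simp only [Finset.mem_range] at hi hj
      have := Int.eq_zero_of_abs_lt_dvd hd (by rw [abs_lt]; constructor <;> omega)
      omega
    · intro h; exact absurd hi h
  exact_mod_cast hC

lemma coeff_triple_eq_sum_expSum (D u v : ℕ → ℝ) (n : ℕ) :
    ((2 * n + 1 : ℕ) : ℂ) * ((PowerSeries.coeff n (PowerSeries.mk D * (PowerSeries.mk u * PowerSeries.mk v)) : ℝ) : ℂ)
      = ∑ q ∈ Finset.range (2 * n + 1), unitExp (-(n * (q / (2 * n + 1 : ℕ)))) *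
        (expSum D n (q / (2 * n + 1 : ℕ)) *
        (expSum u n (q / (2 * n + 1 : ℕ)) * expSum v n (q / (2 * n + 1 : ℕ)))) := by
  -- For $i,j,k\le n$ the number $i+j+k-n$ lies in $[-n,2n]$, so this modulus detects its vanishing
  -- without wrap-around.
  set Q := 2 * n + 1 with hQ
  have h1 : ∀ q : ℕ, unitExp (-(n * (q / Q))) * (expSum D n (q / Q) *
        (expSum u n (q / Q) * expSum v n (q / Q))) =
      ∑ i ∈ Finset.range (n + 1), ∑ j ∈ Finset.range (n + 1), ∑ k ∈ Finset.range (n + 1),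
        ((D i : ℂ) * (u j * v k)) * unitExp (((i : ℤ) + j + k - n : ℤ) * (q / Q)) := by
    intro q
    simp only [expSum]
    rw [Finset.sum_mul_sum, Finset.sum_mul_sum, Finset.mul_sum]
    refine Finset.sum_congr rfl fun i _ => ?_
    rw [Finset.mul_sum]
    refine Finset.sum_congr rfl fun j _ => ?_
    rw [Finset.mul_sum, Finset.mul_sum]
    refine Finset.sum_congr rfl fun k _ => ?_
    have : unitExp (((i : ℤ) + j + k - n : ℤ) * (q / Q)) = unitExp (-(n * (q / Q))) *
        (unitExp (i * (q / Q)) * (unitExp (j * (q / Q)) * unitExp (k * (q / Q)))) := by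
      rw [← unitExp_add, ← unitExp_add, ← unitExp_add]
      congr 1
      push_cast
      ring
    rw [this]
    ring
  simp only [h1]
  rw [Finset.sum_comm, PowerSeries.coeff_mul, Finset.Nat.sum_antidiagonal_eq_sum_range_succ_mk]
  rw [Complex.ofReal_sum, Finset.mul_sum]
  refine Finset.sum_congr rfl fun i hi => ?_
  rw [Finset.sum_comm]
  simp only [Finset.mem_range] at hi
  have hinner : ∀ j ∈ Finset.range (n + 1), (∑ q ∈ Finset.range Q, ∑ k ∈ Finset.range (n + 1),
      ((D i : ℂ) * (u j * v k)) * unitExp (((i : ℤ) + j + k - n : ℤ) * (q / Q))) =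
      if j ≤ n - i then (Q : ℂ) * (D i * (u j * v (n - i - j))) else 0 := by
    intro j hj
    simp only [Finset.mem_range] at hj
    rw [Finset.sum_comm]
    simp only [← Finset.mul_sum, sum_range_unitExp_div Q (by omega)]
    split_ifs with h
    · rw [Finset.sum_eq_single (n - i - j)]
      · rw [if_pos]
        · ring
        · have : (i : ℤ) + j + ((n - i - j : ℕ) : ℤ) - n = 0 := by omega
          rw [this]
          exact dvd_zero _
      · intro k hk hne
        simp only [Finset.mem_range] at hk
        rw [if_neg, mul_zero]
        intro hd
        have := Int.eq_zero_of_abs_lt_dvd hd (by rw [abs_lt]; constructor <;> omega)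
        omega
      · intro h2
        simp only [Finset.mem_range] at h2
        omega
    · refine Finset.sum_eq_zero fun k hk => ?_
      simp only [Finset.mem_range] at hk
      rw [if_neg, mul_zero]
      intro hd
      have := Int.eq_zero_of_abs_lt_dvd hd (by rw [abs_lt]; constructor <;> omega)
      omega
  rw [Finset.sum_congr rfl hinner, ← Finset.sum_filter]
  have hf : (Finset.range (n + 1)).filter (fun j => j ≤ n - i) = Finset.range (n - i + 1) := by
    ext j; simp; omega
  rw [hf, PowerSeries.coeff_mul, Finset.Nat.sum_antidiagonal_eq_sum_range_succ_mk]
  push_cast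
  simp only [PowerSeries.coeff_mk, Finset.mul_sum]

/-- A triple convolution is controlled by the exponential sums of one factor and the mean squares of
the other two. -/
theorem abs_coeff_mul_mul_le (D u v : ℕ → ℝ) (n : ℕ) {B : ℝ} (hB : ∀ ξ, ‖expSum D n ξ‖ ≤ B) :
    |PowerSeries.coeff n (PowerSeries.mk D * (PowerSeries.mk u * PowerSeries.mk v))| ≤
      B * Real.sqrt ((∑ m ∈ Finset.range (n + 1), u m ^ 2) * ∑ m ∈ Finset.range (n + 1), v m ^ 2) := by
  have hB0 : 0 ≤ B := (norm_nonneg _).trans (hB 0)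
  set Q := 2 * n + 1 with hQ
  have hQpos : (0 : ℝ) < Q := by rw [hQ]; positivity
  have key := coeff_triple_eq_sum_expSum D u v n
  rw [← hQ] at key
  set c := PowerSeries.coeff n (PowerSeries.mk D * (PowerSeries.mk u * PowerSeries.mk v))
  have h1 : Q * |c| ≤ ∑ q ∈ Finset.range Q, B * (‖expSum u n (q / Q)‖ * ‖expSum v n (q / Q)‖) := by
    have : (Q : ℝ) * |c| = ‖((Q : ℕ) : ℂ) * (c : ℂ)‖ := by
      rw [norm_mul, Complex.norm_natCast, Complex.norm_real, Real.norm_eq_abs]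
    rw [this, key]
    refine norm_sum_le_of_le _ fun q _ => ?_
    rw [norm_mul, norm_unitExp, one_mul, norm_mul, norm_mul]
    gcongr
    exact hB _
  rw [← Finset.mul_sum] at h1
  have cs := Real.sum_mul_le_sqrt_mul_sqrt (Finset.range Q) (fun q => ‖expSum u n (q / Q)‖)
    (fun q => ‖expSum v n (q / Q)‖)
  rw [sum_norm_expSum_sq u n Q (by omega), sum_norm_expSum_sq v n Q (by omega)] at cs
  set U := ∑ m ∈ Finset.range (n + 1), u m ^ 2
  set V := ∑ m ∈ Finset.range (n + 1), v m ^ 2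
  have hU : 0 ≤ U := Finset.sum_nonneg fun _ _ => sq_nonneg _
  rw [Real.sqrt_mul hQpos.le, Real.sqrt_mul hQpos.le] at cs
  have e : Real.sqrt Q * Real.sqrt U * (Real.sqrt Q * Real.sqrt V) = Q * Real.sqrt (U * V) := by
    rw [Real.sqrt_mul hU]
    have := Real.mul_self_sqrt hQpos.le
    linear_combination (Real.sqrt U * Real.sqrt V) * this
  rw [e] at cs
  have h2 := h1.trans (mul_le_mul_of_nonneg_left cs hB0)
  have h3 : Q * |c| ≤ Q * (B * Real.sqrt (U * V)) := by linarith
  exact le_of_mul_le_mul_left h3 hQpos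

/-! ### Regularly varying sequences and Beta integrals. -/

/-- A positive sequence which is regularly varying of index `ρ`, together with the Potter type bound
that makes its convolutions accessible to dominated convergence. -/
structure RegularlyVaryingSeq (ρ : ℝ) (u : ℕ → ℝ) : Prop where
  pos : ∀ n, 0 < u n
  tendsto : ∀ (k : ℕ → ℕ) (t : ℝ), 0 < t → Tendsto (fun n : ℕ => (k n : ℝ) / n) atTop (𝓝 t) →
    Tendsto (fun n => u (k n) / u n) atTop (𝓝 (t ^ ρ))
  bound : ∃ C : ℝ, ∀ m n : ℕ, m ≤ n → u m ≤ C * (((n : ℝ) + 1) / (m + 1)) ^ (1 / 2 : ℝ) * u n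

/-- The additive convolution of two sequences. -/
noncomputable def addConv (u v : ℕ → ℝ) (n : ℕ) : ℝ := ∑ i ∈ Finset.range (n + 1), u i * v (n - i)

lemma coeff_mk_mul_mk (u v : ℕ → ℝ) (n : ℕ) :
    PowerSeries.coeff n (PowerSeries.mk u * PowerSeries.mk v) = addConv u v n := by
  rw [PowerSeries.coeff_mul, Finset.Nat.sum_antidiagonal_eq_sum_range_succ_mk]
  simp [addConv]

lemma mk_mul_mk (u v : ℕ → ℝ) :
    PowerSeries.mk u * PowerSeries.mk v = PowerSeries.mk (addConv u v) := by
  ext n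
  rw [coeff_mk_mul_mk, PowerSeries.coeff_mk]

/-- Writes a sum exactly as the integral of a step function on $[0,1]$, so that dominated
convergence can replace a Riemann sum argument. -/
lemma sum_range_eq_integral (g : ℕ → ℝ) (N : ℕ) (hN : 0 < N) :
    ∑ i ∈ Finset.range N, g i = N * ∫ t in (0 : ℝ)..1, g ⌊(N : ℝ) * t⌋₊ := by
  have h1 : ∀ i : ℕ, EqOn (fun s : ℝ => g ⌊s⌋₊) (fun _ => g i) (Ioo (i : ℝ) ((i + 1 : ℕ) : ℝ)) := by
    intro i s hs
    have : ⌊s⌋₊ = i := by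
      rw [Nat.floor_eq_iff ((Nat.cast_nonneg i).trans hs.1.le)]
      exact ⟨hs.1.le, by have := hs.2; push_cast at this; exact this⟩
    simp only [this]
  have h2 : ∀ i : ℕ, ∫ s in (i : ℝ)..((i + 1 : ℕ) : ℝ), g ⌊s⌋₊ = g i := by
    intro i
    rw [intervalIntegral.integral_congr_Ioo_of_le (by push_cast; linarith) (h1 i)]
    simp
  have h3 : ∀ i < N, IntervalIntegrable (fun s : ℝ => g ⌊s⌋₊) MeasureTheory.volume (i : ℝ) ((i + 1 : ℕ) : ℝ) := by
    intro i _
    have hc : IntervalIntegrable (fun _ : ℝ => g i) MeasureTheory.volume (i : ℝ) ((i + 1 : ℕ) : ℝ) :=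
      intervalIntegrable_const
    refine hc.congr_uIoo ?_
    rw [uIoo_of_le (by push_cast; linarith)]
    exact (h1 i).symm
  have h4 := intervalIntegral.sum_integral_adjacent_intervals (a := fun i : ℕ => (i : ℝ)) h3
  simp only [h2] at h4
  rw [h4]
  have hN' : (N : ℝ) ≠ 0 := by positivity
  have := intervalIntegral.integral_comp_mul_left (a := 0) (b := 1) (fun s : ℝ => g ⌊s⌋₊) hN'
  rw [this]
  simp [hN']

lemma integrableOn_beta {a b : ℝ} (ha : 0 < a) (hb : 0 < b) :
    MeasureTheory.IntegrableOn (fun t : ℝ => t ^ (a - 1) * (1 - t) ^ (b - 1)) (Ioo 0 1) := by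
  have h := Complex.betaIntegral_convergent (u := a) (v := b) (by simpa) (by simpa)
  rw [intervalIntegrable_iff_integrableOn_Ioo_of_le (by simp)] at h
  have h2 := h.re
  refine MeasureTheory.IntegrableOn.congr_fun h2 (fun x hx => ?_) measurableSet_Ioo
  norm_cast
  rw [← Complex.ofReal_cpow, ← Complex.ofReal_cpow, RCLike.re_to_complex, Complex.re_mul_ofReal,
    Complex.ofReal_re]
  · linarith [hx.2]
  · exact hx.1.le

lemma integral_beta {a b : ℝ} (ha : 0 < a) (hb : 0 < b) :
    ∫ t in Ioo (0 : ℝ) 1, t ^ (a - 1) * (1 - t) ^ (b - 1) =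
      Real.Gamma a * Real.Gamma b / Real.Gamma (a + b) := by
  have h1 := ProbabilityTheory.beta_eq_betaIntegralReal a b ha hb
  rw [ProbabilityTheory.beta] at h1
  rw [h1, Complex.betaIntegral, intervalIntegral.integral_of_le (by norm_num),
    MeasureTheory.integral_Ioc_eq_integral_Ioo, ← RCLike.re_to_complex, ← integral_re]
  · refine MeasureTheory.setIntegral_congr_fun measurableSet_Ioo fun x hx => ?_
    norm_cast
    rw [← Complex.ofReal_cpow, ← Complex.ofReal_cpow, RCLike.re_to_complex, Complex.re_mul_ofReal,
      Complex.ofReal_re]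
    · linarith [hx.2]
    · exact hx.1.le
  · have h := Complex.betaIntegral_convergent (u := a) (v := b) (by simpa) (by simpa)
    rwa [intervalIntegrable_iff_integrableOn_Ioo_of_le (by simp)] at h

lemma RegularlyVaryingSeq.exists_one_le_bound {ρ : ℝ} {u : ℕ → ℝ} (hu : RegularlyVaryingSeq ρ u) :
    ∃ C : ℝ, 1 ≤ C ∧
      ∀ m n : ℕ, m ≤ n → u m ≤ C * (((n : ℝ) + 1) / (m + 1)) ^ (1 / 2 : ℝ) * u n := by
  obtain ⟨C, hC⟩ := hu.bound
  refine ⟨C, ?_, hC⟩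
  have := hC 0 0 le_rfl
  simp at this
  exact (le_mul_iff_one_le_left (hu.pos 0)).1 this

lemma tendsto_floor_div {t : ℝ} (ht : 0 < t) :
    Tendsto (fun n : ℕ => (⌊((n + 1 : ℕ) : ℝ) * t⌋₊ : ℝ) / n) atTop (𝓝 t) := by
  have h1 : Tendsto (fun n : ℕ => (⌊t * ((n + 1 : ℕ) : ℝ)⌋₊ : ℝ) / ((n + 1 : ℕ) : ℝ)) atTop (𝓝 t) :=
    (tendsto_nat_floor_mul_div_atTop ht.le).comp
      (tendsto_natCast_atTop_atTop.comp (tendsto_add_atTop_nat 1))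
  have h2 : Tendsto (fun n : ℕ => ((n + 1 : ℕ) : ℝ) / n) atTop (𝓝 1) := by
    have := (tendsto_const_nhds (x := (1 : ℝ))).add (tendsto_one_div_atTop_nhds_zero_nat (𝕜 := ℝ))
    rw [add_zero] at this
    refine this.congr' ?_
    filter_upwards [eventually_gt_atTop 0] with n hn
    push_cast
    field_simp
  have h3 := h1.mul h2
  rw [mul_one] at h3
  refine h3.congr' ?_
  filter_upwards [eventually_gt_atTop 0] with n hn
  rw [mul_comm t]
  have : ((n + 1 : ℕ) : ℝ) ≠ 0 := by positivity
  field_simp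

/-- Asymptotics of the convolution of two regularly varying sequences. -/
theorem RegularlyVaryingSeq.tendsto_addConv {ρ σ : ℝ} {u v : ℕ → ℝ} (hρ : -1 < ρ) (hσ : -1 < σ)
    (hu : RegularlyVaryingSeq ρ u) (hv : RegularlyVaryingSeq σ v) :
    Tendsto (fun n : ℕ => addConv u v n / (((n : ℝ) + 1) * (u n * v n))) atTop
      (𝓝 (Real.Gamma (ρ + 1) * Real.Gamma (σ + 1) / Real.Gamma ((ρ + 1) + (σ + 1)))) := by
  obtain ⟨C, hC1, hC⟩ := hu.exists_one_le_bound
  obtain ⟨D, hD1, hD⟩ := hv.exists_one_le_bound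
  set F : ℕ → ℝ → ℝ := fun n t => u ⌊((n + 1 : ℕ) : ℝ) * t⌋₊ * v (n - ⌊((n + 1 : ℕ) : ℝ) * t⌋₊) / (u n * v n)
    with hF
  have e1 : ∀ n, addConv u v n / (((n : ℝ) + 1) * (u n * v n)) = ∫ t in Ioo (0 : ℝ) 1, F n t := by
    intro n
    have := hu.pos n
    have := hv.pos n
    rw [addConv, sum_range_eq_integral (fun i => u i * v (n - i)) (n + 1) (by omega),
      intervalIntegral.integral_of_le (by norm_num), MeasureTheory.integral_Ioc_eq_integral_Ioo, hF]
    simp only [MeasureTheory.integral_div]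
    push_cast
    field_simp
  simp only [e1]
  rw [← integral_beta (by linarith) (by linarith)]
  simp only [add_sub_cancel_right]
  -- The exponent $1/2$ in the Potter bounds gives the majorant $t^{-1/2}(1-t)^{-1/2}$, integrable
  -- at both ends.
  have hint : MeasureTheory.IntegrableOn
      (fun t : ℝ => C * D * (t ^ ((1 / 2 : ℝ) - 1) * (1 - t) ^ ((1 / 2 : ℝ) - 1))) (Ioo 0 1) :=
    (integrableOn_beta (by norm_num) (by norm_num)).const_mul _
  refine MeasureTheory.tendsto_integral_filter_of_dominated_convergence _ ?_ ?_ hint ?_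
  · refine Eventually.of_forall fun n => Measurable.aestronglyMeasurable ?_
    have hfl : Measurable fun t : ℝ => ⌊((n + 1 : ℕ) : ℝ) * t⌋₊ :=
      Nat.measurable_floor.comp (measurable_const_mul _)
    have : F n = (fun m : ℕ => u m * v (n - m) / (u n * v n)) ∘ fun t : ℝ => ⌊((n + 1 : ℕ) : ℝ) * t⌋₊ := rfl
    rw [this]
    exact (measurable_from_top).comp hfl
  · refine Eventually.of_forall fun n => ?_
    refine (MeasureTheory.ae_restrict_mem measurableSet_Ioo).mono fun t ht => ?_
    have hn : (0 : ℝ) < n + 1 := by positivity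
    set m := ⌊((n + 1 : ℕ) : ℝ) * t⌋₊ with hm
    have hm1 : (m : ℝ) ≤ (n + 1) * t := by
      have := Nat.floor_le (show 0 ≤ ((n + 1 : ℕ) : ℝ) * t by have := ht.1; positivity)
      push_cast at this
      exact_mod_cast this
    have hm2 : (n + 1) * t ≤ (m : ℝ) + 1 := by
      have := (Nat.lt_floor_add_one (((n + 1 : ℕ) : ℝ) * t)).le
      push_cast at this
      exact_mod_cast this
    have hmn : m ≤ n := by
      have : (m : ℝ) < n + 1 := hm1.trans_lt (by nlinarith [ht.2])
      exact_mod_cast Nat.lt_succ_iff.1 (by exact_mod_cast this)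
    have b1 := hC m n hmn
    have b2 := hD (n - m) n (Nat.sub_le _ _)
    have un := hu.pos n
    have vn := hv.pos n
    have um := hu.pos m
    have vm := hv.pos (n - m)
    have ht1 : 0 < 1 - t := by linarith [ht.2]
    have conv : ∀ s r : ℝ, 0 < s → (n + 1) * s ≤ r → (((n : ℝ) + 1) / r) ^ (1 / 2 : ℝ) ≤ s ^ ((1 / 2 : ℝ) - 1) := by
      intro s r hs hr
      have : ((1 / 2 : ℝ) - 1) = -(1 / 2) := by norm_num
      have hr0 : 0 < r := lt_of_lt_of_le (by positivity) hr
      rw [this, Real.rpow_neg hs.le, ← Real.inv_rpow hs.le]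
      refine Real.rpow_le_rpow (by positivity) ?_ (by norm_num)
      rw [div_le_iff₀ hr0, inv_mul_eq_div, le_div_iff₀ hs]
      exact hr
    have c1 := conv t (m + 1) ht.1 hm2
    have c2 := conv (1 - t) (((n - m : ℕ) : ℝ) + 1) ht1 (by rw [Nat.cast_sub hmn]; linarith)
    have d1 : u m / u n ≤ C * t ^ ((1 / 2 : ℝ) - 1) := by
      rw [div_le_iff₀ un]
      refine b1.trans ?_
      gcongr
    have d2 : v (n - m) / v n ≤ D * (1 - t) ^ ((1 / 2 : ℝ) - 1) := by
      rw [div_le_iff₀ vn]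
      refine b2.trans ?_
      gcongr
    have : F n t = u m / u n * (v (n - m) / v n) := by
      simp only [hF, ← hm]
      field_simp
    rw [this, Real.norm_eq_abs, abs_of_pos (by positivity)]
    have ht0 := ht.1
    refine (mul_le_mul d1 d2 (by positivity) (by positivity)).trans (le_of_eq (by ring))
  · refine (MeasureTheory.ae_restrict_mem measurableSet_Ioo).mono fun t ht => ?_
    have ht1 : 0 < 1 - t := by linarith [ht.2]
    have k1 := tendsto_floor_div ht.1
    have k2 : Tendsto (fun n : ℕ => ((n - ⌊((n + 1 : ℕ) : ℝ) * t⌋₊ : ℕ) : ℝ) / n) atTop (𝓝 (1 - t)) := by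
      refine ((tendsto_const_nhds (x := (1 : ℝ))).sub k1).congr' ?_
      filter_upwards [eventually_gt_atTop 0] with n hn
      have hmn : ⌊((n + 1 : ℕ) : ℝ) * t⌋₊ ≤ n := by
        rw [← Nat.lt_succ_iff, Nat.floor_lt' (by omega)]
        have : (0 : ℝ) < ((n + 1 : ℕ) : ℝ) := by positivity
        show ((n + 1 : ℕ) : ℝ) * t < ((n + 1 : ℕ) : ℝ)
        nlinarith [ht.2]
      rw [Nat.cast_sub hmn]
      field_simp
    have := (hu.tendsto _ _ ht.1 k1).mul (hv.tendsto _ _ ht1 k2)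
    refine this.congr fun n => ?_
    simp only [hF]
    rw [div_mul_div_comm]

/-- The convolution of two regularly varying sequences is regularly varying. -/
theorem RegularlyVaryingSeq.addConv {ρ σ : ℝ} {u v : ℕ → ℝ} (hρ : -1 < ρ) (hσ : -1 < σ)
    (hu : RegularlyVaryingSeq ρ u) (hv : RegularlyVaryingSeq σ v) :
    RegularlyVaryingSeq (1 + (ρ + σ)) (addConv u v) := by
  have lim := hu.tendsto_addConv hρ hσ hv
  set B := Real.Gamma (ρ + 1) * Real.Gamma (σ + 1) / Real.Gamma ((ρ + 1) + (σ + 1)) with hB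
  have hBpos : 0 < B := by
    have := Real.Gamma_pos_of_pos (show 0 < ρ + 1 by linarith)
    have := Real.Gamma_pos_of_pos (show 0 < σ + 1 by linarith)
    have := Real.Gamma_pos_of_pos (show 0 < (ρ + 1) + (σ + 1) by linarith)
    positivity
  set w : ℕ → ℝ := _root_.addConv u v with hw
  set g : ℕ → ℝ := fun n => ((n : ℝ) + 1) * (u n * v n) with hg
  have gpos : ∀ n, 0 < g n := fun n => by
    have := hu.pos n
    have := hv.pos n
    simp only [hg]
    positivity
  have wpos : ∀ n, 0 < w n := fun n =>
    Finset.sum_pos (fun i _ => mul_pos (hu.pos i) (hv.pos _)) (by simp)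
  refine ⟨wpos, ?_, ?_⟩
  · intro k t ht hk
    have hktop : Tendsto k atTop atTop := by
      rw [← tendsto_natCast_atTop_iff (R := ℝ)]
      have := hk.pos_mul_atTop ht (tendsto_natCast_atTop_atTop (R := ℝ))
      refine this.congr' ?_
      filter_upwards [eventually_gt_atTop 0] with n hn
      field_simp
    have l1 := lim.comp hktop
    have l2 : Tendsto (fun n : ℕ => ((k n : ℝ) + 1) / (n + 1)) atTop (𝓝 t) := by
      have h1 : Tendsto (fun n : ℕ => (n : ℝ) / (n + 1)) atTop (𝓝 1) :=
        tendsto_natCast_div_add_atTop 1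
      have h2 : Tendsto (fun n : ℕ => 1 / ((n : ℝ) + 1)) atTop (𝓝 0) :=
        tendsto_one_div_add_atTop_nhds_zero_nat
      have h3 := (hk.mul h1).add h2
      rw [mul_one, add_zero] at h3
      refine h3.congr' ?_
      filter_upwards [eventually_gt_atTop 0] with n hn
      field_simp
    have l3 := (l1.mul (l2.mul ((hu.tendsto k t ht hk).mul (hv.tendsto k t ht hk)))).mul
      (lim.inv₀ hBpos.ne')
    have e : B * (t * (t ^ ρ * t ^ σ)) * B⁻¹ = t ^ (1 + (ρ + σ)) := by
      rw [Real.rpow_add ht, Real.rpow_add ht, Real.rpow_one]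
      field_simp
    rw [e] at l3
    refine l3.congr fun n => ?_
    simp only [Function.comp]
    have := hu.pos n
    have := hv.pos n
    have := hu.pos (k n)
    have := hv.pos (k n)
    have := wpos n
    have := wpos (k n)
    field_simp
  · obtain ⟨C, hC1, hC⟩ := hu.exists_one_le_bound
    obtain ⟨D, hD1, hD⟩ := hv.exists_one_le_bound
    obtain ⟨K, hK⟩ := lim.bddAbove_range
    obtain ⟨K', hK'⟩ := (lim.inv₀ hBpos.ne').bddAbove_range
    have hK0 : ∀ n, w n ≤ K * g n := fun n => by
      have := hK (Set.mem_range_self n)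
      exact (div_le_iff₀ (gpos n)).1 this
    have hK1 : ∀ n, g n ≤ K' * w n := fun n => by
      have := hK' (Set.mem_range_self n)
      simp only [inv_div] at this
      exact (div_le_iff₀ (wpos n)).1 this
    have Kpos : 0 < K := by
      have := (wpos 0).trans_le (hK0 0)
      exact pos_of_mul_pos_left this (gpos 0).le
    refine ⟨K * (C * D) * K', fun m n hmn => ?_⟩
    have hr : (1 : ℝ) ≤ ((n : ℝ) + 1) / (m + 1) := by
      rw [one_le_div (by positivity)]
      have : (m : ℝ) ≤ n := by exact_mod_cast hmn
      linarith
    set r := ((n : ℝ) + 1) / (m + 1) with hrdef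
    have hr0 : 0 < r := by linarith
    have hgm : g m ≤ C * D * g n := by
      have h1 := hC m n hmn
      have h2 := hD m n hmn
      have un := hu.pos n
      have vn := hv.pos n
      have h3 := mul_le_mul h1 h2 (hv.pos m).le (by positivity)
      -- The two losses $r^{1/2}$ multiply to $r=(n+1)/(m+1)$, which the factor $m+1$ in `g m`
      -- cancels exactly.
      have h4 : C * r ^ (1 / 2 : ℝ) * u n * (D * r ^ (1 / 2 : ℝ) * v n) = C * D * r * (u n * v n) := by
        have : r ^ (1 / 2 : ℝ) * r ^ (1 / 2 : ℝ) = r := by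
          rw [← Real.rpow_add hr0]; norm_num
        linear_combination (C * D * (u n * v n)) * this
      rw [h4] at h3
      have h5 : ((m : ℝ) + 1) * r = n + 1 := by rw [hrdef]; field_simp
      have h6 := mul_le_mul_of_nonneg_left h3 (show (0 : ℝ) ≤ m + 1 by positivity)
      simp only [hg]
      refine h6.trans (le_of_eq ?_)
      linear_combination (C * D * (u n * v n)) * h5
    have h7 : w m ≤ K * (C * D) * K' * w n := by
      have := mul_le_mul_of_nonneg_left (hgm.trans (mul_le_mul_of_nonneg_left (hK1 n)
        (by positivity : (0 : ℝ) ≤ C * D))) Kpos.le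
      refine (hK0 m).trans (this.trans (le_of_eq (by ring)))
    have h8 : (1 : ℝ) ≤ r ^ (1 / 2 : ℝ) := Real.one_le_rpow hr (by norm_num)
    have h9 : 0 ≤ K * (C * D) * K' * w n := (wpos m).le.trans h7
    calc w m ≤ K * (C * D) * K' * w n * 1 := by rw [mul_one]; exact h7
      _ ≤ K * (C * D) * K' * w n * r ^ (1 / 2 : ℝ) := mul_le_mul_of_nonneg_left h8 h9
      _ = _ := by ring

/-- Asymptotics of the triple convolution of regularly varying sequences. -/
theorem RegularlyVaryingSeq.tendsto_coeff_triple {ρ σ τ : ℝ} {u v w : ℕ → ℝ} (hρ : -1 < ρ)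
    (hσ : -1 < σ) (hτ : -1 < τ) (hu : RegularlyVaryingSeq ρ u) (hv : RegularlyVaryingSeq σ v)
    (hw : RegularlyVaryingSeq τ w) :
    Tendsto (fun n : ℕ => PowerSeries.coeff n
        (PowerSeries.mk u * (PowerSeries.mk v * PowerSeries.mk w)) / ((n : ℝ) ^ 2 * u n * v n * w n))
      atTop (𝓝 (Real.Gamma (ρ + 1) * Real.Gamma (σ + 1) * Real.Gamma (τ + 1) /
        Real.Gamma ((ρ + 1) + (σ + 1) + (τ + 1)))) := by
  have l1 := hv.tendsto_addConv hσ hτ hw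
  have l2 := hu.tendsto_addConv hρ (by linarith) (hv.addConv hσ hτ hw)
  have l3 : Tendsto (fun n : ℕ => ((n : ℝ) / (n + 1))) atTop (𝓝 1) := tendsto_natCast_div_add_atTop 1
  have l4 := (l2.mul l1).mul ((l3.mul l3).inv₀ (by norm_num))
  have e0 : Real.Gamma ((σ + 1) + (τ + 1)) ≠ 0 := (Real.Gamma_pos_of_pos (by linarith)).ne'
  have e1 : 1 + (σ + τ) + 1 = (σ + 1) + (τ + 1) := by ring
  have e : Real.Gamma (ρ + 1) * Real.Gamma (1 + (σ + τ) + 1) / Real.Gamma (ρ + 1 + (1 + (σ + τ) + 1)) *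
      (Real.Gamma (σ + 1) * Real.Gamma (τ + 1) / Real.Gamma (σ + 1 + (τ + 1))) * (1 * 1)⁻¹ =
      Real.Gamma (ρ + 1) * Real.Gamma (σ + 1) * Real.Gamma (τ + 1) /
        Real.Gamma ((ρ + 1) + (σ + 1) + (τ + 1)) := by
    rw [e1, add_assoc (ρ + 1)]
    field_simp
  rw [e] at l4
  refine l4.congr' ?_
  filter_upwards [eventually_gt_atTop 0] with n hn
  rw [mk_mul_mk, coeff_mk_mul_mk]
  have := hu.pos n
  have := hv.pos n
  have := hw.pos n
  have := (hv.addConv hσ hτ hw).pos n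
  field_simp

/-! ### Potter bounds from logarithmic derivatives. -/

/-- A function with `x H' / H → ρ` satisfies Potter bounds of index `ρ`. -/
lemma exists_potter_of_tendsto {H H' : ℝ → ℝ} {ρ : ℝ} (hH : ∀ᶠ x in atTop, HasDerivAt H (H' x) x)
    (hpos : ∀ᶠ x in atTop, 0 < H x) (hlim : Tendsto (fun x => x * H' x / H x) atTop (𝓝 ρ))
    {ε : ℝ} (hε : 0 < ε) :
    ∃ X : ℝ, 1 ≤ X ∧ ∀ u v, X ≤ u → u ≤ v →
      (v / u) ^ (ρ - ε) * H u ≤ H v ∧ H v ≤ (v / u) ^ (ρ + ε) * H u := by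
  have hl := hlim.eventually (Ioo_mem_nhds (sub_lt_self ρ hε) (lt_add_of_pos_right ρ hε))
  obtain ⟨X, hX⟩ := eventually_atTop.1 (hH.and (hpos.and (hl.and (eventually_ge_atTop 1))))
  have h1X := (hX X le_rfl).2.2.2
  -- The function $\log H-a\log x$ has derivative $(xH'/H-a)/x$, so it is eventually increasing for
  -- $a=\rho-\varepsilon$ and decreasing for $a=\rho+\varepsilon$.
  have hder : ∀ a : ℝ, ∀ x ∈ Ici X, HasDerivAt (fun x => Real.log (H x) - a * Real.log x)
      (H' x / H x - a * x⁻¹) x := by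
    intro a x hx
    obtain ⟨d, p, _, x1⟩ := hX x hx
    exact (d.log p.ne').sub ((Real.hasDerivAt_log (by linarith)).const_mul a)
  have hcont : ∀ a : ℝ, ContinuousOn (fun x => Real.log (H x) - a * Real.log x) (Ici X) :=
    fun a x hx => (hder a x hx).continuousAt.continuousWithinAt
  have key : ∀ a : ℝ, ∀ u v, X ≤ u → u ≤ v → (v / u) ^ a * H u =
      Real.exp (a * (Real.log v - Real.log u) + Real.log (H u)) := by
    intro a u v hu huv
    have u0 : 0 < u := by linarith
    have v0 : 0 < v := by linarith
    rw [Real.exp_add, Real.exp_log (hX u hu).2.1, Real.rpow_def_of_pos (by positivity),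
      Real.log_div v0.ne' u0.ne', mul_comm a]
  refine ⟨X, h1X, fun u v hu huv => ?_⟩
  have hv : X ≤ v := hu.trans huv
  have hvp := (hX v hv).2.1
  constructor
  · have mono : MonotoneOn (fun x => Real.log (H x) - (ρ - ε) * Real.log x) (Ici X) := by
      refine monotoneOn_of_deriv_nonneg (convex_Ici X) (hcont _) ?_ ?_
      · intro x hx
        exact (hder _ x (interior_subset hx)).differentiableAt.differentiableWithinAt
      · intro x hx
        have hx' := interior_subset hx
        rw [(hder _ x hx').deriv]
        obtain ⟨_, p, l, x1⟩ := hX x hx'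
        have x0 : 0 < x := by linarith
        have := l.1.le
        rw [le_div_iff₀ p] at this
        rw [sub_nonneg, le_div_iff₀ p]
        have e : (ρ - ε) * x⁻¹ * H x = ((ρ - ε) * H x) / x := by ring
        rw [e, div_le_iff₀ x0]
        linarith
    have := mono hu hv huv
    simp only at this
    rw [key _ u v hu huv, ← Real.exp_log hvp, Real.exp_le_exp]
    linarith
  · have anti : AntitoneOn (fun x => Real.log (H x) - (ρ + ε) * Real.log x) (Ici X) := by
      refine antitoneOn_of_deriv_nonpos (convex_Ici X) (hcont _) ?_ ?_
      · intro x hx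
        exact (hder _ x (interior_subset hx)).differentiableAt.differentiableWithinAt
      · intro x hx
        have hx' := interior_subset hx
        rw [(hder _ x hx').deriv]
        obtain ⟨_, p, l, x1⟩ := hX x hx'
        have x0 : 0 < x := by linarith
        have := l.2.le
        rw [div_le_iff₀ p] at this
        rw [sub_nonpos, div_le_iff₀ p]
        have e : (ρ + ε) * x⁻¹ * H x = ((ρ + ε) * H x) / x := by ring
        rw [e, le_div_iff₀ x0]
        linarith
    have := anti hu hv huv
    simp only at this
    rw [key _ u v hu huv, ← Real.exp_log hvp, Real.exp_le_exp]
    linarith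

lemma exists_rpow_bounds_of_tendsto {H H' : ℝ → ℝ} {ρ : ℝ}
    (hH : ∀ᶠ x in atTop, HasDerivAt H (H' x) x)
    (hpos : ∀ᶠ x in atTop, 0 < H x) (hlim : Tendsto (fun x => x * H' x / H x) atTop (𝓝 ρ))
    {ε : ℝ} (hε : 0 < ε) :
    ∃ B : ℝ, 0 < B ∧ ∀ᶠ x in atTop, B⁻¹ * x ^ (ρ - ε) ≤ H x ∧ H x ≤ B * x ^ (ρ + ε) := by
  obtain ⟨X, hX1, hX⟩ := exists_potter_of_tendsto hH hpos hlim hε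
  obtain ⟨u, hu, hXu⟩ := (hpos.and (eventually_ge_atTop X)).exists
  have u0 : 0 < u := by linarith
  have a1 : 0 < u ^ (ρ - ε) := by positivity
  have a2 : 0 < u ^ (ρ + ε) := by positivity
  refine ⟨max (u ^ (ρ - ε) / H u) (H u / u ^ (ρ + ε)), lt_max_of_lt_left (by positivity), ?_⟩
  filter_upwards [eventually_ge_atTop u] with x hx
  have x0 : 0 < x := by linarith
  have b1 : 0 < x ^ (ρ - ε) := by positivity
  have b2 : 0 < x ^ (ρ + ε) := by positivity
  obtain ⟨h1, h2⟩ := hX u x hXu hx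
  rw [Real.div_rpow x0.le u0.le] at h1 h2
  constructor
  · refine le_trans ?_ h1
    have : (max (u ^ (ρ - ε) / H u) (H u / u ^ (ρ + ε)))⁻¹ ≤ (u ^ (ρ - ε) / H u)⁻¹ :=
      inv_anti₀ (by positivity) (le_max_left _ _)
    calc _ ≤ (u ^ (ρ - ε) / H u)⁻¹ * x ^ (ρ - ε) := by gcongr
      _ = _ := by field_simp
  · refine h2.trans ?_
    calc _ = H u / u ^ (ρ + ε) * x ^ (ρ + ε) := by field_simp
      _ ≤ _ := by gcongr; exact le_max_right _ _

/-! ### Logarithmic derivatives of $h$ and $h'$. -/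

namespace IsRegularlyVarying

variable {c x₀ : ℝ} {h : ℝ → ℝ}

lemma hasDerivAt (hh : IsRegularlyVarying c x₀ h) {x : ℝ} (hx : x₀ < x) :
    HasDerivAt h (derivWithin h (Ici x₀) x) x :=
  (hh.contDiffOn.differentiableOn (by norm_num) x hx.le).hasDerivWithinAt.hasDerivAt (Ici_mem_nhds hx)

lemma hasDerivAt_derivWithin (hh : IsRegularlyVarying c x₀ h) {x : ℝ} (hx : x₀ < x) :
    HasDerivAt (derivWithin h (Ici x₀)) (iteratedDerivWithin 2 h (Ici x₀) x) x := by
  have h1 : ContDiffOn ℝ 2 (derivWithin h (Ici x₀)) (Ici x₀) :=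
    hh.contDiffOn.derivWithin (uniqueDiffOn_Ici x₀) (by norm_num)
  have h2 := (h1.differentiableOn (by norm_num) x hx.le).hasDerivWithinAt.hasDerivAt (Ici_mem_nhds hx)
  have h3 : iteratedDerivWithin 2 h (Ici x₀) x = derivWithin (derivWithin h (Ici x₀)) (Ici x₀) x := by
    rw [iteratedDerivWithin_succ, iteratedDerivWithin_one]
  rwa [h3]

/-- The logarithmic derivatives of `h` and `h'` in terms of the function `ϑ`. -/
lemma exists_theta (hh : IsRegularlyVarying c x₀ h) :
    ∃ ϑ : ℝ → ℝ,
      (∀ x, x₀ < x → x * derivWithin h (Ici x₀) x / h x = c + ϑ x) ∧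
      (∀ x, x₀ < x → x * iteratedDerivWithin 2 h (Ici x₀) x / derivWithin h (Ici x₀) x =
        c - 1 + ϑ x + x * derivWithin ϑ (Ici x₀) x / (c + ϑ x)) ∧
      Tendsto ϑ atTop (𝓝 0) ∧ Tendsto (fun x => x * derivWithin ϑ (Ici x₀) x) atTop (𝓝 0) ∧
      (c = 1 → (∀ x ∈ Ici x₀, 0 < ϑ x) ∧
        (∀ ε : ℝ, 0 < ε → ∃ A : ℝ, ∀ x ∈ Ici x₀, 1 / ϑ x ≤ A * x ^ ε) ∧
        Tendsto (fun x => x * derivWithin ϑ (Ici x₀) x / ϑ x) atTop (𝓝 0)) := by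
  obtain ⟨ϑ, hϑ, ⟨C, hC, hrep⟩, hc1, hc2⟩ := hh.representation
  have hx0 := hh.one_le_start
  have hcont : ContinuousOn (fun t => ϑ t / t) (Ici x₀) :=
    hϑ.continuousOn.div continuousOn_id fun t ht => by
      have : x₀ ≤ t := ht
      linarith
  have hI : ∀ x, x₀ < x → HasDerivAt (fun x => ∫ t in x₀..x, ϑ t / t) (ϑ x / x) x := by
    intro x hx
    refine intervalIntegral.integral_hasDerivAt_right ?_ ?_ ?_
    · refine (hcont.mono ?_).intervalIntegrable
      rw [uIcc_of_le hx.le]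
      exact Icc_subset_Ici_self
    · exact hcont.stronglyMeasurableAtFilter_nhdsWithin measurableSet_Ici x |>.filter_mono
        (by rw [nhdsWithin_eq_nhds.2 (Ici_mem_nhds hx)])
    · exact hcont.continuousAt (Ici_mem_nhds hx)
  have hd1 : ∀ x, x₀ < x → HasDerivAt h (h x * (c + ϑ x) / x) x := by
    intro x hx
    have x0 : 0 < x := by linarith
    have e := ((Real.hasDerivAt_rpow_const (x := x) (p := c) (Or.inl x0.ne')).const_mul C).mul
      (hI x hx).exp
    have heq : h =ᶠ[𝓝 x] fun x => C * x ^ c * Real.exp (∫ t in x₀..x, ϑ t / t) := by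
      filter_upwards [Ici_mem_nhds hx] with y hy using hrep y hy
    refine (e.congr_of_eventuallyEq heq).congr_deriv ?_
    rw [hrep x hx.le, Real.rpow_sub_one x0.ne']
    field_simp
  have hϑd : ∀ x, x₀ < x → HasDerivAt ϑ (derivWithin ϑ (Ici x₀) x) x := fun x hx =>
    (hϑ.differentiableOn (by norm_num) x hx.le).hasDerivWithinAt.hasDerivAt (Ici_mem_nhds hx)
  have hD1 : ∀ x, x₀ < x → derivWithin h (Ici x₀) x = h x * (c + ϑ x) / x := fun x hx =>
    (hh.hasDerivAt hx).unique (hd1 x hx)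
  have hD2 : ∀ x, x₀ < x → iteratedDerivWithin 2 h (Ici x₀) x =
      ((h x * (c + ϑ x) / x * (c + ϑ x) + h x * derivWithin ϑ (Ici x₀) x) * x -
        h x * (c + ϑ x)) / x ^ 2 := by
    intro x hx
    have x0 : 0 < x := by linarith
    have e := ((hd1 x hx).mul ((hϑd x hx).const_add c)).div (hasDerivAt_id x) x0.ne'
    have heq : derivWithin h (Ici x₀) =ᶠ[𝓝 x] fun x => h x * (c + ϑ x) / x := by
      filter_upwards [Ioi_mem_nhds hx] with y hy using hD1 y hy
    have := (hh.hasDerivAt_derivWithin hx).unique (e.congr_of_eventuallyEq heq)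
    rw [this]
    simp
  have hpos : ∀ x, x₀ < x → 0 < h x := fun x hx => by linarith [hh.one_le x hx.le]
  have hsum : ∀ x, x₀ < x → c + ϑ x ≠ 0 := by
    intro x hx h0
    have := hh.deriv_pos x hx.le
    rw [hD1 x hx, h0] at this
    simp at this
  refine ⟨ϑ, ?_, ?_, ?_, ?_, ?_⟩
  · intro x hx
    have x0 : 0 < x := by linarith
    have := hpos x hx
    rw [hD1 x hx]
    field_simp
  · intro x hx
    have x0 : 0 < x := by linarith
    have := hpos x hx
    have := hsum x hx
    rw [hD1 x hx, hD2 x hx]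
    field_simp
    ring
  · rcases eq_or_lt_of_le hh.one_le_exponent with h1 | h1
    · exact (hc2 h1.symm).2.2.2.2.1
    · exact (hc1 h1).1
  · rcases eq_or_lt_of_le hh.one_le_exponent with h1 | h1
    · have a := (hc2 h1.symm).2.2.2.2.2.1.mul (hc2 h1.symm).2.2.2.2.1
      rw [mul_zero] at a
      refine a.congr' ?_
      filter_upwards [eventually_ge_atTop x₀] with x hx
      have := (hc2 h1.symm).1 x hx
      field_simp
    · exact (hc1 h1).2.1
  · intro h1
    exact ⟨(hc2 h1).1, (hc2 h1).2.2.1, (hc2 h1).2.2.2.2.2.1⟩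

lemma tendsto_logDeriv (hh : IsRegularlyVarying c x₀ h) :
    Tendsto (fun x => x * derivWithin h (Ici x₀) x / h x) atTop (𝓝 c) := by
  obtain ⟨ϑ, h1, _, h3, _⟩ := hh.exists_theta
  have := h3.const_add c
  rw [add_zero] at this
  refine this.congr' ?_
  filter_upwards [eventually_gt_atTop x₀] with x hx using (h1 x hx).symm

lemma tendsto_logDeriv_deriv (hh : IsRegularlyVarying c x₀ h) :
    Tendsto (fun x => x * iteratedDerivWithin 2 h (Ici x₀) x / derivWithin h (Ici x₀) x) atTop
      (𝓝 (c - 1)) := by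
  obtain ⟨ϑ, _, h2, h3, h4, _⟩ := hh.exists_theta
  have hc : c + 0 ≠ 0 := by linarith [hh.one_le_exponent]
  have := (h3.const_add (c - 1)).add (h4.div (h3.const_add c) hc)
  simp only [add_zero, zero_div] at this
  refine this.congr' ?_
  filter_upwards [eventually_gt_atTop x₀] with x hx using (h2 x hx).symm

/-- For $c>1$ the quantity tends to $c-1>0$. For $c=1$ this limit is zero; there it is at least
$\vartheta/2$ eventually, and $1/\vartheta\ll x^{\varepsilon/2}$ supplies the lower bound. -/
lemma eventually_rpow_le_logDeriv_deriv (hh : IsRegularlyVarying c x₀ h) {ε : ℝ} (hε : 0 < ε) :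
    ∀ᶠ x in atTop, x ^ (-ε) ≤
      x * iteratedDerivWithin 2 h (Ici x₀) x / derivWithin h (Ici x₀) x := by
  rcases eq_or_lt_of_le hh.one_le_exponent with hc | hc
  · obtain ⟨ϑ, _, h2, h3, _, h5⟩ := hh.exists_theta
    obtain ⟨pos, hA, hlim⟩ := h5 hc.symm
    obtain ⟨A, hA⟩ := hA (ε / 2) (by positivity)
    have e1 := hlim.eventually (Ioi_mem_nhds (show -(1 / 2 : ℝ) < 0 by norm_num))
    have e2 := (tendsto_rpow_atTop (show 0 < ε / 2 by positivity)).eventually_ge_atTop (2 * A)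
    filter_upwards [e1, e2, eventually_gt_atTop x₀] with x g1 g2 hx
    have x0 : 0 < x := by linarith [hh.one_le_start]
    have p := pos x hx.le
    rw [h2 x hx, ← hc]
    have a1 := hA x hx.le
    rw [div_le_iff₀ p] at a1
    have g1' : -(1 / 2) * ϑ x ≤ x * derivWithin ϑ (Ici x₀) x := by
      have : -(1 / 2 : ℝ) < x * derivWithin ϑ (Ici x₀) x / ϑ x := g1
      rw [lt_div_iff₀ p] at this
      exact this.le
    have b1 : -(1 / 2) * ϑ x ≤ x * derivWithin ϑ (Ici x₀) x / (1 + ϑ x) := by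
      rw [le_div_iff₀ (by linarith)]
      nlinarith
    have y0 : 0 < x ^ (ε / 2) := by positivity
    have b2 : x ^ (-ε) = (x ^ (ε / 2) * x ^ (ε / 2))⁻¹ := by
      rw [← Real.rpow_add x0, Real.rpow_neg x0.le]
      ring_nf
    have b3 : x ^ (-ε) ≤ ϑ x / 2 := by
      rw [b2, inv_le_iff_one_le_mul₀ (by positivity)]
      nlinarith [mul_le_mul_of_nonneg_right g2 (mul_pos y0 p).le]
    linarith
  · have e1 := hh.tendsto_logDeriv_deriv.eventually
      (Ioi_mem_nhds (show (c - 1) / 2 < c - 1 by linarith))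
    have e2 := (tendsto_rpow_neg_atTop hε).eventually
      (Iio_mem_nhds (show 0 < (c - 1) / 2 by linarith))
    filter_upwards [e1, e2] with x g1 g2
    exact (lt_trans g2 g1).le

end IsRegularlyVarying

/-! ### The inverse function, its derivative and its curvature. -/

namespace IsRegularlyVarying

variable {c x₀ : ℝ} {h φ : ℝ → ℝ}

lemma strictMonoOn (hh : IsRegularlyVarying c x₀ h) : StrictMonoOn h (Ici x₀) := by
  refine strictMonoOn_of_deriv_pos (convex_Ici x₀) hh.contDiffOn.continuousOn fun x hx => ?_
  rw [interior_Ici] at hx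
  rw [(hh.hasDerivAt hx).deriv]
  exact hh.deriv_pos x (mem_Ici.2 (le_of_lt hx))

lemma tendsto_atTop (hh : IsRegularlyVarying c x₀ h) : Tendsto h atTop atTop := by
  obtain ⟨B, hB, hb⟩ := exists_rpow_bounds_of_tendsto (ε := 1 / 2)
    ((eventually_gt_atTop x₀).mono fun x hx => hh.hasDerivAt hx)
    ((eventually_ge_atTop x₀).mono fun x hx => by linarith [hh.one_le x hx])
    hh.tendsto_logDeriv (by norm_num)
  have hc := hh.one_le_exponent
  exact tendsto_atTop_mono' _ (hb.mono fun x hx => hx.1)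
    ((tendsto_rpow_atTop (by linarith)).const_mul_atTop (by positivity))

lemma exists_eq_of_le (hh : IsRegularlyVarying c x₀ h) {y : ℝ} (hy : h x₀ ≤ y) : ∃ x, x₀ ≤ x ∧ h x = y := by
  obtain ⟨b, hb, hxb⟩ := ((hh.tendsto_atTop.eventually_ge_atTop y).and (eventually_ge_atTop x₀)).exists
  obtain ⟨x, hx, rfl⟩ := intermediate_value_Icc hxb
    (hh.contDiffOn.continuousOn.mono Icc_subset_Ici_self) ⟨hy, hb⟩
  exact ⟨x, hx.1, rfl⟩

lemma le_inverse (hh : IsRegularlyVarying c x₀ h) (hφ : InvOn φ h (Ici x₀) (Ici (h x₀))) {y : ℝ}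
    (hy : h x₀ ≤ y) : x₀ ≤ φ y := by
  obtain ⟨x, hx, rfl⟩ := hh.exists_eq_of_le hy
  rw [hφ.1 hx]
  exact hx

lemma lt_inverse (hh : IsRegularlyVarying c x₀ h) (hφ : InvOn φ h (Ici x₀) (Ici (h x₀))) {y : ℝ}
    (hy : h x₀ < y) : x₀ < φ y := by
  refine lt_of_le_of_ne (hh.le_inverse hφ hy.le) fun h0 => ?_
  have := hφ.2 hy.le
  rw [← h0] at this
  linarith

lemma inverse_le_iff (hh : IsRegularlyVarying c x₀ h) (hφ : InvOn φ h (Ici x₀) (Ici (h x₀)))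
    {x y : ℝ} (hx : x₀ ≤ x) (hy : h x₀ ≤ y) : φ y ≤ x ↔ y ≤ h x := by
  rw [← hh.strictMonoOn.le_iff_le (hh.le_inverse hφ hy) hx, hφ.2 hy]

lemma strictMonoOn_inverse (hh : IsRegularlyVarying c x₀ h)
    (hφ : InvOn φ h (Ici x₀) (Ici (h x₀))) : StrictMonoOn φ (Ici (h x₀)) := by
  intro a ha b hb hab
  rw [← hh.strictMonoOn.lt_iff_lt (hh.le_inverse hφ ha) (hh.le_inverse hφ hb), hφ.2 ha, hφ.2 hb]
  exact hab

lemma tendsto_inverse_atTop (hh : IsRegularlyVarying c x₀ h)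
    (hφ : InvOn φ h (Ici x₀) (Ici (h x₀))) : Tendsto φ atTop atTop := by
  refine Filter.tendsto_atTop.2 fun b => ?_
  filter_upwards [eventually_ge_atTop (h (max b x₀))] with y hy
  have h0 : h x₀ ≤ h (max b x₀) :=
    hh.strictMonoOn.monotoneOn (self_mem_Ici) (mem_Ici.2 (le_max_right _ _)) (le_max_right _ _)
  have hy0 := h0.trans hy
  by_contra hlt
  push Not at hlt
  have h1 := (hh.inverse_le_iff hφ (le_max_right b x₀) hy0).1 (hlt.le.trans (le_max_left _ _))
  have h2 : φ y = max b x₀ := by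
    rw [le_antisymm h1 hy]
    exact hφ.1 (mem_Ici.2 (le_max_right _ _))
  have := le_max_left b x₀
  linarith

lemma continuousAt_inverse (hh : IsRegularlyVarying c x₀ h)
    (hφ : InvOn φ h (Ici x₀) (Ici (h x₀))) {y : ℝ} (hy : h x₀ < y) : ContinuousAt φ y := by
  refine continuousAt_of_monotoneOn_of_image_mem_nhds (hh.strictMonoOn_inverse hφ).monotoneOn
    (Ici_mem_nhds hy) ?_
  refine mem_of_superset (Ici_mem_nhds (hh.lt_inverse hφ hy)) fun x hx => ?_
  exact ⟨h x, hh.strictMonoOn.monotoneOn self_mem_Ici hx hx, hφ.1 hx⟩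

lemma hasDerivAt_inverse (hh : IsRegularlyVarying c x₀ h)
    (hφ : InvOn φ h (Ici x₀) (Ici (h x₀))) {y : ℝ} (hy : h x₀ < y) :
    HasDerivAt φ (derivWithin h (Ici x₀) (φ y))⁻¹ y := by
  refine HasDerivAt.of_local_left_inverse (hh.continuousAt_inverse hφ hy)
    (hh.hasDerivAt (hh.lt_inverse hφ hy)) (hh.deriv_pos _ (hh.le_inverse hφ hy.le)).ne' ?_
  filter_upwards [Ici_mem_nhds hy] with z hz using hφ.2 hz

lemma deriv_inverse (hh : IsRegularlyVarying c x₀ h)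
    (hφ : InvOn φ h (Ici x₀) (Ici (h x₀))) {y : ℝ} (hy : h x₀ < y) :
    deriv φ y = (derivWithin h (Ici x₀) (φ y))⁻¹ := (hh.hasDerivAt_inverse hφ hy).deriv

lemma deriv_inverse_pos (hh : IsRegularlyVarying c x₀ h)
    (hφ : InvOn φ h (Ici x₀) (Ici (h x₀))) {y : ℝ} (hy : h x₀ < y) : 0 < deriv φ y := by
  rw [hh.deriv_inverse hφ hy]
  exact inv_pos.2 (hh.deriv_pos _ (hh.le_inverse hφ hy.le))

/-- The negative of the second derivative of the inverse function of `h`. -/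
noncomputable def inverseCurvature (x₀ : ℝ) (h φ : ℝ → ℝ) (y : ℝ) : ℝ :=
  iteratedDerivWithin 2 h (Ici x₀) (φ y) * deriv φ y ^ 3

lemma hasDerivAt_deriv_inverse (hh : IsRegularlyVarying c x₀ h)
    (hφ : InvOn φ h (Ici x₀) (Ici (h x₀))) {y : ℝ} (hy : h x₀ < y) :
    HasDerivAt (deriv φ) (-inverseCurvature x₀ h φ y) y := by
  have hx := hh.lt_inverse hφ hy
  have hp := hh.deriv_pos _ hx.le
  have e := (((hh.hasDerivAt_derivWithin hx).comp y (hh.hasDerivAt_inverse hφ hy)).inv hp.ne')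
  have heq : deriv φ =ᶠ[𝓝 y] (derivWithin h (Ici x₀) ∘ φ)⁻¹ := by
    filter_upwards [Ioi_mem_nhds hy] with z hz using hh.deriv_inverse hφ hz
  refine (e.congr_of_eventuallyEq heq).congr_deriv ?_
  rw [inverseCurvature, hh.deriv_inverse hφ hy]
  simp only [Function.comp]
  field_simp

lemma inverseCurvature_pos (hh : IsRegularlyVarying c x₀ h)
    (hφ : InvOn φ h (Ici x₀) (Ici (h x₀))) {y : ℝ} (hy : h x₀ < y) :
    0 < inverseCurvature x₀ h φ y :=
  mul_pos (hh.deriv_two_pos _ (hh.le_inverse hφ hy.le)) (pow_pos (hh.deriv_inverse_pos hφ hy) 3)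

lemma tendsto_logDeriv_inverse (hh : IsRegularlyVarying c x₀ h)
    (hφ : InvOn φ h (Ici x₀) (Ici (h x₀))) :
    Tendsto (fun y => y * deriv φ y / φ y) atTop (𝓝 (1 / c)) := by
  have hc := hh.one_le_exponent
  have := (hh.tendsto_logDeriv.inv₀ (by linarith)).comp (hh.tendsto_inverse_atTop hφ)
  rw [one_div]
  refine this.congr' ?_
  filter_upwards [eventually_gt_atTop (h x₀)] with y hy
  simp only [Function.comp]
  rw [hφ.2 hy.le, hh.deriv_inverse hφ hy]
  rw [inv_div]
  have := hh.deriv_pos _ (hh.le_inverse hφ hy.le)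
  field_simp

/-- The factor relating the curvature of the inverse function to its first derivative. -/
lemma inverseCurvature_eq (hh : IsRegularlyVarying c x₀ h)
    (hφ : InvOn φ h (Ici x₀) (Ici (h x₀))) {y : ℝ} (hy : h x₀ < y) :
    inverseCurvature x₀ h φ y = deriv φ y / y *
      ((φ y * iteratedDerivWithin 2 h (Ici x₀) (φ y) / derivWithin h (Ici x₀) (φ y)) /
        (φ y * derivWithin h (Ici x₀) (φ y) / h (φ y))) := by
  have hx := hh.lt_inverse hφ hy
  have h1 := hh.deriv_pos _ hx.le
  have h2 := hh.one_le_start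
  have h3 : 0 < φ y := by linarith
  have h4 := hh.one_le _ hx.le
  have h5 : 0 < y := by rw [hφ.2 hy.le] at h4; linarith
  rw [inverseCurvature, hφ.2 hy.le, hh.deriv_inverse hφ hy]
  field_simp

lemma tendsto_logDeriv_deriv_inverse (hh : IsRegularlyVarying c x₀ h)
    (hφ : InvOn φ h (Ici x₀) (Ici (h x₀))) :
    Tendsto (fun y => y * (-inverseCurvature x₀ h φ y) / deriv φ y) atTop (𝓝 (1 / c - 1)) := by
  have hc := hh.one_le_exponent
  have := ((hh.tendsto_logDeriv_deriv.div hh.tendsto_logDeriv (by linarith)).comp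
    (hh.tendsto_inverse_atTop hφ)).neg
  have e : -((c - 1) / c) = 1 / c - 1 := by field_simp; ring
  rw [e] at this
  refine this.congr' ?_
  filter_upwards [eventually_gt_atTop (h x₀)] with y hy
  have h4 := hh.one_le x₀ self_mem_Ici
  have := hh.deriv_inverse_pos hφ hy
  have y0 : 0 < y := by linarith
  rw [hh.inverseCurvature_eq hφ hy]
  simp only [Function.comp, Pi.div_apply]
  field_simp

lemma exists_inverse_bounds (hh : IsRegularlyVarying c x₀ h)
    (hφ : InvOn φ h (Ici x₀) (Ici (h x₀))) {ε : ℝ} (hε : 0 < ε) :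
    ∃ B : ℝ, 0 < B ∧ ∀ᶠ y in atTop, B⁻¹ * y ^ (1 / c - ε) ≤ φ y ∧ φ y ≤ B * y ^ (1 / c + ε) :=
  exists_rpow_bounds_of_tendsto
    ((eventually_gt_atTop (h x₀)).mono fun _ hy =>
      (hh.hasDerivAt_inverse hφ hy).differentiableAt.hasDerivAt)
    ((hh.tendsto_inverse_atTop hφ).eventually_gt_atTop 0) (hh.tendsto_logDeriv_inverse hφ) hε

lemma exists_deriv_inverse_bounds (hh : IsRegularlyVarying c x₀ h)
    (hφ : InvOn φ h (Ici x₀) (Ici (h x₀))) {ε : ℝ} (hε : 0 < ε) :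
    ∃ B : ℝ, 0 < B ∧ ∀ᶠ y in atTop,
      B⁻¹ * y ^ (1 / c - 1 - ε) ≤ deriv φ y ∧ deriv φ y ≤ B * y ^ (1 / c - 1 + ε) :=
  exists_rpow_bounds_of_tendsto
    ((eventually_gt_atTop (h x₀)).mono fun _ hy => hh.hasDerivAt_deriv_inverse hφ hy)
    ((eventually_gt_atTop (h x₀)).mono fun _ hy => hh.deriv_inverse_pos hφ hy)
    (hh.tendsto_logDeriv_deriv_inverse hφ) hε

lemma exists_potter_deriv_inverse (hh : IsRegularlyVarying c x₀ h)
    (hφ : InvOn φ h (Ici x₀) (Ici (h x₀))) {ε : ℝ} (hε : 0 < ε) :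
    ∃ X : ℝ, 1 ≤ X ∧ ∀ u v, X ≤ u → u ≤ v →
      (v / u) ^ (1 / c - 1 - ε) * deriv φ u ≤ deriv φ v ∧
        deriv φ v ≤ (v / u) ^ (1 / c - 1 + ε) * deriv φ u :=
  exists_potter_of_tendsto
    ((eventually_gt_atTop (h x₀)).mono fun _ hy => hh.hasDerivAt_deriv_inverse hφ hy)
    ((eventually_gt_atTop (h x₀)).mono fun _ hy => hh.deriv_inverse_pos hφ hy)
    (hh.tendsto_logDeriv_deriv_inverse hφ) hε

/-- By `inverseCurvature_eq` the curvature is $\varphi'(y)/y$ times a ratio of logarithmic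
derivatives at $\varphi(y)$. The denominator lies between $1/2$ and 2, and the numerator is below 1
and at least $\varphi(y)^{-\varepsilon/3}$. -/
lemma exists_inverseCurvature_bounds (hh : IsRegularlyVarying c x₀ h)
    (hφ : InvOn φ h (Ici x₀) (Ici (h x₀))) {ε : ℝ} (hε : 0 < ε) :
    ∃ B : ℝ, 0 < B ∧ ∀ᶠ y in atTop, B⁻¹ * y ^ (1 / c - 2 - ε) ≤ inverseCurvature x₀ h φ y ∧
      inverseCurvature x₀ h φ y ≤ B * y ^ (1 / c - 2 + ε) := by
  have hc1 := hh.one_le_exponent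
  have hc2 := hh.exponent_lt_two
  have hc0 : 0 < c := by linarith
  obtain ⟨B, hB, hb⟩ := hh.exists_deriv_inverse_bounds hφ (show 0 < ε / 3 by positivity)
  obtain ⟨K, hK, hk⟩ := hh.exists_inverse_bounds hφ (show (0 : ℝ) < 1 by norm_num)
  have l1 := (hh.tendsto_inverse_atTop hφ).eventually
    (hh.eventually_rpow_le_logDeriv_deriv (show 0 < ε / 3 by positivity))
  have l2 := ((hh.tendsto_logDeriv.comp (hh.tendsto_inverse_atTop hφ)).eventually
    (Ioo_mem_nhds (show c - 1 / 2 < c by linarith) (show c < 2 by linarith)))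
  have l3 := ((hh.tendsto_logDeriv_deriv.comp (hh.tendsto_inverse_atTop hφ)).eventually
    (Iio_mem_nhds (show c - 1 < 1 by linarith)))
  have hB' : 0 < B * 2 * K ^ (ε / 3) := by positivity
  refine ⟨max (B * 2) (B * 2 * K ^ (ε / 3)), lt_max_of_lt_right hB', ?_⟩
  filter_upwards [hb, hk, l1, l2, l3, eventually_gt_atTop (h x₀), eventually_ge_atTop 1,
    (hh.tendsto_inverse_atTop hφ).eventually_gt_atTop 0] with y b k m1 m2 m3 hy hy1 hφ0
  rw [hh.inverseCurvature_eq hφ hy]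
  simp only [Function.comp] at m1 m2 m3
  have y0 : 0 < y := by linarith
  have p := hh.deriv_inverse_pos hφ hy
  set r := φ y * iteratedDerivWithin 2 h (Ici x₀) (φ y) / derivWithin h (Ici x₀) (φ y)
  set q := φ y * derivWithin h (Ici x₀) (φ y) / h (φ y)
  have q0 : 1 / 2 < q := by linarith [m2.1]
  have q2 : q < 2 := m2.2
  have r1 : r < 1 := m3
  have r0 : 0 < r := lt_of_lt_of_le (by positivity) m1
  constructor
  -- The crude bound $\varphi(y)\le Ky^2$ turns the loss $\varphi(y)^{-\varepsilon/3}$ into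
  -- $y^{-2\varepsilon/3}$; with the loss $\varepsilon/3$ from $\varphi'$ this makes $\varepsilon$.
  · have f1 : (K * y ^ (2 : ℝ)) ^ (-(ε / 3)) ≤ r := by
      refine le_trans ?_ m1
      refine Real.rpow_le_rpow_of_nonpos hφ0 ?_ (by linarith)
      refine k.2.trans ?_
      have : 1 / c ≤ 1 := (div_le_one hc0).2 hc1
      gcongr
      linarith
    have f2 : (K * y ^ (2 : ℝ)) ^ (-(ε / 3)) = (K ^ (ε / 3))⁻¹ * y ^ (-(2 * (ε / 3))) := by
      rw [Real.mul_rpow hK.le (by positivity), Real.rpow_neg hK.le, ← Real.rpow_mul y0.le]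
      congr 2
      ring
    rw [f2] at f1
    have f3 : r / 2 ≤ r / q := by gcongr
    have f4 : (max (B * 2) (B * 2 * K ^ (ε / 3)))⁻¹ ≤ (B * 2 * K ^ (ε / 3))⁻¹ :=
      inv_anti₀ hB' (le_max_right _ _)
    have f5 : y ^ (1 / c - 2 - ε) = y ^ (1 / c - 1 - ε / 3) * y ^ (-(2 * (ε / 3))) / y := by
      rw [← Real.rpow_add y0, ← Real.rpow_sub_one y0.ne']
      congr 1
      ring
    calc _ ≤ (B * 2 * K ^ (ε / 3))⁻¹ * y ^ (1 / c - 2 - ε) := by gcongr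
      _ = (B⁻¹ * y ^ (1 / c - 1 - ε / 3)) / y * (((K ^ (ε / 3))⁻¹ * y ^ (-(2 * (ε / 3)))) / 2) := by
        rw [f5]; field_simp
      _ ≤ deriv φ y / y * (r / 2) := by gcongr; exact b.1
      _ ≤ _ := by gcongr
  · have f3 : r / q ≤ 2 := by
      rw [div_le_iff₀ (by linarith)]
      linarith
    have f5 : y ^ (1 / c - 2 + ε) = y ^ (1 / c - 1 + ε) / y := by
      rw [← Real.rpow_sub_one y0.ne']
      congr 1
      ring
    have f6 : y ^ (1 / c - 1 + ε / 3) ≤ y ^ (1 / c - 1 + ε) :=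
      Real.rpow_le_rpow_of_exponent_le hy1 (by linarith)
    calc _ ≤ (B * y ^ (1 / c - 1 + ε / 3)) / y * 2 := by gcongr; exact b.2
      _ ≤ (B * y ^ (1 / c - 1 + ε)) / y * 2 := by gcongr
      _ = (B * 2) * y ^ (1 / c - 2 + ε) := by rw [f5]; ring
      _ ≤ _ := by gcongr; exact le_max_left _ _

lemma antitoneOn_deriv_inverse (hh : IsRegularlyVarying c x₀ h)
    (hφ : InvOn φ h (Ici x₀) (Ici (h x₀))) : AntitoneOn (deriv φ) (Ioi (h x₀)) := by
  refine antitoneOn_of_deriv_nonpos (convex_Ioi _) ?_ ?_ ?_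
  · exact fun y hy => (hh.hasDerivAt_deriv_inverse hφ hy).continuousAt.continuousWithinAt
  · intro y hy
    rw [interior_Ioi] at hy
    exact (hh.hasDerivAt_deriv_inverse hφ hy).differentiableAt.differentiableWithinAt
  · intro y hy
    rw [interior_Ioi] at hy
    rw [(hh.hasDerivAt_deriv_inverse hφ hy).deriv]
    linarith [hh.inverseCurvature_pos hφ hy]

end IsRegularlyVarying

/-! ### Sampling a function with Potter bounds. -/

/-- Potter bounds enclose the ratio between powers $\rho\pm\varepsilon$ of $k(n)/n$; the minimum and
maximum cover both orders of $k(n)$ and $n$. Letting $n\to\infty$ and then $\varepsilon\to0$ closes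
the gap. -/
lemma tendsto_div_of_potter {G : ℝ → ℝ} {ρ : ℝ} (hpos : ∀ᶠ x in atTop, 0 < G x)
    (hP : ∀ ε : ℝ, 0 < ε → ∃ X : ℝ, 1 ≤ X ∧ ∀ u v, X ≤ u → u ≤ v →
      (v / u) ^ (ρ - ε) * G u ≤ G v ∧ G v ≤ (v / u) ^ (ρ + ε) * G u)
    {k : ℕ → ℕ} {t : ℝ} (ht : 0 < t) (hk : Tendsto (fun n : ℕ => (k n : ℝ) / n) atTop (𝓝 t)) :
    Tendsto (fun n : ℕ => G (k n) / G n) atTop (𝓝 (t ^ ρ)) := by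
  have hktop : Tendsto (fun n => (k n : ℝ)) atTop atTop := by
    have := hk.pos_mul_atTop ht (tendsto_natCast_atTop_atTop (R := ℝ))
    refine this.congr' ?_
    filter_upwards [eventually_gt_atTop 0] with n hn
    field_simp
  have hntop := tendsto_natCast_atTop_atTop (R := ℝ)
  have sandwich : ∀ ε : ℝ, 0 < ε → ∀ᶠ n : ℕ in atTop,
      min (((k n : ℝ) / n) ^ (ρ - ε)) (((k n : ℝ) / n) ^ (ρ + ε)) ≤ G (k n) / G n ∧
      G (k n) / G n ≤ max (((k n : ℝ) / n) ^ (ρ - ε)) (((k n : ℝ) / n) ^ (ρ + ε)) := by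
    intro ε hε
    obtain ⟨X, hX1, hX⟩ := hP ε hε
    filter_upwards [hktop.eventually_ge_atTop X, hntop.eventually_ge_atTop X,
      hktop.eventually hpos, hntop.eventually hpos] with n h1 h2 p1 p2
    have k0 : (0 : ℝ) < k n := by linarith
    have n0 : (0 : ℝ) < n := by linarith
    have inv : ∀ a : ℝ, ((n : ℝ) / k n) ^ a = (((k n : ℝ) / n) ^ a)⁻¹ := fun a => by
      rw [← Real.inv_rpow (by positivity), inv_div]
    rw [le_div_iff₀ p2, div_le_iff₀ p2]
    rcases le_total (k n : ℝ) n with h | h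
    · obtain ⟨a, b⟩ := hX _ _ h1 h
      rw [inv, inv_mul_le_iff₀ (by positivity)] at a
      rw [inv, le_inv_mul_iff₀ (by positivity)] at b
      exact ⟨(mul_le_mul_of_nonneg_right (min_le_right _ _) p2.le).trans b,
        a.trans (mul_le_mul_of_nonneg_right (le_max_left _ _) p2.le)⟩
    · obtain ⟨a, b⟩ := hX _ _ h2 h
      exact ⟨(mul_le_mul_of_nonneg_right (min_le_left _ _) p2.le).trans a,
        b.trans (mul_le_mul_of_nonneg_right (le_max_right _ _) p2.le)⟩
  have c1 : Tendsto (fun ε : ℝ => t ^ (ρ - ε)) (𝓝[>] 0) (𝓝 (t ^ ρ)) := by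
    have : ContinuousAt (fun ε : ℝ => t ^ (ρ - ε)) 0 :=
      ContinuousAt.rpow continuousAt_const (by fun_prop) (Or.inl ht.ne')
    have h := this.tendsto
    simp only [sub_zero] at h
    exact h.mono_left nhdsWithin_le_nhds
  have c2 : Tendsto (fun ε : ℝ => t ^ (ρ + ε)) (𝓝[>] 0) (𝓝 (t ^ ρ)) := by
    have : ContinuousAt (fun ε : ℝ => t ^ (ρ + ε)) 0 :=
      ContinuousAt.rpow continuousAt_const (by fun_prop) (Or.inl ht.ne')
    have h := this.tendsto
    simp only [add_zero] at h
    exact h.mono_left nhdsWithin_le_nhds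
  have lim : ∀ a : ℝ, Tendsto (fun n : ℕ => ((k n : ℝ) / n) ^ a) atTop (𝓝 (t ^ a)) := fun a =>
    hk.rpow_const (Or.inl ht.ne')
  rw [tendsto_order]
  constructor
  · intro a ha
    have := c1.min c2
    rw [min_self] at this
    obtain ⟨ε, h1, h2⟩ := ((this.eventually (Ioi_mem_nhds ha)).and self_mem_nhdsWithin).exists
    have := ((lim (ρ - ε)).min (lim (ρ + ε))).eventually (Ioi_mem_nhds h1)
    filter_upwards [this, sandwich ε h2] with n g1 g2 using lt_of_lt_of_le g1 g2.1
  · intro a ha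
    have := c1.max c2
    rw [max_self] at this
    obtain ⟨ε, h1, h2⟩ := ((this.eventually (Iio_mem_nhds ha)).and self_mem_nhdsWithin).exists
    have := ((lim (ρ - ε)).max (lim (ρ + ε))).eventually (Iio_mem_nhds h1)
    filter_upwards [this, sandwich ε h2] with n g1 g2 using lt_of_le_of_lt g2.2 g1

/-- Sampling a function with Potter bounds gives a regularly varying sequence. -/
lemma regularlyVaryingSeq_of_potter {G : ℝ → ℝ} {ρ : ℝ} (hρ : -(1 / 4) ≤ ρ)
    (hpos : ∀ᶠ x in atTop, 0 < G x)
    (hP : ∀ ε : ℝ, 0 < ε → ∃ X : ℝ, 1 ≤ X ∧ ∀ u v, X ≤ u → u ≤ v →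
      (v / u) ^ (ρ - ε) * G u ≤ G v ∧ G v ≤ (v / u) ^ (ρ + ε) * G u) :
    ∀ᶠ M : ℕ in atTop, RegularlyVaryingSeq ρ fun m => G (max m M : ℕ) := by
  -- Since $\rho\ge-1/4$, a Potter loss of $1/4$ keeps the exponent at least $-1/2$, as the
  -- structure demands.
  obtain ⟨X, hX1, hX⟩ := hP (1 / 4) (by norm_num)
  obtain ⟨Y, hY⟩ := eventually_atTop.1 hpos
  filter_upwards [eventually_ge_atTop ⌈X⌉₊, eventually_ge_atTop ⌈Y⌉₊] with M hMX hMY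
  have hMX' : X ≤ M := Nat.ceil_le.1 hMX
  have hMY' : Y ≤ M := Nat.ceil_le.1 hMY
  have hge : ∀ m : ℕ, (M : ℝ) ≤ (max m M : ℕ) := fun m => by exact_mod_cast le_max_right m M
  have hp : ∀ m : ℕ, 0 < G (max m M : ℕ) := fun m => hY _ (hMY'.trans (hge m))
  refine ⟨hp, ?_, 2, ?_⟩
  · intro k t ht hk
    have h1 := tendsto_div_of_potter hpos hP ht hk
    have hktop : Tendsto k atTop atTop := by
      rw [← tendsto_natCast_atTop_iff (R := ℝ)]
      have := hk.pos_mul_atTop ht (tendsto_natCast_atTop_atTop (R := ℝ))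
      refine this.congr' ?_
      filter_upwards [eventually_gt_atTop 0] with n hn
      field_simp
    refine h1.congr' ?_
    filter_upwards [hktop.eventually_ge_atTop M, eventually_ge_atTop M] with n a b
    rw [max_eq_left a, max_eq_left b]
  · intro m n hmn
    set a : ℕ := max m M with ha
    set b : ℕ := max n M with hb
    have hab : a ≤ b := max_le_max hmn le_rfl
    have hab' : (a : ℝ) ≤ b := by exact_mod_cast hab
    have haX : X ≤ (a : ℝ) := hMX'.trans (hge m)
    have a0 : (0 : ℝ) < a := by linarith
    have hba : (1 : ℝ) ≤ (b : ℝ) / a := by rw [one_le_div a0]; exact hab'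
    have h1 := (hX a b haX hab').1
    have h2 : ((b : ℝ) / a) ^ (-(1 / 2) : ℝ) * G a ≤ G b := by
      refine le_trans ?_ h1
      have := Real.rpow_le_rpow_of_exponent_le hba (show (-(1 / 2) : ℝ) ≤ ρ - 1 / 4 by linarith)
      exact mul_le_mul_of_nonneg_right this (hp m).le
    rw [Real.rpow_neg (by positivity), inv_mul_le_iff₀ (by positivity)] at h2
    have h3 : (b : ℝ) / a ≤ 4 * (((n : ℝ) + 1) / (m + 1)) := by
      rw [div_le_iff₀ a0, mul_div_assoc', div_mul_eq_mul_div, le_div_iff₀ (by positivity)]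
      have M1 : 1 ≤ M := by
        have : (1 : ℝ) ≤ M := by linarith
        exact_mod_cast this
      have : b * (m + 1) ≤ 4 * (n + 1) * a := by
        rcases le_total M m with c1 | c1
        · have : b = n := max_eq_left (c1.trans hmn)
          have : a = m := max_eq_left c1
          have : 1 ≤ m := M1.trans c1
          nlinarith
        · have ha' : a = M := max_eq_right c1
          rcases le_total M n with c2 | c2
          · have : b = n := max_eq_left c2
            nlinarith
          · have : b = M := max_eq_right c2
            nlinarith
      exact_mod_cast this
    have h4 : ((b : ℝ) / a) ^ (1 / 2 : ℝ) ≤ 2 * (((n : ℝ) + 1) / (m + 1)) ^ (1 / 2 : ℝ) := by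
      refine (Real.rpow_le_rpow (by positivity) h3 (by norm_num)).trans (le_of_eq ?_)
      rw [Real.mul_rpow (by norm_num) (by positivity)]
      congr 1
      rw [show (4 : ℝ) = 2 ^ (2 : ℝ) by norm_num, ← Real.rpow_mul (by norm_num)]
      norm_num
    exact h2.trans (mul_le_mul_of_nonneg_right h4 (hp n).le)

/-! ### Sawtooth sums along a function of controlled curvature. -/

/-- Two applications of the mean value theorem convert curvature bounds into the second-difference
bounds required by van der Corput's test. -/
lemma exists_second_diff_eq {φ φ' s : ℝ → ℝ} {y : ℝ}
    (h1 : ∀ x, y ≤ x → HasDerivAt φ (φ' x) x) (h2 : ∀ x, y ≤ x → HasDerivAt φ' (-s x) x) :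
    ∃ z, y ≤ z ∧ z ≤ y + 2 ∧ 2 * φ (y + 1) - φ y - φ (y + 2) = s z := by
  have hd : ∀ x, y ≤ x → HasDerivAt (fun x => φ (x + 1) - φ x) (φ' (x + 1) - φ' x) x := fun x hx =>
    ((h1 (x + 1) (by linarith)).comp_add_const x 1).sub (h1 x hx)
  obtain ⟨w, hw, ew⟩ := exists_hasDerivAt_eq_slope (fun x => φ (x + 1) - φ x)
    (fun x => φ' (x + 1) - φ' x) (show y < y + 1 by linarith)
    (fun x hx => (hd x hx.1).continuousAt.continuousWithinAt) (fun x hx => hd x hx.1.le)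
  obtain ⟨z, hz, ez⟩ := exists_hasDerivAt_eq_slope φ' (fun x => -s x) (show w < w + 1 by linarith)
    (fun x hx => (h2 x (hw.1.le.trans hx.1)).continuousAt.continuousWithinAt)
    (fun x hx => h2 x (hw.1.le.trans hx.1.le))
  refine ⟨z, by linarith [hw.1, hz.1], by linarith [hw.2, hz.2], ?_⟩
  have e1 : y + 1 + 1 = y + 2 := by ring
  simp only [add_sub_cancel_left, div_one, e1] at ew ez
  linarith

/-- Twisted sums of `ψ(-φ(m))` over dyadic blocks. -/
lemma norm_sum_sawtooth_block_le {φ φ' s : ℝ → ℝ} {Y γ B : ℝ} (hY : 1 ≤ Y) (hγ : 3 / 4 ≤ γ)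
    (hγ1 : γ ≤ 1) (hB : 1 ≤ B) (h1 : ∀ x, Y ≤ x → HasDerivAt φ (φ' x) x)
    (h2 : ∀ x, Y ≤ x → HasDerivAt φ' (-s x) x)
    (h3 : ∀ x, Y ≤ x → B⁻¹ * x ^ (γ - 2 - 1 / 100) ≤ s x)
    (h4 : ∀ x, Y ≤ x → s x ≤ B * x ^ (γ - 2 + 1 / 100))
    {a b : ℕ} (ha : Y ≤ a) (hab : a ≤ b) (hb : b ≤ 2 * a) (ξ : ℝ) :
    ‖∑ m ∈ Finset.Ico a b, (sawtooth (-φ m) : ℂ) * unitExp (m * ξ)‖ ≤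
      (2 + 3 * (zetaConst * (64 * B ^ 2 + 48 * B))) * (a : ℝ) ^ (3 / 4 : ℝ) := by
  have a1 : (1 : ℝ) ≤ a := hY.trans ha
  have a0 : (0 : ℝ) < a := by linarith
  have B0 : 0 < B := by linarith
  have hab' : (a : ℝ) ≤ b := by exact_mod_cast hab
  have hb' : (b : ℝ) ≤ 2 * a := by exact_mod_cast hb
  -- All intermediate points lie in $[a,4a]$, and the factor $1/16=4^{-2}$ pays for the power of 4.
  -- The factor $a^{1/50}$ in `C` is the gap between the upper and lower curvature exponents.
  set lam := B⁻¹ / 16 * (a : ℝ) ^ (γ - 2 - 1 / 100) with hlam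
  set C := 16 * B ^ 2 * (a : ℝ) ^ (1 / 50 : ℝ) with hC
  have lam0 : 0 < lam := by positivity
  have hC1 : 1 ≤ C := by
    have : (1 : ℝ) ≤ (a : ℝ) ^ (1 / 50 : ℝ) := Real.one_le_rpow a1 (by norm_num)
    have : 1 ≤ B ^ 2 := one_le_pow₀ hB
    rw [hC]
    nlinarith
  have hClam : C * lam = B * (a : ℝ) ^ (γ - 2 + 1 / 100) := by
    have : (a : ℝ) ^ (γ - 2 + 1 / 100) = (a : ℝ) ^ (1 / 50 : ℝ) * (a : ℝ) ^ (γ - 2 - 1 / 100) := by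
      rw [← Real.rpow_add a0]; congr 1; ring
    rw [this, hC, hlam]
    field_simp
  have hs : ∀ m ∈ Finset.Ico a b, lam ≤ 2 * φ (m + 1) - φ m - φ (m + 2) ∧
      2 * φ (m + 1) - φ m - φ (m + 2) ≤ C * lam := by
    intro m hm
    simp only [Finset.mem_Ico] at hm
    have hm1 : (a : ℝ) ≤ m := by exact_mod_cast hm.1
    have hm2 : (m : ℝ) + 1 ≤ b := by exact_mod_cast hm.2
    obtain ⟨z, hz1, hz2, ez⟩ := exists_second_diff_eq (y := (m : ℝ)) (s := s)
      (fun x hx => h1 x (ha.trans (hm1.trans hx))) (fun x hx => h2 x (ha.trans (hm1.trans hx)))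
    have hzY : Y ≤ z := ha.trans (hm1.trans hz1)
    have haz : (a : ℝ) ≤ z := hm1.trans hz1
    have hz4 : z ≤ 4 * a := by linarith
    rw [ez]
    constructor
    · refine le_trans ?_ (h3 z hzY)
      have e1 : (4 * (a : ℝ)) ^ (γ - 2 - 1 / 100) ≤ z ^ (γ - 2 - 1 / 100) :=
        Real.rpow_le_rpow_of_nonpos (a0.trans_le haz) hz4 (by linarith)
      rw [Real.mul_rpow (by norm_num) a0.le] at e1
      have e2 : (1 / 16 : ℝ) ≤ (4 : ℝ) ^ (γ - 2 - 1 / 100) := by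
        have : (1 / 16 : ℝ) = (4 : ℝ) ^ (-2 : ℝ) := by
          rw [Real.rpow_neg (by norm_num)]; norm_num
        rw [this]
        exact Real.rpow_le_rpow_of_exponent_le (by norm_num) (by linarith)
      calc lam = B⁻¹ * (1 / 16 * (a : ℝ) ^ (γ - 2 - 1 / 100)) := by rw [hlam]; ring
        _ ≤ B⁻¹ * ((4 : ℝ) ^ (γ - 2 - 1 / 100) * (a : ℝ) ^ (γ - 2 - 1 / 100)) := by gcongr
        _ ≤ _ := by gcongr
    · rw [hClam]
      refine (h4 z hzY).trans ?_
      exact mul_le_mul_of_nonneg_left (Real.rpow_le_rpow_of_nonpos a0 haz (by linarith)) B0.le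
  -- The exponent $0.52$ is $1/50+1-1/2$, from $C\,a\,\sqrt\lambda$ with $\sqrt\lambda\le a^{-1/2}$.
  -- The exponent $0.63$ is half of $2-3/4+1/100$, from $1/\sqrt\lambda$ with $\gamma\ge3/4$.
  set V₁ := 64 * B ^ 2 * (a : ℝ) ^ (52 / 100 : ℝ) with hV₁
  set V₂ := 48 * B * (a : ℝ) ^ (63 / 100 : ℝ) with hV₂
  have slam : 0 < Real.sqrt lam := Real.sqrt_pos.2 lam0
  have sle : Real.sqrt lam ≤ (a : ℝ) ^ (-(1 / 2) : ℝ) := by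
    refine Real.sqrt_le_iff.2 ⟨by positivity, ?_⟩
    rw [← Real.rpow_natCast, ← Real.rpow_mul a0.le]
    have : (a : ℝ) ^ (γ - 2 - 1 / 100) ≤ (a : ℝ) ^ (-(1 / 2) * ((2 : ℕ) : ℝ) : ℝ) :=
      Real.rpow_le_rpow_of_exponent_le a1 (by push_cast; linarith)
    refine le_trans ?_ this
    rw [hlam]
    have : B⁻¹ / 16 ≤ 1 := by
      have : B⁻¹ ≤ 1 := inv_le_one_of_one_le₀ hB
      linarith
    exact mul_le_of_le_one_left (by positivity) this
  have sge : 1 / Real.sqrt lam ≤ 4 * B * (a : ℝ) ^ (63 / 100 : ℝ) := by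
    have : (1 / (4 * B * (a : ℝ) ^ (63 / 100 : ℝ))) ≤ Real.sqrt lam := by
      refine Real.le_sqrt_of_sq_le ?_
      rw [div_pow, one_pow, mul_pow, mul_pow, ← Real.rpow_natCast ((a : ℝ) ^ (63 / 100 : ℝ)),
        ← Real.rpow_mul a0.le]
      have e1 : (a : ℝ) ^ (-(126 / 100) : ℝ) ≤ (a : ℝ) ^ (γ - 2 - 1 / 100) :=
        Real.rpow_le_rpow_of_exponent_le a1 (by linarith)
      have e2 : (a : ℝ) ^ (63 / 100 * ((2 : ℕ) : ℝ) : ℝ) = ((a : ℝ) ^ (-(126 / 100) : ℝ))⁻¹ := by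
        rw [← Real.rpow_neg a0.le]; norm_num
      rw [e2]
      have e3 : (1 : ℝ) / (4 ^ 2 * B ^ 2 * ((a : ℝ) ^ (-(126 / 100) : ℝ))⁻¹) =
        (B ^ 2)⁻¹ / 16 * (a : ℝ) ^ (-(126 / 100) : ℝ) := by field_simp; norm_num
      rw [e3, hlam]
      have e4 : (B ^ 2)⁻¹ ≤ B⁻¹ := inv_anti₀ B0 (by nlinarith)
      gcongr
    rw [div_le_iff₀ slam]
    rw [div_le_iff₀ (by positivity)] at this
    linarith
  have hW : ∀ k : ℕ, 1 ≤ k → ∀ ξ, ‖∑ m ∈ Finset.Ico a b, unitExp (k * (-φ m) + m * ξ)‖ ≤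
      (k : ℝ) ^ (1 / 2 : ℝ) * V₁ + V₂ := by
    intro k hk ξ
    have hk1 : (1 : ℝ) ≤ k := by exact_mod_cast hk
    have hk0 : (0 : ℝ) < k := by linarith
    have e : ∀ m : ℕ, (((k : ℝ) * (-φ ((m + 2 : ℕ) : ℝ)) + ((m + 2 : ℕ) : ℝ) * ξ) -
        (k * (-φ ((m + 1 : ℕ) : ℝ)) + ((m + 1 : ℕ) : ℝ) * ξ)) -
        ((k * (-φ ((m + 1 : ℕ) : ℝ)) + ((m + 1 : ℕ) : ℝ) * ξ) - (k * (-φ m) + m * ξ)) =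
        k * (2 * φ (m + 1) - φ m - φ (m + 2)) := by
      intro m
      push_cast
      ring
    have vdc := norm_sum_unitExp_le_of_second_diff (fun m : ℕ => k * (-φ m) + m * ξ) a b hab
      (lam := k * lam) (C := C) (by positivity) hC1
      (fun m hm => by simp only [e]; have := (hs m hm).1; gcongr)
      (fun m hm => by
        simp only [e]
        have := mul_le_mul_of_nonneg_left (hs m hm).2 hk0.le
        linarith)
    refine vdc.trans ?_
    have sk : Real.sqrt (k * lam) = Real.sqrt k * Real.sqrt lam := Real.sqrt_mul hk0.le _
    have sk1 : 1 ≤ Real.sqrt k := Real.one_le_sqrt.2 hk1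
    have i1 : 4 * (C * (k * lam) * (b - a) + 3) / Real.sqrt (k * lam) =
        4 * C * (b - a) * (Real.sqrt k * Real.sqrt lam) + 12 / (Real.sqrt k * Real.sqrt lam) := by
      rw [sk]
      have q1 := Real.mul_self_sqrt hk0.le
      have q2 := Real.mul_self_sqrt lam0.le
      field_simp
      linear_combination (-4 * C * (b - a) * lam) * q1 +
        (-4 * C * (b - a) * (Real.sqrt k * Real.sqrt k)) * q2
    rw [i1, ← Real.sqrt_eq_rpow]
    have i2 : 12 / (Real.sqrt k * Real.sqrt lam) ≤ V₂ := by
      have : 12 / (Real.sqrt k * Real.sqrt lam) ≤ 12 * (1 / Real.sqrt lam) := by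
        rw [mul_one_div]
        gcongr
        exact le_mul_of_one_le_left slam.le sk1
      rw [hV₂]
      linarith
    have i3 : 4 * C * (b - a) * Real.sqrt lam ≤ V₁ := by
      have : 4 * C * (b - a) * Real.sqrt lam ≤ 4 * C * a * (a : ℝ) ^ (-(1 / 2) : ℝ) := by
        gcongr
        linarith
      refine this.trans (le_of_eq ?_)
      rw [hC, hV₁]
      have : (a : ℝ) ^ (52 / 100 : ℝ) = (a : ℝ) ^ (1 / 50 : ℝ) * a * (a : ℝ) ^ (-(1 / 2) : ℝ) := by
        rw [← Real.rpow_add_one a0.ne', ← Real.rpow_add a0]; norm_num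
      rw [this]
      ring
    have i4 := mul_le_mul_of_nonneg_left i3 (Real.sqrt_nonneg k)
    linarith
  -- With $\delta=a^{-1/4}$ the trivial part $\delta a$ is $a^{3/4}$, while the other two have
  -- exponents $3/16+0.52$ and $1/16+0.63$, both below $3/4$.
  have main := norm_sum_sawtooth_le (fun m : ℕ => -φ m) (Finset.Ico a b) (V₁ := V₁) (V₂ := V₂)
    (δ := (a : ℝ) ^ (-(1 / 4) : ℝ)) (by positivity) (by positivity) (by positivity) hW ξ
  refine main.trans ?_
  have card : ((Finset.Ico a b).card : ℝ) ≤ a := by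
    rw [Nat.card_Ico, Nat.cast_sub hab]; linarith
  have j1 : 2 * (a : ℝ) ^ (-(1 / 4) : ℝ) * (Finset.Ico a b).card ≤ 2 * (a : ℝ) ^ (3 / 4 : ℝ) := by
    have : (a : ℝ) ^ (3 / 4 : ℝ) = (a : ℝ) ^ (-(1 / 4) : ℝ) * a := by
      rw [← Real.rpow_add_one a0.ne']; norm_num
    rw [this, ← mul_assoc]
    gcongr
  have j2 : ((a : ℝ) ^ (-(1 / 4) : ℝ)) ^ (1 / 4 : ℝ) * V₁ / (a : ℝ) ^ (-(1 / 4) : ℝ) ≤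
      64 * B ^ 2 * (a : ℝ) ^ (3 / 4 : ℝ) := by
    rw [← Real.rpow_mul a0.le, hV₁]
    have : (a : ℝ) ^ (-(1 / 4) * (1 / 4) : ℝ) * (64 * B ^ 2 * (a : ℝ) ^ (52 / 100 : ℝ)) /
        (a : ℝ) ^ (-(1 / 4) : ℝ) = 64 * B ^ 2 * ((a : ℝ) ^ (-(1 / 4) * (1 / 4) : ℝ) *
        (a : ℝ) ^ (52 / 100 : ℝ) / (a : ℝ) ^ (-(1 / 4) : ℝ)) := by ring
    rw [this, ← Real.rpow_add a0, ← Real.rpow_sub a0]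
    gcongr
    norm_num
  have j3 : ((a : ℝ) ^ (-(1 / 4) : ℝ)) ^ (3 / 4 : ℝ) * V₂ / (a : ℝ) ^ (-(1 / 4) : ℝ) ≤
      48 * B * (a : ℝ) ^ (3 / 4 : ℝ) := by
    rw [← Real.rpow_mul a0.le, hV₂]
    have : (a : ℝ) ^ (-(1 / 4) * (3 / 4) : ℝ) * (48 * B * (a : ℝ) ^ (63 / 100 : ℝ)) /
        (a : ℝ) ^ (-(1 / 4) : ℝ) = 48 * B * ((a : ℝ) ^ (-(1 / 4) * (3 / 4) : ℝ) *
        (a : ℝ) ^ (63 / 100 : ℝ) / (a : ℝ) ^ (-(1 / 4) : ℝ)) := by ring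
    rw [this, ← Real.rpow_add a0, ← Real.rpow_sub a0]
    gcongr
    norm_num
  set δ := (a : ℝ) ^ (-(1 / 4) : ℝ)
  have j4 : 3 * (zetaConst * (δ ^ (1 / 4 : ℝ) * V₁ + δ ^ (3 / 4 : ℝ) * V₂)) / δ =
      3 * (zetaConst * (δ ^ (1 / 4 : ℝ) * V₁ / δ + δ ^ (3 / 4 : ℝ) * V₂ / δ)) := by ring
  rw [j4]
  have j5 := mul_le_mul_of_nonneg_left (add_le_add j2 j3) zetaConst_nonneg
  linarith

/-- Dyadic summation of block estimates. -/
lemma norm_sum_le_of_dyadic {f : ℕ → ℂ} {M : ℕ} {K : ℝ} (hK : 0 ≤ K) (hM : 1 ≤ M)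
    (hf : ∀ a b : ℕ, M ≤ a → a ≤ b → b ≤ 2 * a →
      ‖∑ m ∈ Finset.Ico a b, f m‖ ≤ K * (a : ℝ) ^ (3 / 4 : ℝ)) (N : ℕ) (hN : M ≤ N) :
    ‖∑ m ∈ Finset.Ico M N, f m‖ ≤ 4 * K * (N : ℝ) ^ (3 / 4 : ℝ) := by
  induction N using Nat.strong_induction_on with
  | _ N ih =>
    have N0 : (0 : ℝ) < N := by exact_mod_cast lt_of_lt_of_le hM hN
    rcases le_or_gt N (2 * M) with h | h
    · refine (hf M N le_rfl hN h).trans ?_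
      have h1 : (M : ℝ) ^ (3 / 4 : ℝ) ≤ (N : ℝ) ^ (3 / 4 : ℝ) := by gcongr
      have h2 : 0 ≤ K * (N : ℝ) ^ (3 / 4 : ℝ) := by positivity
      have h3 := mul_le_mul_of_nonneg_left h1 hK
      linarith
    · set a := (N + 1) / 2 with ha
      have ha1 : M ≤ a := by omega
      have ha2 : a < N := by omega
      have ha3 : N ≤ 2 * a := by omega
      have ha4 : 3 * a ≤ 2 * N := by omega
      have i1 := ih a ha2 ha1
      have i2 := hf a N ha1 ha2.le ha3
      rw [← Finset.sum_Ico_consecutive f ha1 ha2.le]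
      refine (norm_add_le _ _).trans ?_
      have a1 : (a : ℝ) ≤ 2 / 3 * N := by
        have : (3 : ℝ) * a ≤ 2 * N := by exact_mod_cast ha4
        linarith
      have p1 : (a : ℝ) ^ (3 / 4 : ℝ) ≤ (4 / 5) * (N : ℝ) ^ (3 / 4 : ℝ) := by
        refine (Real.rpow_le_rpow (by positivity) a1 (by norm_num)).trans ?_
        rw [Real.mul_rpow (by norm_num) N0.le]
        gcongr
        have : ((2 / 3 : ℝ) ^ (3 / 4 : ℝ)) ^ 4 ≤ (4 / 5 : ℝ) ^ 4 := by
          rw [← Real.rpow_natCast, ← Real.rpow_mul (by norm_num)]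
          norm_num
        exact (pow_le_pow_iff_left₀ (by positivity) (by norm_num) (by norm_num)).1 this
      have p2 := mul_le_mul_of_nonneg_left p1 hK
      linarith

/-! ### The indicator of the values and its smooth model. -/

open Classical in
/-- The indicator sequence of the values `⌊h n⌋`, `n ≥ N₀`. -/
noncomputable def valueIndicator (h : ℝ → ℝ) (N₀ m : ℕ) : ℝ :=
  if ∃ n : ℕ, N₀ ≤ n ∧ ⌊h n⌋ = m then 1 else 0

lemma valueIndicator_le_one (h : ℝ → ℝ) (N₀ m : ℕ) : valueIndicator h N₀ m ≤ 1 := by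
  rw [valueIndicator]; split_ifs <;> norm_num

lemma valueIndicator_sq (h : ℝ → ℝ) (N₀ m : ℕ) :
    valueIndicator h N₀ m ^ 2 = valueIndicator h N₀ m := by
  rw [valueIndicator]; split_ifs <;> norm_num

lemma abs_sawtooth_le_one (x : ℝ) : |sawtooth x| ≤ 1 := by
  rw [sawtooth, abs_le]
  constructor <;> linarith [Int.fract_nonneg x, Int.fract_lt_one x]

lemma sawtooth_neg_eq (x : ℝ) : sawtooth (-x) = ⌈x⌉ - x - 1 / 2 := by
  rw [sawtooth, Int.fract, Int.floor_neg]
  push_cast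
  ring

namespace IsRegularlyVarying

variable {c x₀ : ℝ} {h φ : ℝ → ℝ} {N₀ : ℕ}

/-- The difference of ceilings counts the integers in $[\varphi(m),\varphi(m+1))$, that is, the $n$
with $\lfloor h(n)\rfloor=m$; injectivity allows at most one. The condition $h(N_0)\le m$ ensures
that every integer counted is at least $N_0$. -/
lemma valueIndicator_eq_ceil_sub_ceil (hh : IsRegularlyVarying c x₀ h)
    (hφ : InvOn φ h (Ici x₀) (Ici (h x₀))) (hN₀ : x₀ ≤ N₀)
    (hinj : InjOn (fun n : ℕ => ⌊h n⌋) (Ici N₀)) {m : ℕ} (hm : h N₀ ≤ m) :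
    valueIndicator h N₀ m = ((⌈φ ((m + 1 : ℕ) : ℝ)⌉ : ℝ) - ⌈φ m⌉) := by
  have h0 : h x₀ ≤ h N₀ := hh.strictMonoOn.monotoneOn self_mem_Ici hN₀ hN₀
  have hm0 : h x₀ ≤ m := h0.trans hm
  have hm1 : h x₀ ≤ ((m + 1 : ℕ) : ℝ) := by push_cast; linarith
  have hmem : ∀ n : ℕ, N₀ ≤ n → (⌊h n⌋ = m ↔ ⌈φ m⌉ ≤ (n : ℤ) ∧ (n : ℤ) < ⌈φ ((m + 1 : ℕ) : ℝ)⌉) := by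
    intro n hn
    have hxn : x₀ ≤ n := hN₀.trans (by exact_mod_cast hn)
    rw [Int.floor_eq_iff, Int.ceil_le, Int.lt_ceil, Int.cast_natCast, Int.cast_natCast,
      hh.inverse_le_iff hφ hxn hm0, ← not_le (a := φ _), hh.inverse_le_iff hφ hxn hm1, not_le]
    push_cast
    rfl
  have hge : ∀ n : ℤ, ⌈φ m⌉ ≤ n → ∃ k : ℕ, (k : ℤ) = n ∧ N₀ ≤ k := by
    intro n hn
    have h1 : (N₀ : ℝ) ≤ φ m := by
      have := (hh.strictMonoOn_inverse hφ).monotoneOn (mem_Ici.2 h0) (mem_Ici.2 hm0) hm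
      rwa [hφ.1 (mem_Ici.2 hN₀)] at this
    have h2 : (N₀ : ℤ) ≤ n := by
      have := h1.trans (Int.ceil_le.1 hn)
      exact_mod_cast this
    exact ⟨n.toNat, by omega, by omega⟩
  have hle : ⌈φ m⌉ ≤ ⌈φ ((m + 1 : ℕ) : ℝ)⌉ :=
    Int.ceil_mono ((hh.strictMonoOn_inverse hφ).monotoneOn (mem_Ici.2 hm0) (mem_Ici.2 hm1)
      (by push_cast; linarith))
  have hle2 : ⌈φ ((m + 1 : ℕ) : ℝ)⌉ ≤ ⌈φ m⌉ + 1 := by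
    by_contra hlt
    push Not at hlt
    obtain ⟨k₁, e1, l1⟩ := hge ⌈φ m⌉ le_rfl
    obtain ⟨k₂, e2, l2⟩ := hge (⌈φ m⌉ + 1) (by omega)
    have f1 := (hmem k₁ l1).2 ⟨by omega, by omega⟩
    have f2 := (hmem k₂ l2).2 ⟨by omega, by omega⟩
    have := hinj (mem_Ici.2 l1) (mem_Ici.2 l2) (f1.trans f2.symm)
    omega
  rw [valueIndicator]
  split_ifs with hex
  · obtain ⟨n, hn, hn2⟩ := hex
    have := (hmem n hn).1 hn2
    have e : ⌈φ ((m + 1 : ℕ) : ℝ)⌉ = ⌈φ m⌉ + 1 := by omega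
    rw [e]
    push_cast
    ring
  · have e : ⌈φ ((m + 1 : ℕ) : ℝ)⌉ = ⌈φ m⌉ := by
      by_contra hne
      obtain ⟨k, e1, l1⟩ := hge ⌈φ m⌉ le_rfl
      exact hex ⟨k, l1, (hmem k l1).2 ⟨by omega, by omega⟩⟩
    rw [e, sub_self]

/-- Twisted sums of `ψ(-φ(m))` for the inverse `φ` of a regularly varying function. -/
lemma exists_norm_sum_sawtooth_le (hh : IsRegularlyVarying c x₀ h)
    (hφ : InvOn φ h (Ici x₀) (Ici (h x₀))) (hc : c < 4 / 3) :
    ∃ K : ℝ, 0 ≤ K ∧ ∀ᶠ M : ℕ in atTop, ∀ N, M ≤ N → ∀ ξ : ℝ,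
      ‖∑ m ∈ Finset.Ico M N, (sawtooth (-φ m) : ℂ) * unitExp (m * ξ)‖ ≤
        K * (N : ℝ) ^ (3 / 4 : ℝ) := by
  have hc1 := hh.one_le_exponent
  have hγ : 3 / 4 ≤ 1 / c := by rw [le_div_iff₀ (by linarith)]; linarith
  have hγ1 : 1 / c ≤ 1 := (div_le_one (by linarith)).2 hc1
  obtain ⟨B, hB, hb⟩ := hh.exists_inverseCurvature_bounds hφ (show (0 : ℝ) < 1 / 100 by norm_num)
  obtain ⟨Y, hY⟩ := eventually_atTop.1 (hb.and ((eventually_gt_atTop (h x₀)).and (eventually_ge_atTop 1)))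
  have hY1 : 1 ≤ Y := (hY Y le_rfl).2.2
  set A := max B 1 with hA
  have hA1 : 1 ≤ A := le_max_right _ _
  have hK : 0 ≤ 2 + 3 * (zetaConst * (64 * A ^ 2 + 48 * A)) := by
    have := zetaConst_nonneg
    positivity
  refine ⟨4 * (2 + 3 * (zetaConst * (64 * A ^ 2 + 48 * A))), by positivity, ?_⟩
  filter_upwards [eventually_ge_atTop ⌈Y⌉₊] with M hM N hN ξ
  have hMY : Y ≤ M := Nat.ceil_le.1 hM
  have hM1 : 1 ≤ M := by
    have : (1 : ℝ) ≤ M := hY1.trans hMY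
    exact_mod_cast this
  refine norm_sum_le_of_dyadic (f := fun m => (sawtooth (-φ m) : ℂ) * unitExp (m * ξ)) hK hM1 ?_ N hN
  intro a b ha hab hba
  have haY : Y ≤ (a : ℝ) := hMY.trans (by exact_mod_cast ha)
  refine norm_sum_sawtooth_block_le (φ' := deriv φ) (s := inverseCurvature x₀ h φ) hY1 hγ hγ1 hA1
    ?_ ?_ ?_ ?_ haY hab hba ξ
  · exact fun x hx => (hh.hasDerivAt_inverse hφ (hY x hx).2.1).differentiableAt.hasDerivAt
  · exact fun x hx => hh.hasDerivAt_deriv_inverse hφ (hY x hx).2.1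
  · intro x hx
    have x0 : 0 < x := by linarith
    refine le_trans ?_ (hY x hx).1.1
    have : A⁻¹ ≤ B⁻¹ := inv_anti₀ hB (le_max_left _ _)
    gcongr
  · intro x hx
    have x0 : 0 < x := by linarith
    refine (hY x hx).1.2.trans ?_
    have : B ≤ A := le_max_left _ _
    gcongr

/-- The inverse is concave, so its increment lies between the derivatives at the two ends. The
resulting error telescopes when summed. -/
lemma abs_inverse_add_one_sub_sub_deriv_le (hh : IsRegularlyVarying c x₀ h)
    (hφ : InvOn φ h (Ici x₀) (Ici (h x₀))) {y : ℝ} (hy : h x₀ < y) :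
    |φ (y + 1) - φ y - deriv φ y| ≤ deriv φ y - deriv φ (y + 1) := by
  obtain ⟨z, hz, ez⟩ := exists_hasDerivAt_eq_slope φ (deriv φ) (show y < y + 1 by linarith)
    (fun x hx => (hh.continuousAt_inverse hφ (hy.trans_le hx.1)).continuousWithinAt)
    (fun x hx => (hh.hasDerivAt_inverse hφ (hy.trans hx.1)).differentiableAt.hasDerivAt)
  rw [add_sub_cancel_left, div_one] at ez
  rw [← ez]
  have a := hh.antitoneOn_deriv_inverse hφ
  have a1 := a (mem_Ioi.2 hy) (mem_Ioi.2 (hy.trans hz.1)) hz.1.le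
  have a2 := a (mem_Ioi.2 (hy.trans hz.1)) (mem_Ioi.2 (by linarith [hz.1, hz.2] : h x₀ < y + 1)) hz.2.le
  rw [abs_le]
  constructor <;> linarith

end IsRegularlyVarying

/-- Shifting the index only multiplies a twisted sum by a unit and changes a boundary term, so
increments cost no more than two sums of the sequence itself. -/
lemma norm_sum_Ico_diff_mul_unitExp_le (σ : ℕ → ℝ) (hσ : ∀ m, |σ m| ≤ 1) {M N : ℕ} (hMN : M ≤ N)
    (ξ : ℝ) :
    ‖∑ m ∈ Finset.Ico M N, ((σ (m + 1) - σ m : ℝ) : ℂ) * unitExp (m * ξ)‖ ≤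
      ‖∑ m ∈ Finset.Ico M (N + 1), (σ m : ℂ) * unitExp (m * ξ)‖ + 1 +
        ‖∑ m ∈ Finset.Ico M N, (σ m : ℂ) * unitExp (m * ξ)‖ := by
  set g : ℕ → ℂ := fun m => (σ m : ℂ) * unitExp (m * ξ) with hg
  have e : ∑ m ∈ Finset.Ico M N, ((σ (m + 1) - σ m : ℝ) : ℂ) * unitExp (m * ξ) =
      unitExp (-ξ) * (∑ m ∈ Finset.Ico M (N + 1), g m - g M) - ∑ m ∈ Finset.Ico M N, g m := by
    rw [Finset.sum_eq_sum_Ico_succ_bot (by omega : M < N + 1), add_sub_cancel_left,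
      ← Finset.sum_Ico_add' g M N 1, Finset.mul_sum, ← Finset.sum_sub_distrib]
    refine Finset.sum_congr rfl fun m _ => ?_
    simp only [hg]
    have : unitExp (m * ξ) = unitExp (-ξ) * unitExp (((m + 1 : ℕ) : ℝ) * ξ) := by
      rw [← unitExp_add]
      congr 1
      push_cast
      ring
    rw [Complex.ofReal_sub, sub_mul]
    congr 1
    rw [this]
    ring
  rw [e]
  refine (norm_sub_le _ _).trans ?_
  rw [norm_mul, norm_unitExp, one_mul]
  have h1 : ‖g M‖ ≤ 1 := by
    simp only [hg]
    rw [norm_mul, norm_unitExp, mul_one, Complex.norm_real]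
    exact hσ M
  have := norm_sub_le (∑ m ∈ Finset.Ico M (N + 1), g m) (g M)
  linarith

namespace IsRegularlyVarying

variable {c x₀ : ℝ} {h φ : ℝ → ℝ} {N₀ : ℕ}

/-- The value indicator is approximated by a sampled derivative of the inverse function, with a
uniform bound for the exponential sums of the difference. -/
lemma exists_model (hh : IsRegularlyVarying c x₀ h)
    (hφ : InvOn φ h (Ici x₀) (Ici (h x₀))) (hc : c < 4 / 3) (hN₀ : x₀ ≤ N₀)
    (hinj : InjOn (fun n : ℕ => ⌊h n⌋) (Ici N₀)) :
    ∃ u : ℕ → ℝ, RegularlyVaryingSeq (1 / c - 1) u ∧ (∀ᶠ n : ℕ in atTop, u n = deriv φ n) ∧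
      (∃ K : ℝ, 0 ≤ K ∧ ∀ᶠ n : ℕ in atTop, ∀ ξ : ℝ,
        ‖expSum (fun m => valueIndicator h N₀ m - u m) n ξ‖ ≤ K * (n : ℝ) ^ (3 / 4 : ℝ)) ∧
      ∀ ε : ℝ, 0 < ε → ∃ K : ℝ, 0 < K ∧ ∀ᶠ n : ℕ in atTop,
        ∑ m ∈ Finset.range (n + 1), valueIndicator h N₀ m ^ 2 ≤ K * (n : ℝ) ^ (1 / c + ε) ∧
        ∑ m ∈ Finset.range (n + 1), u m ^ 2 ≤ K * (n : ℝ) ^ (1 / c + ε) ∧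
        (n : ℝ) ^ (1 / c - 1 - ε) ≤ K * u n := by
  have hc1 := hh.one_le_exponent
  have hγ : 3 / 4 ≤ 1 / c := by rw [le_div_iff₀ (by linarith)]; linarith
  have hγ1 : 1 / c ≤ 1 := (div_le_one (by linarith)).2 hc1
  obtain ⟨K, hK, hsaw⟩ := hh.exists_norm_sum_sawtooth_le hφ hc
  have hseq := regularlyVaryingSeq_of_potter (G := deriv φ) (ρ := 1 / c - 1) (by linarith)
    ((eventually_gt_atTop (h x₀)).mono fun _ hy => hh.deriv_inverse_pos hφ hy)
    (fun ε hε => hh.exists_potter_deriv_inverse hφ hε)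
  obtain ⟨M, hM1, hM2, hM3, hM4⟩ := (hsaw.and (hseq.and ((tendsto_natCast_atTop_atTop (R := ℝ)).eventually
    ((eventually_gt_atTop (h x₀)).and (eventually_ge_atTop (h N₀)))))).exists
  -- Freezing the argument at `M` for small indices keeps the model positive and bounded everywhere
  -- without affecting asymptotics.
  set u : ℕ → ℝ := fun m => deriv φ (max m M : ℕ) with hu
  set F := valueIndicator h N₀
  have umax : ∀ m, u m ≤ deriv φ M := fun m => by
    have : (M : ℝ) ≤ (max m M : ℕ) := by exact_mod_cast le_max_right m M
    exact hh.antitoneOn_deriv_inverse hφ (mem_Ioi.2 hM3) (mem_Ioi.2 (hM3.trans_le this)) this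
  have hFm : ∀ m, M ≤ m → F m = ((⌈φ ((m + 1 : ℕ) : ℝ)⌉ : ℝ) - ⌈φ m⌉) := fun m hm =>
    hh.valueIndicator_eq_ceil_sub_ceil hφ hN₀ hinj (hM4.trans (by exact_mod_cast hm))
  have hgt : ∀ m : ℕ, M ≤ m → h x₀ < m := fun m hm => hM3.trans_le (by exact_mod_cast hm)
  set σ : ℕ → ℝ := fun m => sawtooth (-φ m) with hσ
  set r : ℕ → ℝ := fun m => φ ((m + 1 : ℕ) : ℝ) - φ m - deriv φ m with hr
  -- Deviation from the model splits into an oscillating sawtooth increment and the linearization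
  -- error of $\varphi$.
  have hD : ∀ m, M ≤ m → F m - u m = (σ (m + 1) - σ m) + r m := by
    intro m hm
    simp only [hσ, hr, hu, max_eq_left hm, hFm m hm, sawtooth_neg_eq]
    ring
  set K₀ := ∑ m ∈ Finset.range M, |F m - u m| with hK₀
  have hK₀0 : 0 ≤ K₀ := Finset.sum_nonneg fun _ _ => abs_nonneg _
  have dpos : 0 < deriv φ M := hh.deriv_inverse_pos hφ hM3
  have hexp : ∀ n : ℕ, M ≤ n → 1 ≤ n → ∀ ξ : ℝ, ‖expSum (fun m => F m - u m) n ξ‖ ≤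
      (K₀ + 1 + deriv φ M + 6 * K) * (n : ℝ) ^ (3 / 4 : ℝ) := by
    intro n hn hn1 ξ
    have n1 : (1 : ℝ) ≤ n := by exact_mod_cast hn1
    rw [expSum, Finset.range_eq_Ico, ← Finset.sum_Ico_consecutive _ (Nat.zero_le M) (by omega : M ≤ n + 1)]
    have b1 : ‖∑ m ∈ Finset.Ico 0 M, ((F m - u m : ℝ) : ℂ) * unitExp (m * ξ)‖ ≤ K₀ := by
      rw [hK₀, Finset.range_eq_Ico]
      refine norm_sum_le_of_le _ fun m _ => ?_
      rw [norm_mul, norm_unitExp, mul_one, Complex.norm_real, Real.norm_eq_abs]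
    have e2 : ∑ m ∈ Finset.Ico M (n + 1), ((F m - u m : ℝ) : ℂ) * unitExp (m * ξ) =
        ∑ m ∈ Finset.Ico M (n + 1), ((σ (m + 1) - σ m : ℝ) : ℂ) * unitExp (m * ξ) +
        ∑ m ∈ Finset.Ico M (n + 1), (r m : ℂ) * unitExp (m * ξ) := by
      rw [← Finset.sum_add_distrib]
      refine Finset.sum_congr rfl fun m hm => ?_
      rw [hD m (Finset.mem_Ico.1 hm).1]
      push_cast
      ring
    have b2 := norm_sum_Ico_diff_mul_unitExp_le σ (fun m => abs_sawtooth_le_one _)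
      (by omega : M ≤ n + 1) ξ
    have b3 := hM1 (n + 1 + 1) (by omega) ξ
    have b4 := hM1 (n + 1) (by omega) ξ
    have b5 : ‖∑ m ∈ Finset.Ico M (n + 1), (r m : ℂ) * unitExp (m * ξ)‖ ≤ deriv φ M := by
      have : ‖∑ m ∈ Finset.Ico M (n + 1), (r m : ℂ) * unitExp (m * ξ)‖ ≤
          ∑ m ∈ Finset.Ico M (n + 1), -(deriv φ ((m + 1 : ℕ) : ℝ) - deriv φ m) := by
        refine norm_sum_le_of_le _ fun m hm => ?_
        rw [norm_mul, norm_unitExp, mul_one, Complex.norm_real, Real.norm_eq_abs]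
        have := hh.abs_inverse_add_one_sub_sub_deriv_le hφ (hgt m (Finset.mem_Ico.1 hm).1)
        simp only [hr]
        push_cast
        linarith
      refine this.trans ?_
      rw [Finset.sum_neg_distrib, Finset.sum_Ico_sub (fun m : ℕ => deriv φ m) (by omega : M ≤ n + 1)]
      have := hh.deriv_inverse_pos hφ (hgt (n + 1) (by omega))
      linarith
    have p : ∀ k : ℕ, k ≤ 3 * n → (k : ℝ) ^ (3 / 4 : ℝ) ≤ 3 * (n : ℝ) ^ (3 / 4 : ℝ) := by
      intro k hk
      have h1 : (k : ℝ) ≤ 3 * n := by exact_mod_cast hk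
      refine (Real.rpow_le_rpow (by positivity) h1 (by norm_num)).trans ?_
      rw [Real.mul_rpow (by norm_num) (by positivity)]
      gcongr
      calc (3 : ℝ) ^ (3 / 4 : ℝ) ≤ 3 ^ (1 : ℝ) :=
            Real.rpow_le_rpow_of_exponent_le (by norm_num) (by norm_num)
        _ = 3 := Real.rpow_one 3
    have p1 := mul_le_mul_of_nonneg_left (p (n + 1 + 1) (by omega)) hK
    have p2 := mul_le_mul_of_nonneg_left (p (n + 1) (by omega)) hK
    have p3 : 1 ≤ (n : ℝ) ^ (3 / 4 : ℝ) := Real.one_le_rpow n1 (by norm_num)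
    have p4 : K₀ + 1 + deriv φ M ≤ (K₀ + 1 + deriv φ M) * (n : ℝ) ^ (3 / 4 : ℝ) :=
      le_mul_of_one_le_right (by positivity) p3
    rw [e2]
    refine (norm_add_le _ _).trans ?_
    refine (add_le_add b1 (norm_add_le _ _)).trans ?_
    simp only [hσ] at b2 ⊢
    linarith
  refine ⟨u, hM2, ?_, ⟨K₀ + 1 + deriv φ M + 6 * K, by positivity, ?_⟩, ?_⟩
  · filter_upwards [eventually_ge_atTop M] with n hn
    simp only [hu, max_eq_left hn]
  · filter_upwards [eventually_ge_atTop M, eventually_ge_atTop 1] with n hn hn1 using hexp n hn hn1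
  · intro ε hε
    obtain ⟨B, hB, hb⟩ := hh.exists_inverse_bounds hφ hε
    obtain ⟨B', hB', hb'⟩ := hh.exists_deriv_inverse_bounds hφ hε
    set K₁ := K₀ + 1 + deriv φ M + 6 * K with hK₁
    have hK₁0 : 0 ≤ K₁ := by positivity
    set L := M + 1 + B * 2 ^ (1 / c + ε) with hL
    have hL0 : 0 < L := by positivity
    refine ⟨max (max L (deriv φ M * (L + K₁))) B', lt_max_of_lt_right hB', ?_⟩
    have t1 := (tendsto_natCast_atTop_atTop (R := ℝ)).eventually hb'
    have t2 := ((tendsto_natCast_atTop_atTop (R := ℝ)).comp (tendsto_add_atTop_nat 1)).eventually hb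
    filter_upwards [eventually_ge_atTop M, eventually_ge_atTop 1, t1, t2] with n hn hn1 g1 g2
    simp only [Function.comp] at g2
    have n1 : (1 : ℝ) ≤ n := by exact_mod_cast hn1
    have n0 : (0 : ℝ) < n := by linarith
    have q1 : 1 ≤ (n : ℝ) ^ (1 / c + ε) := Real.one_le_rpow n1 (by linarith)
    have sF : ∑ m ∈ Finset.range (n + 1), F m ≤ L * (n : ℝ) ^ (1 / c + ε) := by
      rw [Finset.range_eq_Ico, ← Finset.sum_Ico_consecutive _ (Nat.zero_le M) (by omega : M ≤ n + 1)]
      have s1 : ∑ m ∈ Finset.Ico 0 M, F m ≤ M := by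
        refine (Finset.sum_le_card_nsmul _ _ 1 fun m _ => valueIndicator_le_one h N₀ m).trans ?_
        simp
      have s2 : ∑ m ∈ Finset.Ico M (n + 1), F m = (⌈φ ((n + 1 : ℕ) : ℝ)⌉ : ℝ) - ⌈φ M⌉ := by
        rw [← Finset.sum_Ico_sub (fun m : ℕ => (⌈φ m⌉ : ℝ)) (by omega : M ≤ n + 1)]
        exact Finset.sum_congr rfl fun m hm => hFm m (Finset.mem_Ico.1 hm).1
      have s3 : (⌈φ ((n + 1 : ℕ) : ℝ)⌉ : ℝ) < φ ((n + 1 : ℕ) : ℝ) + 1 := Int.ceil_lt_add_one _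
      have s4 : (0 : ℝ) ≤ (⌈φ M⌉ : ℝ) := by
        have a1 := hh.le_inverse hφ hM3.le
        have a2 := hh.one_le_start
        exact (by linarith : (0 : ℝ) ≤ φ M).trans (Int.le_ceil _)
      have s5 : φ ((n + 1 : ℕ) : ℝ) ≤ B * 2 ^ (1 / c + ε) * (n : ℝ) ^ (1 / c + ε) := by
        refine g2.2.trans ?_
        rw [mul_assoc, ← Real.mul_rpow (by norm_num) n0.le]
        gcongr
        push_cast
        linarith
      have s6 : ((M : ℝ) + 1) ≤ (M + 1) * (n : ℝ) ^ (1 / c + ε) :=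
        le_mul_of_one_le_right (by positivity) q1
      rw [hL]
      linarith
    -- Frequency zero of the exponential sum bound transfers the count of values to the model;
    -- $3/4\le1/c$ makes the error harmless.
    have su : ∑ m ∈ Finset.range (n + 1), u m ≤ (L + K₁) * (n : ℝ) ^ (1 / c + ε) := by
      have d := hexp n hn hn1 0
      rw [expSum] at d
      simp only [mul_zero, unitExp_zero, mul_one, ← Complex.ofReal_sum, Complex.norm_real,
        Real.norm_eq_abs, Finset.sum_sub_distrib] at d
      have d1 := (abs_le.1 d).1
      have d2 : (n : ℝ) ^ (3 / 4 : ℝ) ≤ (n : ℝ) ^ (1 / c + ε) :=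
        Real.rpow_le_rpow_of_exponent_le n1 (by linarith)
      have d3 := mul_le_mul_of_nonneg_left d2 hK₁0
      linarith
    refine ⟨?_, ?_, ?_⟩
    · have : ∀ m ∈ Finset.range (n + 1), F m ^ 2 = F m := fun m _ => valueIndicator_sq h N₀ m
      rw [Finset.sum_congr rfl this]
      refine sF.trans ?_
      gcongr
      exact (le_max_left _ _).trans (le_max_left _ _)
    · have : ∑ m ∈ Finset.range (n + 1), u m ^ 2 ≤ deriv φ M * ∑ m ∈ Finset.range (n + 1), u m := by
        rw [Finset.mul_sum]
        refine Finset.sum_le_sum fun m _ => ?_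
        rw [sq]
        exact mul_le_mul_of_nonneg_right (umax m) (hM2.pos m).le
      refine this.trans ((mul_le_mul_of_nonneg_left su dpos.le).trans ?_)
      rw [← mul_assoc]
      gcongr
      exact (le_max_right _ _).trans (le_max_left _ _)
    · have e : u n = deriv φ n := by simp only [hu, max_eq_left hn]
      have g := g1.1
      rw [inv_mul_le_iff₀ hB'] at g
      rw [e]
      refine g.trans ?_
      have : 0 < deriv φ n := hh.deriv_inverse_pos hφ (hgt n hn)
      gcongr
      exact le_max_right _ _

end IsRegularlyVarying

/-! ### Error terms, generating functions and conclusion. -/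

lemma isLittleO_coeff_triple {D u v W : ℕ → ℝ} {α β₁ β₂ μ K K₁ K₂ c : ℝ}
    (hexp : α + (β₁ + β₂) / 2 < μ)
    (hD : ∀ᶠ n : ℕ in atTop, ∀ ξ : ℝ, ‖expSum D n ξ‖ ≤ K * (n : ℝ) ^ α)
    (hu : ∀ᶠ n : ℕ in atTop, ∑ m ∈ Finset.range (n + 1), u m ^ 2 ≤ K₁ * (n : ℝ) ^ β₁)
    (hv : ∀ᶠ n : ℕ in atTop, ∑ m ∈ Finset.range (n + 1), v m ^ 2 ≤ K₂ * (n : ℝ) ^ β₂)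
    (hW : ∀ᶠ n : ℕ in atTop, (n : ℝ) ^ μ ≤ c * W n) :
    (fun n => PowerSeries.coeff n
      (PowerSeries.mk D * (PowerSeries.mk u * PowerSeries.mk v))) =o[atTop] W := by
  have h1 : (fun n => PowerSeries.coeff n
      (PowerSeries.mk D * (PowerSeries.mk u * PowerSeries.mk v))) =O[atTop]
      fun n : ℕ => (n : ℝ) ^ (α + (β₁ + β₂) / 2) := by
    refine IsBigO.of_bound (K * Real.sqrt (K₁ * K₂)) ?_
    filter_upwards [hD, hu, hv, eventually_ge_atTop 1] with n d a b hn
    have n0 : (0 : ℝ) < n := by exact_mod_cast hn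
    have key := abs_coeff_mul_mul_le D u v n d
    have hU : 0 ≤ ∑ m ∈ Finset.range (n + 1), u m ^ 2 := Finset.sum_nonneg fun _ _ => sq_nonneg _
    have hV : 0 ≤ ∑ m ∈ Finset.range (n + 1), v m ^ 2 := Finset.sum_nonneg fun _ _ => sq_nonneg _
    have p0 : 0 ≤ K * (n : ℝ) ^ α := (norm_nonneg _).trans (d 0)
    have p1 := mul_le_mul a b hV (hU.trans a)
    have e : Real.sqrt (K₁ * (n : ℝ) ^ β₁ * (K₂ * (n : ℝ) ^ β₂)) =
        Real.sqrt (K₁ * K₂) * (n : ℝ) ^ ((β₁ + β₂) / 2) := by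
      have e1 : K₁ * (n : ℝ) ^ β₁ * (K₂ * (n : ℝ) ^ β₂) =
          K₁ * K₂ * ((n : ℝ) ^ ((β₁ + β₂) / 2)) ^ 2 := by
        rw [← Real.rpow_natCast, ← Real.rpow_mul n0.le]
        have : (β₁ + β₂) / 2 * ((2 : ℕ) : ℝ) = β₁ + β₂ := by push_cast; ring
        rw [this, Real.rpow_add n0]
        ring
      rw [e1, Real.sqrt_mul' _ (by positivity), Real.sqrt_sq (by positivity)]
    rw [Real.norm_eq_abs, Real.norm_eq_abs, abs_of_pos (by positivity : 0 < (n : ℝ) ^ (α + (β₁ + β₂) / 2))]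
    refine key.trans ((mul_le_mul_of_nonneg_left (Real.sqrt_le_sqrt p1) p0).trans (le_of_eq ?_))
    rw [e, Real.rpow_add n0]
    ring
  have h2 : (fun n : ℕ => (n : ℝ) ^ (α + (β₁ + β₂) / 2)) =o[atTop] fun n : ℕ => (n : ℝ) ^ μ := by
    refine (isLittleO_iff_tendsto' ?_).2 ?_
    · filter_upwards [eventually_ge_atTop 1] with n hn h0
      have n0 : (0 : ℝ) < n := by exact_mod_cast hn
      exact absurd h0 (by positivity)
    · have := (tendsto_rpow_neg_atTop (sub_pos.2 hexp)).comp (tendsto_natCast_atTop_atTop (R := ℝ))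
      refine this.congr' ?_
      filter_upwards [eventually_ge_atTop 1] with n hn
      have n0 : (0 : ℝ) < n := by exact_mod_cast hn
      simp only [Function.comp]
      rw [← Real.rpow_sub n0]
      congr 1
      ring
  have h3 : (fun n : ℕ => (n : ℝ) ^ μ) =O[atTop] W := by
    refine IsBigO.of_bound |c| ?_
    filter_upwards [hW] with n hn
    rw [Real.norm_eq_abs, abs_of_nonneg (by positivity), Real.norm_eq_abs, ← abs_mul]
    exact hn.trans (le_abs_self _)
  exact (h1.trans_isLittleO h2).trans_isBigO h3

/-- The counting function of the arithmetic sphere as a coefficient of a product of generating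
functions. -/
lemma sphereCount_eq_coeff {c x₀ : Fin 3 → ℝ} {h : Fin 3 → ℝ → ℝ} {N₀ : ℕ}
    (hh : ∀ k, IsRegularlyVarying (c k) (x₀ k) (h k)) (hN₀ : ∀ k, x₀ k ≤ N₀)
    (hinj : ∀ k, InjOn (fun n : ℕ => ⌊h k n⌋) (Ici N₀)) (l : ℕ) :
    (sphereCount h N₀ l : ℝ) =
      PowerSeries.coeff l (∏ k, PowerSeries.mk (valueIndicator (h k) N₀)) := by
  classical
  rw [PowerSeries.coeff_prod]
  simp only [PowerSeries.coeff_mk, valueIndicator]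
  simp only [Finset.prod_ite_zero, Finset.prod_const_one, ← Finset.sum_filter, Finset.sum_const,
    nsmul_eq_mul, mul_one]
  congr 1
  have hnn : ∀ k, ∀ n : ℕ, N₀ ≤ n → 0 ≤ ⌊h k n⌋ := fun k n hn => by
    have : (N₀ : ℝ) ≤ n := by exact_mod_cast hn
    have := (hh k).one_le n (mem_Ici.2 ((hN₀ k).trans this))
    exact Int.floor_nonneg.2 (by linarith)
  -- Sending a point to its triple of values is injective on the sphere, and its image is the set of
  -- decompositions of `l` counted by the coefficient.
  set Φ : (Fin 3 → ℕ) → (Fin 3 →₀ ℕ) := fun x =>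
    Finsupp.equivFunOnFinite.symm fun k => ⌊h k (x k)⌋.toNat with hΦ
  have hΦk : ∀ x k, Φ x k = ⌊h k (x k)⌋.toNat := fun x k => rfl
  have hΦinj : InjOn Φ (arithmeticSphere h N₀ l) := by
    intro x hx y hy hxy
    ext k
    have e : Φ x k = Φ y k := by rw [hxy]
    rw [hΦk, hΦk] at e
    have hx0 := hnn k (x k) (hx.1 k)
    have hy0 := hnn k (y k) (hy.1 k)
    exact hinj k (mem_Ici.2 (hx.1 k)) (mem_Ici.2 (hy.1 k))
      (show ⌊h k (x k)⌋ = ⌊h k (y k)⌋ by omega)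
  rw [sphereCount, ← hΦinj.ncard_image, ← ncard_coe_finset]
  congr 1
  ext f
  simp only [mem_image, Finset.coe_filter, Finset.mem_finsuppAntidiag, Finset.mem_univ, mem_ofPred_eq,
    forall_true_left, Finset.subset_univ, and_true]
  constructor
  · rintro ⟨x, hx, rfl⟩
    refine ⟨?_, fun k => ⟨x k, hx.1 k, ?_⟩⟩
    · have h2 := hx.2
      have : ((∑ k, Φ x k : ℕ) : ℤ) = l := by
        rw [← h2]
        push_cast
        refine Finset.sum_congr rfl fun k _ => ?_
        rw [hΦk]
        exact Int.toNat_of_nonneg (hnn k (x k) (hx.1 k))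
      exact_mod_cast this
    · rw [hΦk]
      exact (Int.toNat_of_nonneg (hnn k (x k) (hx.1 k))).symm
  · rintro ⟨hsum, hf⟩
    choose x hx hfx using hf
    refine ⟨x, ⟨hx, ?_⟩, ?_⟩
    · simp only [hfx]
      exact_mod_cast hsum
    · ext k
      rw [hΦk, hfx k]
      simp

theorem theorem1p2 (c γ x₀ : Fin 3 → ℝ) (h φ : Fin 3 → ℝ → ℝ) (N₀ : ℕ)
    (hc : ∀ k, c k ∈ Ico (1 : ℝ) (4 / 3))
    (hγ : ∀ k, γ k = 1 / c k)
    (h₁ : 4 * (1 - γ 0) + 5 * (1 - γ 1) / 2 + 5 * (1 - γ 2) / 2 < 1)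
    (h₂ : 5 * (1 - γ 0) / 2 + 4 * (1 - γ 1) + 5 * (1 - γ 2) / 2 < 1)
    (h₃ : 5 * (1 - γ 0) / 2 + 5 * (1 - γ 1) / 2 + 4 * (1 - γ 2) < 1)
    (hh : ∀ k, IsRegularlyVarying (c k) (x₀ k) (h k))
    (hφ : ∀ k, InvOn (φ k) (h k) (Ici (x₀ k)) (Ici (h k (x₀ k))))
    (hN₀ : ∀ k, x₀ k ≤ N₀)
    (hinj : ∀ k, InjOn (fun n : ℕ => ⌊h k n⌋) (Ici N₀)) :
    (fun l : ℕ => (sphereCount h N₀ l : ℝ) -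
        Real.Gamma (γ 0) * Real.Gamma (γ 1) * Real.Gamma (γ 2) / Real.Gamma (γ 0 + γ 1 + γ 2) *
          ((l : ℝ) ^ 2 * deriv (φ 0) l * deriv (φ 1) l * deriv (φ 2) l))
      =o[atTop]
    (fun l : ℕ => (l : ℝ) ^ 2 * deriv (φ 0) l * deriv (φ 1) l * deriv (φ 2) l) := by
  have hγ1 : ∀ k, γ k ≤ 1 := fun k => by
    rw [hγ k]
    exact (div_le_one (by linarith [(hc k).1])).2 (hc k).1
  have hγ0 : ∀ k, 3 / 4 ≤ γ k := fun k => by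
    rw [hγ k, le_div_iff₀ (by linarith [(hc k).1])]
    linarith [(hc k).2]
  have model := fun k => (hh k).exists_model (hφ k) (hc k).2 (hN₀ k) (hinj k)
  simp only [← hγ] at model
  choose u hseq hud hexp hbd using model
  choose K hK0 hK using hexp
  set F : Fin 3 → ℕ → ℝ := fun k => valueIndicator (h k) N₀ with hF
  set W : ℕ → ℝ := fun n => (n : ℝ) ^ 2 * u 0 n * u 1 n * u 2 n with hW
  have a0 := hγ1 0
  have a1 := hγ1 1
  have a2 := hγ1 2
  obtain ⟨ε, hε, e0, e1, e2⟩ : ∃ ε : ℝ, 0 < ε ∧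
      3 / 4 + ((γ 1 + ε) + (γ 2 + ε)) / 2 < γ 0 + γ 1 + γ 2 - 1 - 3 * ε ∧
      3 / 4 + ((γ 0 + ε) + (γ 2 + ε)) / 2 < γ 0 + γ 1 + γ 2 - 1 - 3 * ε ∧
      3 / 4 + ((γ 0 + ε) + (γ 1 + ε)) / 2 < γ 0 + γ 1 + γ 2 - 1 - 3 * ε := by
    -- Each exponent inequality needs $4\varepsilon$ below one of these gaps, whence
    -- $\varepsilon=g/5$. Positivity follows from the hypotheses after lowering the coefficients
    -- $5/2$ to 2, which uses $\gamma_k\le1$.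
    set g := min (γ 0 + (γ 1 + γ 2) / 2 - 7 / 4)
      (min (γ 1 + (γ 0 + γ 2) / 2 - 7 / 4) (γ 2 + (γ 0 + γ 1) / 2 - 7 / 4)) with hg
    have g0 : 0 < g := lt_min (by linarith) (lt_min (by linarith) (by linarith))
    have g1 : g ≤ γ 0 + (γ 1 + γ 2) / 2 - 7 / 4 := min_le_left _ _
    have g2 : g ≤ γ 1 + (γ 0 + γ 2) / 2 - 7 / 4 := (min_le_right _ _).trans (min_le_left _ _)
    have g3 : g ≤ γ 2 + (γ 0 + γ 1) / 2 - 7 / 4 := (min_le_right _ _).trans (min_le_right _ _)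
    exact ⟨g / 5, by linarith, by linarith, by linarith, by linarith⟩
  choose L hL0 hL using fun k => hbd k ε hε
  have hWlow : ∀ᶠ n : ℕ in atTop, (n : ℝ) ^ (γ 0 + γ 1 + γ 2 - 1 - 3 * ε) ≤ (L 0 * L 1 * L 2) * W n := by
    filter_upwards [hL 0, hL 1, hL 2, eventually_ge_atTop 1] with n l0 l1 l2 hn
    have n0 : (0 : ℝ) < n := by exact_mod_cast hn
    have p := mul_le_mul (mul_le_mul l0.2.2 l1.2.2 (by positivity)
      (mul_nonneg (hL0 0).le ((hseq 0).pos n).le)) l2.2.2 (by positivity)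
      (mul_nonneg (mul_nonneg (hL0 0).le ((hseq 0).pos n).le)
        (mul_nonneg (hL0 1).le ((hseq 1).pos n).le))
    have e : (n : ℝ) ^ (γ 0 + γ 1 + γ 2 - 1 - 3 * ε) = (n : ℝ) ^ 2 *
        ((n : ℝ) ^ (γ 0 - 1 - ε) * (n : ℝ) ^ (γ 1 - 1 - ε) * (n : ℝ) ^ (γ 2 - 1 - ε)) := by
      rw [← Real.rpow_add n0, ← Real.rpow_add n0, ← Real.rpow_natCast, ← Real.rpow_add n0]
      congr 1
      push_cast
      ring
    rw [e]
    refine (mul_le_mul_of_nonneg_left p (by positivity)).trans (le_of_eq ?_)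
    simp only [hW]
    ring
  have hFb := fun k => (hL k).mono fun n hn => hn.1
  have hub := fun k => (hL k).mono fun n hn => hn.2.1
  have o0 := isLittleO_coeff_triple e0 (hK 0) (hFb 1) (hFb 2) hWlow
  have o1 := isLittleO_coeff_triple e1 (hK 1) (hub 0) (hFb 2) hWlow
  have o2 := isLittleO_coeff_triple e2 (hK 2) (hub 0) (hub 1) hWlow
  have lim := (hseq 0).tendsto_coeff_triple (by linarith [hγ0 0]) (by linarith [hγ0 1])
    (by linarith [hγ0 2]) (hseq 1) (hseq 2)
  simp only [sub_add_cancel] at lim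
  set Γ₃ := Real.Gamma (γ 0) * Real.Gamma (γ 1) * Real.Gamma (γ 2) / Real.Gamma (γ 0 + γ 1 + γ 2)
  have o3 : (fun n : ℕ => PowerSeries.coeff n (PowerSeries.mk (u 0) *
      (PowerSeries.mk (u 1) * PowerSeries.mk (u 2))) - Γ₃ * W n) =o[atTop] W := by
    have hW0 : ∀ᶠ n : ℕ in atTop, W n ≠ 0 := by
      filter_upwards [eventually_ge_atTop 1] with n hn
      have n0 : (0 : ℝ) < n := by exact_mod_cast hn
      have p0 := (hseq 0).pos n
      have p1 := (hseq 1).pos n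
      have p2 := (hseq 2).pos n
      simp only [hW]
      positivity
    refine (isLittleO_iff_tendsto' (hW0.mono fun n hn h0 => absurd h0 hn)).2 ?_
    have := lim.sub_const Γ₃
    rw [sub_self] at this
    refine this.congr' ?_
    filter_upwards [hW0] with n hn
    rw [sub_div, mul_div_cancel_right₀ _ hn]
  have hmk : ∀ k, PowerSeries.mk (fun m => valueIndicator (h k) N₀ m - u k m) =
      PowerSeries.mk (F k) - PowerSeries.mk (u k) := fun k => by
    ext n
    simp [hF]
  -- The three mixed products plus $u_0u_1u_2$ recombine to $F_0F_1F_2$ by a ring identity for power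
  -- series.
  have total := ((o0.add o1).add o2).add o3
  have hWeq : W =ᶠ[atTop] fun l : ℕ => (l : ℝ) ^ 2 * deriv (φ 0) l * deriv (φ 1) l * deriv (φ 2) l := by
    filter_upwards [hud 0, hud 1, hud 2] with n d0 d1 d2
    simp only [hW, d0, d1, d2]
  refine total.congr' ?_ hWeq
  filter_upwards [hWeq] with n hn
  rw [← hn, sphereCount_eq_coeff hh hN₀ hinj n, Fin.prod_univ_three, ← add_sub_assoc]
  congr 1
  simp only [← map_add]
  congr 1
  simp only [hmk, hF]
  ring
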